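/- **Setting.** Let $(U_i,\varepsilon_i)_{i\ge 1}$ be i.i.d. pairs of random variables with $U_i$ uniform on $[0,1]$, $E[\varepsilon_i\mid U_i]=0$, $0<\underline\sigma^2\le E[\varepsilon_i^2\mid U_i]\le\bar\sigma^2<\infty$ and $E[|\varepsilon_i|^3\mid U_i]\le\bar\kappa_3<\infty$. Let $f:[0,1]^2\to[0,1]$ be measurable with $\int_{[0,1]^2} f>0$, and let $p_n\in(0,1]$. For each $n$ the true network is the symmetric $n\times n$ matrix $A$ with $A_{ij}=A_{ji}=p_nf(U_i,U_j)$ for $i<j$ and $A_{ii}=0$. Write $\iota_n$ for the vector of ones, fix $T\ge 1$, $\delta\in(0,1]$ and $a_n>0$, and define the degree, diffusion and eigenvector centralities $$C^{(1)}=A\iota_n,\qquad C^{(T)}=\Big(\sum_{t=1}^T\delta^tA^t\Big)\iota_n,\qquad C^{(\infty)}=a_nv_1(A),$$ where $v_1(A)$ is an eigenvector of Euclidean norm one for the eigenvalue of $A$ of largest absolute value (the nonnegative one, if there is a tie $\pm\lambda$). For each $d\in\{1,T,\infty\}$ separately, with $\beta^{(d)}\in\mathbb R$ fixed, suppose $Y_i=\beta^{(d)}C^{(d)}_i+\varepsilon_i$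 for $i\le n$, and let $$\tilde\beta^{(d)}=\frac{Y'C^{(d)}}{(C^{(d)})'C^{(d)}}$$ be the OLS estimator when $A$ is observed (read as $0$ if $C^{(d)}=0$). **Theorem 1.** (a) For $d\in\{1,T\}$: $\tilde\beta^{(d)}\to\beta^{(d)}$ in probability as $n\to\infty$ if and only if $p_n\succ n^{-3/2}$, that is, $p_n/n^{-3/2}\to\infty$. (b) Suppose in addition that $f$ is symmetric and that $\lambda_1(f)\ne\lambda_2(f)$, that is, the leading (largest) eigenvalue of the integral operator $g\mapsto\int_0^1 f(\cdot,y)g(y)\,dy$ on $L^2[0,1]$ has multiplicity one. Then the leading eigenvalue of $A$ has multiplicity one with probability tending to one (so that $v_1(A)$ is well defined up to sign), and, whichever unit leading eigenvector $v_1(A)$ is taken, $\tilde\beta^{(\infty)}\to\beta^{(\infty)}$ in probability if and only if $a_n\to\infty$. -/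

import Mathlib

open MeasureTheory ProbabilityTheory Filter Topology
open scoped unitInterval Matrix

noncomputable section

namespace CentralityOLS

/-- The link function `f : [0,1]² → [0,1]`: measurable, with positive integral.
Symmetry is not required here. -/
structure IsGraphon (f : I → I → ℝ) : Prop where
  measurable : Measurable (fun z : I × I => f z.1 z.2)
  nonneg : ∀ u v, 0 ≤ f u v
  le_one : ∀ u v, f u v ≤ 1
  integral_pos : 0 < ∫ z : I × I, f z.1 z.2

/-- The pairs `(U i, ε i)`, `i = 0, 1, 2, …`, are independent and identically distributed random
variables, and every latent type `U i` is uniform on `[0,1]`. -/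
structure IsSample {Ω : Type*} [MeasurableSpace Ω] (P : Measure Ω)
    (U : ℕ → Ω → I) (ε : ℕ → Ω → ℝ) : Prop where
  measurable_type : ∀ i, Measurable (U i)
  measurable_error : ∀ i, Measurable (ε i)
  indep : iIndepFun (fun i ω => (U i ω, ε i ω)) P
  identDistrib : ∀ i, IdentDistrib (fun ω => (U i ω, ε i ω)) (fun ω => (U 0 ω, ε 0 ω)) P P
  uniform : ∀ i, P.map (U i) = volume

/-- Conditional moments of the errors given the types, with variance bounds `lo` (for `σ̲²`) and
`hi` (for `σ̄²`) and third-moment bound `κ`.  The field `memLp` (finiteness of `E|ε i|³`, which the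
last bound contains) makes the Bochner conditional expectations meaningful. -/
structure ErrorMoments {Ω : Type*} [MeasurableSpace Ω] (P : Measure Ω)
    (U : ℕ → Ω → I) (ε : ℕ → Ω → ℝ) (lo hi κ : ℝ) : Prop where
  lo_pos : 0 < lo
  memLp : ∀ i, MemLp (ε i) 3 P
  mean : ∀ i, P[ε i | MeasurableSpace.comap (U i) inferInstance] =ᵐ[P] fun _ => 0
  var_lower : ∀ i, ∀ᵐ ω ∂P,
    lo ≤ (P[fun ω' => ε i ω' ^ 2 | MeasurableSpace.comap (U i) inferInstance]) ω
  var_upper : ∀ i, ∀ᵐ ω ∂P,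
    (P[fun ω' => ε i ω' ^ 2 | MeasurableSpace.comap (U i) inferInstance]) ω ≤ hi
  third : ∀ i, ∀ᵐ ω ∂P,
    (P[fun ω' => |ε i ω'| ^ 3 | MeasurableSpace.comap (U i) inferInstance]) ω ≤ κ

/-- The symmetric adjacency matrix with entries `p * f (u i) (u j)` for `i < j` and zero
diagonal. -/
def adjacency (f : I → I → ℝ) (p : ℝ) {n : ℕ} (u : Fin n → I) : Matrix (Fin n) (Fin n) ℝ :=
  Matrix.of fun i j => if i = j then 0 else p * f (u (min i j)) (u (max i j))

/-- The true network `A` of the first `n` agents. -/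
def network {Ω : Type*} (f : I → I → ℝ) (p : ℕ → ℝ) (U : ℕ → Ω → I) (n : ℕ) (ω : Ω) :
    Matrix (Fin n) (Fin n) ℝ :=
  adjacency f (p n) fun i => U i ω

/-- Degree centrality `A ι`. -/
def degreeCentrality {n : ℕ} (A : Matrix (Fin n) (Fin n) ℝ) : Fin n → ℝ :=
  A *ᵥ fun _ => 1

/-- Diffusion centrality `(∑_{t=1}^T δ^t A^t) ι`. -/
def diffusionCentrality (δ : ℝ) (T : ℕ) {n : ℕ} (A : Matrix (Fin n) (Fin n) ℝ) : Fin n → ℝ :=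
  (∑ t ∈ Finset.Icc 1 T, δ ^ t • A ^ t) *ᵥ fun _ => 1

/-- `l` is the eigenvalue of `A` of largest absolute value.  For a matrix with nonnegative
entries the spectral radius is an eigenvalue (Perron-Frobenius), so such an `l ≥ 0` exists when
`0 < n`; if `-l` is an eigenvalue too, the leading one is `l`, whose eigenvector can be chosen
nonnegative. -/
def IsLeadingEigenvalue {n : ℕ} (A : Matrix (Fin n) (Fin n) ℝ) (l : ℝ) : Prop :=
  Module.End.HasEigenvalue (Matrix.toLin' A) l ∧
    ∀ m, Module.End.HasEigenvalue (Matrix.toLin' A) m → |m| ≤ l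

/-- `v` is an eigenvector of Euclidean length one for the leading eigenvalue of `A`. -/
def IsLeadingEigenvector {n : ℕ} (A : Matrix (Fin n) (Fin n) ℝ) (v : Fin n → ℝ) : Prop :=
  v ⬝ᵥ v = 1 ∧ ∃ l, IsLeadingEigenvalue A l ∧ A *ᵥ v = l • v

/-- The leading eigenvalue of `A` has multiplicity one. -/
def LeadingEigenvalueSimple {n : ℕ} (A : Matrix (Fin n) (Fin n) ℝ) : Prop :=
  ∃ l, IsLeadingEigenvalue A l ∧
    Module.finrank ℝ (Module.End.eigenspace (Matrix.toLin' A) l) = 1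

/-- `g` is an eigenfunction in `L²[0,1]`, with eigenvalue `l`, of the integral operator with
kernel `f`. -/
def IsEigenfunction (f : I → I → ℝ) (l : ℝ) (g : I → ℝ) : Prop :=
  MemLp g 2 volume ∧ ¬ (g =ᵐ[volume] fun _ => 0) ∧
    ∀ᵐ x : I, ∫ y : I, f x y * g y = l * g x

/-- `f` is symmetric and the leading eigenvalue of its integral operator has multiplicity one,
that is, `λ₁(f) ≠ λ₂(f)` for the eigenvalues counted with multiplicity. -/
def GraphonLeadingSimple (f : I → I → ℝ) : Prop :=
  (∀ u v, f u v = f v u) ∧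
    ∃ l, (∃ g, IsEigenfunction f l g) ∧ (∀ m g, IsEigenfunction f m g → |m| ≤ l) ∧
      ∀ g h, IsEigenfunction f l g → IsEigenfunction f l h → ∃ c : ℝ, h =ᵐ[volume] fun x => c * g x

/-- The least squares slope (without intercept) in the regression of `Y` on `C`. -/
def olsSlope {n : ℕ} (Y C : Fin n → ℝ) : ℝ := (Y ⬝ᵥ C) / (C ⬝ᵥ C)

/-- The outcomes `Y_i = β C_i + ε_i`, `i < n`. -/
def outcome {Ω : Type*} (β : ℝ) (ε : ℕ → Ω → ℝ) (C : (n : ℕ) → Ω → Fin n → ℝ) (n : ℕ) (ω : Ω) :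
    Fin n → ℝ :=
  fun i => β * C n ω i + ε i ω

/-- Least squares of the outcomes on the centrality `C` is consistent for the slope `β`:
convergence in probability as `n → ∞`. -/
def OLSConsistent {Ω : Type*} [MeasurableSpace Ω] (P : Measure Ω) (β : ℝ) (ε : ℕ → Ω → ℝ)
    (C : (n : ℕ) → Ω → Fin n → ℝ) : Prop :=
  TendstoInMeasure P (fun n ω => olsSlope (outcome β ε C n ω) (C n ω)) atTop (fun _ => β)

end CentralityOLS

end

/-! With the regressor `C` nonzero, the error of the slope is `ε'C / C'C`, that is, a score `ε'c`
with unit weights `c = C/‖C‖` divided by `‖C‖`. The weights depend on the types only, so the score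
has the same order for every `n` and every choice of unit weights. Its second moment lies between
`lo` and `hi`, so Chebyshev bounds it above. Its third absolute moment is bounded by a constant, so
the second moment cannot come from rare large values, and the score stays away from zero with
probability bounded below (`le_measure_score_ge`). Consistency is therefore equivalent to divergence
of the order of `‖C‖`; this is `tendstoInMeasure_iff`, which ignores events of vanishing
probability.

For degree and diffusion, a law of large numbers over pairs puts the total weight of the network
above a multiple of `p n * n ^ 2`. Cauchy-Schwarz then gives `‖C‖` at least of order `p n * n ^
(3/2)`. When that quantity is bounded, `n * p n` is bounded too, the higher powers of `A` add only a
constant factor, and `‖C‖` is bounded.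

For the eigenvector centrality `‖C‖ = a n` exactly. What remains is to replace an arbitrary,
possibly nonmeasurable, leading eigenvector by a measurable function of the types. Power iteration
provides one, and the two agree up to sign when the leading eigenvalue is simple.

Simplicity of the sampled eigenvalue is deduced from quadratic forms, without convergence of
spectra. The integral operator is compact, so a simple top eigenvalue `l` has a gap: `f - l φ⊗φ` has
form at most `μ < l` (`exists_gap`). That kernel is close in `L²` to a step kernel, whose sampled
form is controlled by cell counts. Hence, up to a term of rank one, the form of `A` is at most about
`p n * μ * n`, while at the sampled `φ` its Rayleigh quotient is about `p n * l * n`. Two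
independent top eigenvectors cannot coexist (`leadingEigenvalueSimple_of_form_le`). -/

namespace CentralityOLS

/-! ### Conditional moments of the errors and independence across agents -/

section Conditional

variable {Ω α 𝒵 : Type*} [MeasurableSpace Ω] [MeasurableSpace α] [MeasurableSpace 𝒵]
  {P : Measure Ω} [IsProbabilityMeasure P]

/-- An upper bound for a conditional moment of `e` given `X` survives multiplication by a
nonnegative function of `X`. -/
lemma integral_mul_comp_le_of_condExp_le {X : Ω → α} (hX : Measurable X) {e : Ω → ℝ}
    (he : Integrable e P) {b : ℝ} (hb : ∀ᵐ ω ∂P, (P[e | MeasurableSpace.comap X inferInstance]) ω ≤ b)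
    {g : α → ℝ} (hg : Measurable g) (hg0 : ∀ x, 0 ≤ g x)
    (hI : Integrable (fun ω => e ω * g (X ω)) P) (hgI : Integrable (fun ω => g (X ω)) P) :
    ∫ ω, e ω * g (X ω) ∂P ≤ b * ∫ ω, g (X ω) ∂P := by
  have hm := hX.comap_le
  have hgm : StronglyMeasurable[MeasurableSpace.comap X inferInstance] (fun ω => g (X ω)) :=
    (hg.comp (comap_measurable X)).stronglyMeasurable
  rw [← integral_condExp hm, ← integral_const_mul]
  refine integral_mono_ae integrable_condExp (hgI.const_mul b) ?_
  filter_upwards [condExp_mul_of_stronglyMeasurable_right hgm hI he, hb] with ω h1 h2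
  have h3 : (P[fun ω => e ω * g (X ω) | MeasurableSpace.comap X inferInstance]) ω
    = (P[e | MeasurableSpace.comap X inferInstance]) ω * g (X ω) := h1
  rw [h3]
  exact mul_le_mul_of_nonneg_right h2 (hg0 _)

/-- The bound of `integral_mul_comp_le_of_condExp_le` with a weight that may also depend on a
variable independent of the pair `(X, e)`. -/
lemma integral_mul_comp_le_of_indepFun {X : Ω → α} (hX : Measurable X) {e : Ω → ℝ}
    (he : Measurable e) {Z : Ω → 𝒵} (hZ : Measurable Z)
    (hind : IndepFun (fun ω => (X ω, e ω)) Z P) {ψ : ℝ → ℝ} (hψ : Measurable ψ)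
    (hψI : Integrable (fun ω => ψ (e ω)) P) {b : ℝ}
    (hb : ∀ᵐ ω ∂P, (P[fun ω => ψ (e ω) | MeasurableSpace.comap X inferInstance]) ω ≤ b)
    {G : α × 𝒵 → ℝ} (hG : Measurable G) (hG0 : ∀ x, 0 ≤ G x)
    (hI : Integrable (fun ω => ψ (e ω) * G (X ω, Z ω)) P)
    (hGI : Integrable (fun ω => G (X ω, Z ω)) P) :
    ∫ ω, ψ (e ω) * G (X ω, Z ω) ∂P ≤ b * ∫ ω, G (X ω, Z ω) ∂P := by
  have hXe : Measurable fun ω => (X ω, e ω) := hX.prodMk he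
  have hmap := hind.map_prod_eq_prod_map_map hXe.aemeasurable hZ.aemeasurable
  have hW : Measurable fun ω => ((X ω, e ω), Z ω) := hXe.prodMk hZ
  set ν := P.map fun ω => (X ω, e ω) with hν
  set ρ := P.map Z with hρ
  have : IsProbabilityMeasure ν := Measure.isProbabilityMeasure_map hXe.aemeasurable
  have : IsProbabilityMeasure ρ := Measure.isProbabilityMeasure_map hZ.aemeasurable
  let F : (α × ℝ) × 𝒵 → ℝ := fun w => ψ w.1.2 * G (w.1.1, w.2)
  let F' : (α × ℝ) × 𝒵 → ℝ := fun w => G (w.1.1, w.2)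
  have hF : Measurable F := by fun_prop
  have hF' : Measurable F' := by fun_prop
  have e1 : ∫ ω, ψ (e ω) * G (X ω, Z ω) ∂P = ∫ w, F w ∂(ν.prod ρ) := by
    rw [← hmap, integral_map hW.aemeasurable hF.aestronglyMeasurable]
  have e2 : ∫ ω, G (X ω, Z ω) ∂P = ∫ w, F' w ∂(ν.prod ρ) := by
    rw [← hmap, integral_map hW.aemeasurable hF'.aestronglyMeasurable]
  have i1 : Integrable F (ν.prod ρ) := by
    rw [← hmap, integrable_map_measure hF.aestronglyMeasurable hW.aemeasurable]; exact hI
  have i2 : Integrable F' (ν.prod ρ) := by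
    rw [← hmap, integrable_map_measure hF'.aestronglyMeasurable hW.aemeasurable]; exact hGI
  -- Fubini with the independent variable outermost: for each fixed `z` the weight is a function of
  -- `X` alone, and the previous lemma applies.
  rw [e1, e2, integral_prod_symm _ i1, integral_prod_symm _ i2, ← integral_const_mul]
  refine integral_mono_ae i1.integral_prod_right (i2.integral_prod_right.const_mul b) ?_
  filter_upwards [i1.prod_left_ae, i2.prod_left_ae] with z h1 h2
  have m1 : Measurable fun x : α × ℝ => F (x, z) := by fun_prop
  have m2 : Measurable fun x : α × ℝ => F' (x, z) := by fun_prop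
  rw [hν, integral_map hXe.aemeasurable m1.aestronglyMeasurable,
    integral_map hXe.aemeasurable m2.aestronglyMeasurable]
  rw [hν, integrable_map_measure m1.aestronglyMeasurable hXe.aemeasurable] at h1
  rw [hν, integrable_map_measure m2.aestronglyMeasurable hXe.aemeasurable] at h2
  exact integral_mul_comp_le_of_condExp_le (g := fun x => G (x, z)) hX hψI hb (by fun_prop)
    (fun _ => hG0 _) h1 h2

end Conditional

variable {Ω : Type*} [MeasurableSpace Ω] {P : Measure Ω}
  {U : ℕ → Ω → I} {ε : ℕ → Ω → ℝ}

/-- The latent types of the first `n` agents. -/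
def types (U : ℕ → Ω → I) (n : ℕ) (ω : Ω) : Fin n → I := fun i => U i ω

/-- The errors of the first `n` agents. -/
def errors (ε : ℕ → Ω → ℝ) (n : ℕ) (ω : Ω) : Fin n → ℝ := fun i => ε i ω

lemma IsSample.measurable_types (hU : IsSample P U ε) (n : ℕ) : Measurable (types U n) :=
  measurable_pi_lambda _ fun i => hU.measurable_type i

lemma IsSample.measurable_errors (hU : IsSample P U ε) (n : ℕ) : Measurable (errors ε n) :=
  measurable_pi_lambda _ fun i => hU.measurable_error i

variable [IsProbabilityMeasure P]

/-- A bound for a conditional moment of `ε k` given `U k` survives multiplication by a nonnegative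
function of all types and of the other errors. -/
lemma IsSample.integral_mul_le (hU : IsSample P U ε) {n : ℕ} (k : Fin n) {ψ : ℝ → ℝ}
    (hψ : Measurable ψ) (hψI : Integrable (fun ω => ψ (ε k ω)) P) {b : ℝ}
    (hb : ∀ᵐ ω ∂P, (P[fun ω => ψ (ε k ω) | MeasurableSpace.comap (U k) inferInstance]) ω ≤ b)
    {G : (Fin n → I) → (Fin n → ℝ) → ℝ} (hG : Measurable (Function.uncurry G))
    (hG0 : ∀ u e, 0 ≤ G u e) (hGk : ∀ u e x, G u (Function.update e k x) = G u e)
    (hI : Integrable (fun ω => ψ (ε k ω) * G (types U n ω) (errors ε n ω)) P)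
    (hGI : Integrable (fun ω => G (types U n ω) (errors ε n ω)) P) :
    ∫ ω, ψ (ε k ω) * G (types U n ω) (errors ε n ω) ∂P
      ≤ b * ∫ ω, G (types U n ω) (errors ε n ω) ∂P := by
  classical
  set T : Finset ℕ := (Finset.range n).erase k with hT
  let X : ℕ → Ω → I × ℝ := fun i ω => (U i ω, ε i ω)
  have hXm : ∀ i, Measurable (X i) := fun i => (hU.measurable_type i).prodMk (hU.measurable_error i)
  have h0 := hU.indep.indepFun_finset {(k : ℕ)} T (by simp [hT]) hXm
  let Z : Ω → (T → I × ℝ) := fun ω j => X j ω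
  have hZ : Measurable Z := measurable_pi_lambda _ fun j => hXm j
  have hind : IndepFun (fun ω => (U k ω, ε k ω)) Z P := by
    refine h0.comp (φ := fun w : (({(k : ℕ)} : Finset ℕ) → I × ℝ) => w ⟨k, by simp⟩) (ψ := id)
      (by fun_prop) measurable_id
  have hmem : ∀ i : Fin n, i ≠ k → (i : ℕ) ∈ T := fun i hi => by
    simp [hT, Fin.val_inj, hi]
  let uu : I × (T → I × ℝ) → Fin n → I := fun w i =>
    if h : i = k then w.1 else (w.2 ⟨i, hmem i h⟩).1
  -- The `k`-th error is not available from `(U k, Z)`; the value `0` stands in for it, harmlessly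
  -- because of `hGk`.
  let ee : I × (T → I × ℝ) → Fin n → ℝ := fun w i =>
    if h : i = k then 0 else (w.2 ⟨i, hmem i h⟩).2
  have huu : Measurable uu := by
    refine measurable_pi_lambda _ fun i => ?_
    by_cases h : i = k
    · simp only [uu, h, dite_true]; exact measurable_fst
    · simp only [uu, h, dite_false]; fun_prop
  have hee : Measurable ee := by
    refine measurable_pi_lambda _ fun i => ?_
    by_cases h : i = k
    · simp only [ee, h, dite_true]; exact measurable_const
    · simp only [ee, h, dite_false]; fun_prop
  have key : ∀ ω, G (uu (U k ω, Z ω)) (ee (U k ω, Z ω)) = G (types U n ω) (errors ε n ω) := by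
    intro ω
    have h1 : uu (U k ω, Z ω) = types U n ω := by
      funext i
      by_cases h : i = k
      · simp [uu, h, types]
      · simp [uu, h, types, Z, X]
    have h2 : ee (U k ω, Z ω) = Function.update (errors ε n ω) k 0 := by
      funext i
      by_cases h : i = k
      · subst h; simp [ee]
      · simp [ee, h, errors, Z, X]
    rw [h1, h2, hGk]
  have := integral_mul_comp_le_of_indepFun (hU.measurable_type k) (hU.measurable_error k) hZ hind
    hψ hψI hb (G := fun w => G (uu w) (ee w)) (hG.comp (huu.prodMk hee)) (fun _ => hG0 _ _)
    (by simpa only [key] using hI) (by simpa only [key] using hGI)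
  simpa only [key] using this

/-- If the conditional mean of `ψ (ε k)` given `U k` is zero, then `ψ (ε k)` is orthogonal to the
functions of all types and of the other errors. -/
lemma ErrorMoments.integral_mul_eq_zero {lo hi κ : ℝ} (hε : ErrorMoments P U ε lo hi κ)
    (hU : IsSample P U ε) {n : ℕ} (k : Fin n)
    {G : (Fin n → I) → (Fin n → ℝ) → ℝ} (hG : Measurable (Function.uncurry G))
    (hGk : ∀ u e x, G u (Function.update e k x) = G u e)
    (hI : Integrable (fun ω => ε k ω * G (types U n ω) (errors ε n ω)) P)
    (hGI : Integrable (fun ω => G (types U n ω) (errors ε n ω)) P) :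
    ∫ ω, ε k ω * G (types U n ω) (errors ε n ω) ∂P = 0 := by
  have hεI : Integrable (ε k) P := (hε.memLp k).integrable (by norm_num)
  -- For nonnegative weights, the upper bound with `b = 0` is applied to the error and to its
  -- negative. A general weight is then split into its positive and negative parts, neither of which
  -- involves the `k`-th error.
  have nonpos : ∀ G : (Fin n → I) → (Fin n → ℝ) → ℝ, Measurable (Function.uncurry G) →
      (∀ u e x, G u (Function.update e k x) = G u e) → (∀ u e, 0 ≤ G u e) →
      Integrable (fun ω => ε k ω * G (types U n ω) (errors ε n ω)) P →
      Integrable (fun ω => G (types U n ω) (errors ε n ω)) P →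
      ∫ ω, ε k ω * G (types U n ω) (errors ε n ω) ∂P = 0 := by
    intro G hG hGk hG0 hI hGI
    refine le_antisymm ?_ ?_
    · simpa using hU.integral_mul_le k (ψ := fun x => x) measurable_id hεI (b := 0)
        ((hε.mean k).mono fun ω h => h.le) hG hG0 hGk hI hGI
    · have hb : ∀ᵐ ω ∂P, (P[fun ω => -ε k ω | MeasurableSpace.comap (U k) inferInstance]) ω ≤ 0 := by
        filter_upwards [condExp_neg (μ := P) (ε k) (MeasurableSpace.comap (U k) inferInstance),
          hε.mean k] with ω h1 h2
        have h3 : (P[fun ω => -ε k ω | MeasurableSpace.comap (U k) inferInstance]) ω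
          = -(P[ε k | MeasurableSpace.comap (U k) inferInstance]) ω := h1
        rw [h3, h2, neg_zero]
      have := hU.integral_mul_le k (ψ := fun x => -x) measurable_neg hεI.neg (b := 0) hb hG hG0 hGk
        (hI.neg.congr (ae_of_all _ fun ω => by simp)) hGI
      simp only [neg_mul, integral_neg, zero_mul] at this
      linarith
  have ha : ∀ x : ℝ, x = max x 0 - max (-x) 0 := fun x => by
    rcases le_total x 0 with h | h
    · rw [max_eq_right h, max_eq_left (by linarith)]; ring
    · rw [max_eq_left h, max_eq_right (by linarith)]; ring
  have hUε : Measurable fun ω => Function.uncurry G (types U n ω, errors ε n ω) :=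
    hG.comp ((hU.measurable_types n).prodMk (hU.measurable_errors n))
  have I1 : Integrable (fun ω => ε k ω * max (G (types U n ω) (errors ε n ω)) 0) P := by
    refine hI.mono ?_ (ae_of_all _ fun ω => ?_)
    · exact ((hU.measurable_error k).mul (hUε.max measurable_const)).aestronglyMeasurable
    · rw [norm_mul, norm_mul]
      refine mul_le_mul_of_nonneg_left ?_ (norm_nonneg _)
      rw [Real.norm_eq_abs, Real.norm_eq_abs, abs_of_nonneg (le_max_right _ _)]
      exact max_le (le_abs_self _) (abs_nonneg _)
  have I2 : Integrable (fun ω => ε k ω * max (-G (types U n ω) (errors ε n ω)) 0) P := by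
    refine hI.mono ?_ (ae_of_all _ fun ω => ?_)
    · exact ((hU.measurable_error k).mul (hUε.neg.max measurable_const)).aestronglyMeasurable
    · rw [norm_mul, norm_mul]
      refine mul_le_mul_of_nonneg_left ?_ (norm_nonneg _)
      rw [Real.norm_eq_abs, Real.norm_eq_abs, abs_of_nonneg (le_max_right _ _)]
      exact max_le (neg_le_abs _) (abs_nonneg _)
  have z1 := nonpos (fun u e => max (G u e) 0) (hG.max measurable_const)
    (fun u e x => by simp only [hGk]) (fun _ _ => le_max_right _ _) I1 hGI.pos_part
  have z2 := nonpos (fun u e => max (-G u e) 0) (hG.neg.max measurable_const)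
    (fun u e x => by simp only [hGk]) (fun _ _ => le_max_right _ _) I2 hGI.neg.pos_part
  calc ∫ ω, ε k ω * G (types U n ω) (errors ε n ω) ∂P
      = ∫ ω, (ε k ω * max (G (types U n ω) (errors ε n ω)) 0
          - ε k ω * max (-G (types U n ω) (errors ε n ω)) 0) ∂P := by
        congr 1; funext ω; rw [← mul_sub, ← ha]
    _ = 0 := by rw [integral_sub I1 I2, z1, z2, sub_zero]

end CentralityOLS

/-! ### Second and third moments of weighted sums of errors -/

namespace CentralityOLS

/-- Taylor's formula for `|x| ^ 3` at `a`: the second derivative `6 * |a + s|` is at most `6 * |a| +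
6 * |s|`, which integrates to the last two terms. The coefficient one of `|a| ^ 3` allows the bound
to be iterated over the agents without growth, and the term linear in `b` is the one that vanishes
in expectation. -/
lemma abs_add_pow_three_le (a b : ℝ) :
    |a + b| ^ 3 ≤ |a| ^ 3 + 3 * (a * |a|) * b + 3 * |a| * b ^ 2 + |b| ^ 3 := by
  rcases abs_cases a with ⟨ha, ha'⟩ | ⟨ha, ha'⟩ <;> rcases abs_cases b with ⟨hb, hb'⟩ | ⟨hb, hb'⟩ <;>
    rcases abs_cases (a + b) with ⟨hc, hc'⟩ | ⟨hc, hc'⟩ <;> rw [ha, hb, hc]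
  · nlinarith
  · nlinarith
  · nlinarith [mul_nonneg (sq_nonneg b) (neg_nonneg.2 hb'.le)]
  · have : (a + b) ^ 3 - b ^ 3 = a * ((a + b) ^ 2 + (a + b) * b + b ^ 2) := by ring
    have h2 : 0 ≤ a * ((a + b) ^ 2 + (a + b) * b + b ^ 2) :=
      mul_nonneg ha' (by nlinarith [sq_nonneg (a + b + b), sq_nonneg (a + b - b)])
    nlinarith
  · have : b ^ 3 - (a + b) ^ 3 = -a * ((a + b) ^ 2 + (a + b) * b + b ^ 2) := by ring
    have h2 : 0 ≤ -a * ((a + b) ^ 2 + (a + b) * b + b ^ 2) :=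
      mul_nonneg (by linarith) (by nlinarith [sq_nonneg (a + b + b), sq_nonneg (a + b - b)])
    nlinarith
  · nlinarith [mul_nonneg (sq_nonneg b) hb']
  · nlinarith
  · nlinarith

/-- The weighted error `∑ i ∈ s, c i * e i`. -/
def weightedSum {n : ℕ} (s : Finset (Fin n)) (c e : Fin n → ℝ) : ℝ := ∑ i ∈ s, c i * e i

lemma weightedSum_insert {n : ℕ} {s : Finset (Fin n)} {k : Fin n} (hk : k ∉ s) (c e : Fin n → ℝ) :
    weightedSum (insert k s) c e = weightedSum s c e + c k * e k := by
  rw [weightedSum, Finset.sum_insert hk, add_comm, weightedSum]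

/-- This is what makes partial sums admissible as weights for the error of an agent outside `s`. -/
lemma weightedSum_update {n : ℕ} {s : Finset (Fin n)} {k : Fin n} (hk : k ∉ s) (c e : Fin n → ℝ)
    (x : ℝ) : weightedSum s c (Function.update e k x) = weightedSum s c e := by
  refine Finset.sum_congr rfl fun i hi => ?_
  have hne : i ≠ k := fun h => hk (by rwa [h] at hi)
  rw [Function.update_of_ne hne]

lemma abs_weightedSum_le {n : ℕ} (s : Finset (Fin n)) {c : Fin n → ℝ} (hc : ∀ i, |c i| ≤ 1)
    (e : Fin n → ℝ) : |weightedSum s c e| ≤ ∑ i, |e i| := by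
  calc |weightedSum s c e| ≤ ∑ i ∈ s, |c i * e i| := Finset.abs_sum_le_sum_abs _ _
    _ ≤ ∑ i ∈ s, |e i| := Finset.sum_le_sum fun i _ => by
        rw [abs_mul]; exact mul_le_of_le_one_left (abs_nonneg _) (hc i)
    _ ≤ ∑ i, |e i| := Finset.sum_le_sum_of_subset_of_nonneg (Finset.subset_univ _)
        fun i _ _ => abs_nonneg _

lemma abs_le_sum_abs {n : ℕ} (e : Fin n → ℝ) (k : Fin n) : |e k| ≤ ∑ i, |e i| :=
  Finset.single_le_sum (f := fun i => |e i|) (fun _ _ => abs_nonneg _) (Finset.mem_univ k)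

lemma measurable_weightedSum {n : ℕ} {c : (Fin n → I) → Fin n → ℝ} (hc : Measurable c)
    (s : Finset (Fin n)) :
    Measurable fun w : (Fin n → I) × (Fin n → ℝ) => weightedSum s (c w.1) w.2 := by
  unfold weightedSum
  refine Finset.measurable_sum _ fun i _ => ?_
  have : Measurable fun w : (Fin n → I) × (Fin n → ℝ) => c w.1 := hc.comp measurable_fst
  exact ((measurable_pi_apply i).comp this).mul ((measurable_pi_apply i).comp measurable_snd)

variable {Ω : Type*} [MeasurableSpace Ω] {P : Measure Ω}
  {U : ℕ → Ω → I} {ε : ℕ → Ω → ℝ} {lo hi κ : ℝ}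

lemma ErrorMoments.integrable_cube (hε : ErrorMoments P U ε lo hi κ) (i : ℕ) :
    Integrable (fun ω => |ε i ω| ^ 3) P :=
  (hε.memLp i).integrable_norm_pow (p := 3) (by norm_num)

variable [IsProbabilityMeasure P]

/-- The errors have finite third moments and the weights are bounded, so every integrand of degree
at most three in the errors is covered by this single criterion. -/
lemma ErrorMoments.integrable_of_cubic_bound (hε : ErrorMoments P U ε lo hi κ)
    (hU : IsSample P U ε) {n : ℕ} {F : (Fin n → I) → (Fin n → ℝ) → ℝ}
    (hF : Measurable (Function.uncurry F)) {C : ℝ}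
    (hC : ∀ u e, |F u e| ≤ C * (1 + (∑ i, |e i|) ^ 3)) :
    Integrable (fun ω => F (types U n ω) (errors ε n ω)) P := by
  have h3 : MemLp (fun ω => ∑ i : Fin n, |ε i ω|) 3 P :=
    memLp_finsetSum _ fun i _ => (hε.memLp i).abs
  have hI : Integrable (fun ω => C * (1 + (∑ i : Fin n, |ε i ω|) ^ 3)) P := by
    refine ((integrable_const (1 : ℝ)).add ?_).const_mul C
    refine (h3.integrable_norm_pow (p := 3) (by norm_num)).congr (ae_of_all _ fun ω => ?_)
    simp only [Real.norm_eq_abs]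
    rw [abs_of_nonneg (Finset.sum_nonneg fun i _ => abs_nonneg _)]
  refine hI.mono' ?_ (ae_of_all _ fun ω => ?_)
  · exact (hF.comp ((hU.measurable_types n).prodMk (hU.measurable_errors n))).aestronglyMeasurable
  · exact hC _ _

lemma cubic_dominates {d : ℝ} (hd : 0 ≤ d) : d ≤ 1 + d ^ 3 ∧ d ^ 2 ≤ 1 + d ^ 3 := by
  have hd3 : 0 ≤ d ^ 3 := by positivity
  constructor
  · rcases le_total d 1 with h | h
    · linarith
    · nlinarith [mul_nonneg hd (sub_nonneg.2 h), mul_nonneg (mul_nonneg hd hd) (sub_nonneg.2 h)]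
  · rcases le_total d 1 with h | h
    · nlinarith
    · nlinarith [mul_nonneg (mul_nonneg hd hd) (sub_nonneg.2 h)]

lemma ErrorMoments.integrable_sq (hε : ErrorMoments P U ε lo hi κ) (i : ℕ) :
    Integrable (fun ω => ε i ω ^ 2) P :=
  ((hε.memLp i).mono_exponent (p := 2) (by norm_num)).integrable_sq

lemma ErrorMoments.hi_nonneg (hε : ErrorMoments P U ε lo hi κ) : 0 ≤ hi := by
  obtain ⟨ω, h1, h2⟩ := ((hε.var_lower 0).and (hε.var_upper 0)).exists
  exact hε.lo_pos.le.trans (h1.trans h2)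

lemma ErrorMoments.third_nonneg (hε : ErrorMoments P U ε lo hi κ) : 0 ≤ κ := by
  have h0 : 0 ≤ᵐ[P] P[fun ω' => |ε 0 ω'| ^ 3 | MeasurableSpace.comap (U 0) inferInstance] :=
    condExp_nonneg (ae_of_all _ fun ω => by positivity)
  obtain ⟨ω, h1, h2⟩ := (h0.and (hε.third 0)).exists
  exact le_trans h1 h2

lemma integral_add_three {α : Type*} [MeasurableSpace α] {μ : Measure α} {f g h : α → ℝ}
    (hf : Integrable f μ) (hg : Integrable g μ) (hh : Integrable h μ) :
    ∫ x, (f x + g x + h x) ∂μ = ∫ x, f x ∂μ + ∫ x, g x ∂μ + ∫ x, h x ∂μ := by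
  rw [← integral_add hf hg]
  exact integral_add (hf.add hg) hh

/-- Expanding the square of a weighted sum of errors by one term. -/
lemma ErrorMoments.integral_sq_insert (hε : ErrorMoments P U ε lo hi κ) (hU : IsSample P U ε)
    {n : ℕ} {c : (Fin n → I) → Fin n → ℝ} (hc : Measurable c) (hc1 : ∀ u i, |c u i| ≤ 1)
    {g : (Fin n → I) → ℝ} (hg : Measurable g) (hg1 : ∀ u, |g u| ≤ 1)
    {s : Finset (Fin n)} {k : Fin n} (hk : k ∉ s) :
    ∫ ω, weightedSum (insert k s) (c (types U n ω)) (errors ε n ω) ^ 2 * g (types U n ω) ∂P =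
      ∫ ω, weightedSum s (c (types U n ω)) (errors ε n ω) ^ 2 * g (types U n ω) ∂P +
      ∫ ω, ε k ω ^ 2 * (c (types U n ω) k ^ 2 * g (types U n ω)) ∂P := by
  have hw := measurable_weightedSum hc s
  have hck : Measurable fun w : (Fin n → I) × (Fin n → ℝ) => c w.1 k :=
    (measurable_pi_apply k).comp (hc.comp measurable_fst)
  have hgm : Measurable fun w : (Fin n → I) × (Fin n → ℝ) => g w.1 := hg.comp measurable_fst
  have hek : Measurable fun w : (Fin n → I) × (Fin n → ℝ) => w.2 k :=
    (measurable_pi_apply k).comp measurable_snd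
  have d0 : ∀ e : Fin n → ℝ, 0 ≤ ∑ i, |e i| := fun e => Finset.sum_nonneg fun i _ => abs_nonneg _
  have I1 : Integrable (fun ω => weightedSum s (c (types U n ω)) (errors ε n ω) ^ 2 *
      g (types U n ω)) P := by
    refine hε.integrable_of_cubic_bound hU (F := fun u e => weightedSum s (c u) e ^ 2 * g u)
      ((hw.pow_const 2).mul hgm) (C := 1) fun u e => ?_
    have h1 := abs_weightedSum_le s (hc1 u) e
    rw [abs_mul, abs_pow, one_mul]
    calc _ ≤ (∑ i, |e i|) ^ 2 * 1 := by gcongr; exact hg1 u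
      _ ≤ _ := by rw [mul_one]; exact (cubic_dominates (d0 e)).2
  have I2 : Integrable (fun ω => ε k ω * (2 * weightedSum s (c (types U n ω)) (errors ε n ω) *
      c (types U n ω) k * g (types U n ω))) P := by
    refine hε.integrable_of_cubic_bound hU
      (F := fun u e => e k * (2 * weightedSum s (c u) e * c u k * g u))
      (hek.mul (((hw.const_mul 2).mul hck).mul hgm)) (C := 2) fun u e => ?_
    have h1 := abs_weightedSum_le s (hc1 u) e
    rw [abs_mul, abs_mul, abs_mul, abs_mul, abs_two]
    calc _ ≤ (∑ i, |e i|) * (2 * (∑ i, |e i|) * 1 * 1) := by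
          gcongr
          · exact abs_le_sum_abs e k
          · exact hc1 u k
          · exact hg1 u
      _ ≤ _ := by nlinarith [(cubic_dominates (d0 e)).2]
  have I2' : Integrable (fun ω => 2 * weightedSum s (c (types U n ω)) (errors ε n ω) *
      c (types U n ω) k * g (types U n ω)) P := by
    refine hε.integrable_of_cubic_bound hU
      (F := fun u e => 2 * weightedSum s (c u) e * c u k * g u)
      (((hw.const_mul 2).mul hck).mul hgm) (C := 2) fun u e => ?_
    have h1 := abs_weightedSum_le s (hc1 u) e
    rw [abs_mul, abs_mul, abs_mul, abs_two]
    calc _ ≤ 2 * (∑ i, |e i|) * 1 * 1 := by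
          gcongr
          · exact hc1 u k
          · exact hg1 u
      _ ≤ _ := by nlinarith [(cubic_dominates (d0 e)).1]
  have I3 : Integrable (fun ω => ε k ω ^ 2 * (c (types U n ω) k ^ 2 * g (types U n ω))) P := by
    refine hε.integrable_of_cubic_bound hU (F := fun u e => e k ^ 2 * (c u k ^ 2 * g u))
      ((hek.pow_const 2).mul ((hck.pow_const 2).mul hgm)) (C := 1) fun u e => ?_
    rw [abs_mul, abs_mul, abs_pow, abs_pow, one_mul]
    calc _ ≤ (∑ i, |e i|) ^ 2 * (1 ^ 2 * 1) := by
          gcongr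
          · exact abs_le_sum_abs e k
          · exact hc1 u k
          · exact hg1 u
      _ ≤ _ := by nlinarith [(cubic_dominates (d0 e)).2]
  -- The cross term is linear in `ε k`, and its other factors do not involve `ε k` because `k ∉ s`.
  have hz := hε.integral_mul_eq_zero hU k
    (G := fun u e => 2 * weightedSum s (c u) e * c u k * g u)
    (((hw.const_mul 2).mul hck).mul hgm) (fun u e x => by rw [weightedSum_update hk]) I2 I2'
  calc _ = ∫ ω, (weightedSum s (c (types U n ω)) (errors ε n ω) ^ 2 * g (types U n ω)
        + ε k ω * (2 * weightedSum s (c (types U n ω)) (errors ε n ω) *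
          c (types U n ω) k * g (types U n ω))
        + ε k ω ^ 2 * (c (types U n ω) k ^ 2 * g (types U n ω))) ∂P := by
        congr 1; funext ω
        rw [weightedSum_insert hk]
        simp only [errors]
        ring
    _ = _ := by
        rw [integral_add_three I1 I2 I3, hz, add_zero]

lemma ErrorMoments.integral_error_sq_mul_le (hε : ErrorMoments P U ε lo hi κ)
    (hU : IsSample P U ε) {n : ℕ} (k : Fin n)
    {G : (Fin n → I) → (Fin n → ℝ) → ℝ} (hG : Measurable (Function.uncurry G))
    (hG0 : ∀ u e, 0 ≤ G u e) (hGk : ∀ u e x, G u (Function.update e k x) = G u e)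
    (hI : Integrable (fun ω => ε k ω ^ 2 * G (types U n ω) (errors ε n ω)) P)
    (hGI : Integrable (fun ω => G (types U n ω) (errors ε n ω)) P) :
    ∫ ω, ε k ω ^ 2 * G (types U n ω) (errors ε n ω) ∂P
      ≤ hi * ∫ ω, G (types U n ω) (errors ε n ω) ∂P :=
  hU.integral_mul_le k (ψ := fun x => x ^ 2) (by fun_prop) (hε.integrable_sq k) (hε.var_upper k)
    hG hG0 hGk hI hGI

lemma ErrorMoments.le_integral_error_sq_mul (hε : ErrorMoments P U ε lo hi κ)
    (hU : IsSample P U ε) {n : ℕ} (k : Fin n)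
    {G : (Fin n → I) → (Fin n → ℝ) → ℝ} (hG : Measurable (Function.uncurry G))
    (hG0 : ∀ u e, 0 ≤ G u e) (hGk : ∀ u e x, G u (Function.update e k x) = G u e)
    (hI : Integrable (fun ω => ε k ω ^ 2 * G (types U n ω) (errors ε n ω)) P)
    (hGI : Integrable (fun ω => G (types U n ω) (errors ε n ω)) P) :
    lo * ∫ ω, G (types U n ω) (errors ε n ω) ∂P
      ≤ ∫ ω, ε k ω ^ 2 * G (types U n ω) (errors ε n ω) ∂P := by
  -- The lower variance bound is an upper bound for the conditional mean of `-x ^ 2`;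
  -- `integral_mul_le` asks no sign of `ψ`.
  have hb : ∀ᵐ ω ∂P, (P[fun ω => -ε k ω ^ 2 | MeasurableSpace.comap (U k) inferInstance]) ω
      ≤ -lo := by
    filter_upwards [condExp_neg (μ := P) (fun ω => ε k ω ^ 2)
      (MeasurableSpace.comap (U k) inferInstance), hε.var_lower k] with ω h1 h2
    have h3 : (P[fun ω => -ε k ω ^ 2 | MeasurableSpace.comap (U k) inferInstance]) ω
      = -(P[fun ω => ε k ω ^ 2 | MeasurableSpace.comap (U k) inferInstance]) ω := h1
    rw [h3]; linarith
  have := hU.integral_mul_le k (ψ := fun x => -x ^ 2) (by fun_prop) (hε.integrable_sq k).neg hb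
    hG hG0 hGk (hI.neg.congr (ae_of_all _ fun ω => by simp)) hGI
  simp only [neg_mul, integral_neg] at this
  linarith

lemma IsSample.integrable_types (hU : IsSample P U ε) {n : ℕ} {g : (Fin n → I) → ℝ}
    (hg : Measurable g) {C : ℝ} (hgC : ∀ u, |g u| ≤ C) :
    Integrable (fun ω => g (types U n ω)) P :=
  Integrable.of_bound (hg.comp (hU.measurable_types n)).aestronglyMeasurable C
    (ae_of_all _ fun _ => hgC _)

/-- The second moment of a weighted sum of errors is comparable to that of the weights. -/
lemma ErrorMoments.integral_weightedSum_sq (hε : ErrorMoments P U ε lo hi κ) (hU : IsSample P U ε)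
    {n : ℕ} {c : (Fin n → I) → Fin n → ℝ} (hc : Measurable c) (hc1 : ∀ u i, |c u i| ≤ 1)
    {g : (Fin n → I) → ℝ} (hg : Measurable g) (hg0 : ∀ u, 0 ≤ g u) (hg1 : ∀ u, g u ≤ 1)
    (s : Finset (Fin n)) :
    ∫ ω, weightedSum s (c (types U n ω)) (errors ε n ω) ^ 2 * g (types U n ω) ∂P
      ≤ hi * ∫ ω, (∑ i ∈ s, c (types U n ω) i ^ 2) * g (types U n ω) ∂P ∧
    lo * ∫ ω, (∑ i ∈ s, c (types U n ω) i ^ 2) * g (types U n ω) ∂P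
      ≤ ∫ ω, weightedSum s (c (types U n ω)) (errors ε n ω) ^ 2 * g (types U n ω) ∂P := by
  classical
  have hga : ∀ u, |g u| ≤ 1 := fun u => by rw [abs_of_nonneg (hg0 u)]; exact hg1 u
  have hcm : ∀ i, Measurable fun u => c u i := fun i => (measurable_pi_apply i).comp hc
  have hcg : ∀ i, Measurable fun u => c u i ^ 2 * g u := fun i => ((hcm i).pow_const 2).mul hg
  have hcb : ∀ i u, |c u i ^ 2 * g u| ≤ 1 := fun i u => by
    rw [abs_mul, abs_pow]
    exact mul_le_one₀ (pow_le_one₀ (abs_nonneg _) (hc1 u i)) (abs_nonneg _) (hga u)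
  -- Each new index contributes `E[ε k ^ 2 * c k ^ 2 * g]`, which lies between `lo` and `hi` times
  -- `E[c k ^ 2 * g]`. The extra weight `g` is carried along because the cubic bound below needs the
  -- case `g = c k ^ 2`.
  induction s using Finset.induction_on with
  | empty => simp [weightedSum]
  | insert k s hk ih =>
    have J1 : Integrable (fun ω => c (types U n ω) k ^ 2 * g (types U n ω)) P :=
      hU.integrable_types (hcg k) (hcb k)
    have J2 : Integrable (fun ω => (∑ i ∈ s, c (types U n ω) i ^ 2) * g (types U n ω)) P := by
      simp only [Finset.sum_mul]
      exact integrable_finsetSum _ fun i _ => hU.integrable_types (hcg i) (hcb i)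
    have hGm : Measurable (Function.uncurry
        fun (u : Fin n → I) (_ : Fin n → ℝ) => c u k ^ 2 * g u) := (hcg k).comp measurable_fst
    have J3 : Integrable (fun ω => ε k ω ^ 2 * (c (types U n ω) k ^ 2 * g (types U n ω))) P := by
      have := (hε.integrable_sq k).mul_bdd (c := 1)
        ((hcg k).comp (hU.measurable_types n)).aestronglyMeasurable
        (ae_of_all _ fun ω => hcb k (types U n ω))
      exact this
    rw [hε.integral_sq_insert hU hc hc1 hg hga hk]
    have e1 : ∫ ω, (∑ i ∈ insert k s, c (types U n ω) i ^ 2) * g (types U n ω) ∂P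
        = ∫ ω, (∑ i ∈ s, c (types U n ω) i ^ 2) * g (types U n ω) ∂P +
          ∫ ω, c (types U n ω) k ^ 2 * g (types U n ω) ∂P := by
      rw [← integral_add J2 J1]
      congr 1; funext ω; rw [Finset.sum_insert hk]; ring
    rw [e1, mul_add, mul_add]
    have h1 := hε.integral_error_sq_mul_le hU k (G := fun u _ => c u k ^ 2 * g u) hGm
      (fun u _ => mul_nonneg (sq_nonneg _) (hg0 u)) (fun _ _ _ => rfl) J3 J1
    have h2 := hε.le_integral_error_sq_mul hU k (G := fun u _ => c u k ^ 2 * g u) hGm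
      (fun u _ => mul_nonneg (sq_nonneg _) (hg0 u)) (fun _ _ _ => rfl) J3 J1
    exact ⟨add_le_add ih.1 h1, add_le_add ih.2 h2⟩

/-- The third absolute moment of a weighted sum of errors is bounded when the weights have
Euclidean norm at most one. -/
lemma ErrorMoments.integral_weightedSum_cube_le (hε : ErrorMoments P U ε lo hi κ)
    (hU : IsSample P U ε) {n : ℕ} {c : (Fin n → I) → Fin n → ℝ} (hc : Measurable c)
    (hc1 : ∀ u, ∑ i, c u i ^ 2 ≤ 1) (s : Finset (Fin n)) :
    ∫ ω, |weightedSum s (c (types U n ω)) (errors ε n ω)| ^ 3 ∂P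
      ≤ (3 * hi * (1 + hi) + κ) * ∫ ω, ∑ i ∈ s, c (types U n ω) i ^ 2 ∂P := by
  classical
  have hsq : ∀ u i, c u i ^ 2 ≤ 1 := fun u i =>
    (Finset.single_le_sum (f := fun i => c u i ^ 2) (fun i _ => sq_nonneg _)
      (Finset.mem_univ i)).trans (hc1 u)
  have hca : ∀ u i, |c u i| ≤ 1 := fun u i => by
    have := hsq u i; rw [← sq_abs] at this; nlinarith [abs_nonneg (c u i)]
  have hcm : ∀ i, Measurable fun u => c u i := fun i => (measurable_pi_apply i).comp hc
  have hhi := hε.hi_nonneg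
  have hκ := hε.third_nonneg
  have d0 : ∀ e : Fin n → ℝ, 0 ≤ ∑ i, |e i| := fun e => Finset.sum_nonneg fun i _ => abs_nonneg _
  have hcsq : ∀ i u, |c u i ^ 2| ≤ 1 := fun i u => by
    rw [abs_of_nonneg (sq_nonneg _)]; exact hsq u i
  have hcI : ∀ i, Integrable (fun ω => c (types U n ω) i ^ 2) P := fun i =>
    hU.integrable_types ((hcm i).pow_const 2) (hcsq i)
  induction s using Finset.induction_on with
  | empty => simp [weightedSum]
  | insert k s hk ih =>
    have hw := measurable_weightedSum hc s
    have hck : Measurable fun w : (Fin n → I) × (Fin n → ℝ) => c w.1 k :=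
      (hcm k).comp measurable_fst
    have hek : Measurable fun w : (Fin n → I) × (Fin n → ℝ) => w.2 k :=
      (measurable_pi_apply k).comp measurable_snd
    have hwa : Measurable fun w : (Fin n → I) × (Fin n → ℝ) => |weightedSum s (c w.1) w.2| :=
      hw.norm
    have I0 : ∀ t : Finset (Fin n),
        Integrable (fun ω => |weightedSum t (c (types U n ω)) (errors ε n ω)| ^ 3) P := fun t =>
      hε.integrable_of_cubic_bound hU (F := fun u e => |weightedSum t (c u) e| ^ 3)
        ((measurable_weightedSum hc t).norm.pow_const 3) (C := 1) fun u e => by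
          have h1 := abs_weightedSum_le t (hca u) e
          rw [abs_pow, abs_abs, one_mul]
          calc _ ≤ (∑ i, |e i|) ^ 3 := by gcongr
            _ ≤ _ := by linarith
    have mA : Measurable (Function.uncurry fun (u : Fin n → I) (e : Fin n → ℝ) =>
        3 * (weightedSum s (c u) e * |weightedSum s (c u) e|) * c u k) :=
      ((hw.mul hwa).const_mul 3).mul hck
    have mB : Measurable (Function.uncurry fun (u : Fin n → I) (e : Fin n → ℝ) =>
        3 * |weightedSum s (c u) e| * c u k ^ 2) := (hwa.const_mul 3).mul (hck.pow_const 2)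
    have mC : Measurable (Function.uncurry fun (u : Fin n → I) (_ : Fin n → ℝ) =>
        |c u k| ^ 3) := hck.norm.pow_const 3
    have bA : ∀ u e, |3 * (weightedSum s (c u) e * |weightedSum s (c u) e|) * c u k|
        ≤ 3 * (∑ i, |e i|) ^ 2 := fun u e => by
      have h1 := abs_weightedSum_le s (hca u) e
      rw [abs_mul, abs_mul, abs_mul, abs_abs, abs_of_pos (by norm_num : (0 : ℝ) < 3)]
      calc _ ≤ 3 * ((∑ i, |e i|) * (∑ i, |e i|)) * 1 := by
            gcongr
            exact hca u k
        _ = _ := by ring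
    have bB : ∀ u e, |3 * |weightedSum s (c u) e| * c u k ^ 2| ≤ 3 * (∑ i, |e i|) := fun u e => by
      have h1 := abs_weightedSum_le s (hca u) e
      rw [abs_mul, abs_mul, abs_abs, abs_of_pos (by norm_num : (0 : ℝ) < 3)]
      calc _ ≤ 3 * (∑ i, |e i|) * 1 := by
            gcongr
            exact hcsq k u
        _ = _ := by ring
    have bC : ∀ u, |(|c u k| ^ 3)| ≤ 1 := fun u => by
      rw [abs_pow, abs_abs]; exact pow_le_one₀ (abs_nonneg _) (hca u k)
    have IA' := hε.integrable_of_cubic_bound hU mA (C := 3) fun u e =>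
      (bA u e).trans (by nlinarith [(cubic_dominates (d0 e)).2])
    have IB' := hε.integrable_of_cubic_bound hU mB (C := 3) fun u e =>
      (bB u e).trans (by nlinarith [(cubic_dominates (d0 e)).1])
    have IC' : Integrable (fun ω => |c (types U n ω) k| ^ 3) P :=
      hU.integrable_types ((hcm k).norm.pow_const 3) bC
    have IA : Integrable (fun ω => ε k ω * (3 * (weightedSum s (c (types U n ω)) (errors ε n ω) *
        |weightedSum s (c (types U n ω)) (errors ε n ω)|) * c (types U n ω) k)) P :=
      hε.integrable_of_cubic_bound hU (F := fun u e => e k *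
        (3 * (weightedSum s (c u) e * |weightedSum s (c u) e|) * c u k)) (hek.mul mA) (C := 3) fun u e => by
        rw [abs_mul]
        calc _ ≤ (∑ i, |e i|) * (3 * (∑ i, |e i|) ^ 2) := by
              gcongr
              · exact abs_le_sum_abs e k
              · exact bA u e
          _ ≤ _ := by nlinarith
    have IB : Integrable (fun ω => ε k ω ^ 2 * (3 *
        |weightedSum s (c (types U n ω)) (errors ε n ω)| * c (types U n ω) k ^ 2)) P :=
      hε.integrable_of_cubic_bound hU (F := fun u e => e k ^ 2 *
        (3 * |weightedSum s (c u) e| * c u k ^ 2)) ((hek.pow_const 2).mul mB) (C := 3) fun u e => by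
        rw [abs_mul, abs_pow]
        calc _ ≤ (∑ i, |e i|) ^ 2 * (3 * (∑ i, |e i|)) := by
              gcongr
              · exact abs_le_sum_abs e k
              · exact bB u e
          _ ≤ _ := by nlinarith
    have IC : Integrable (fun ω => |ε k ω| ^ 3 * |c (types U n ω) k| ^ 3) P :=
      hε.integrable_of_cubic_bound hU
        (F := fun u e => |e k| ^ 3 * |c u k| ^ 3) ((hek.norm.pow_const 3).mul mC) (C := 1) fun u e => by
        rw [abs_mul, abs_pow, abs_abs]
        calc _ ≤ (∑ i, |e i|) ^ 3 * 1 := by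
              gcongr
              · exact abs_le_sum_abs e k
              · exact bC u
          _ ≤ _ := by linarith
    have zA := hε.integral_mul_eq_zero hU k mA
      (fun u e x => by rw [weightedSum_update hk]) IA IA'
    have zB := hε.integral_error_sq_mul_le hU k mB (fun u e => by positivity)
      (fun u e x => by rw [weightedSum_update hk]) IB IB'
    have zC := hU.integral_mul_le k (ψ := fun x => |x| ^ 3) (by fun_prop) (hε.integrable_cube k)
      (hε.third k) mC (fun u e => by positivity) (fun u e x => rfl) IC IC'
    have IS : Integrable (fun ω => weightedSum s (c (types U n ω)) (errors ε n ω) ^ 2 *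
        c (types U n ω) k ^ 2) P :=
      hε.integrable_of_cubic_bound hU (F := fun u e => weightedSum s (c u) e ^ 2 * c u k ^ 2)
        ((hw.pow_const 2).mul (hck.pow_const 2)) (C := 1)
        fun u e => by
          have h1 := abs_weightedSum_le s (hca u) e
          rw [abs_mul, abs_pow]
          calc _ ≤ (∑ i, |e i|) ^ 2 * 1 := by gcongr; exact hcsq k u
            _ ≤ _ := by nlinarith [(cubic_dominates (d0 e)).2]
    have zS := (hε.integral_weightedSum_sq hU hc hca (g := fun u => c u k ^ 2)
      ((hcm k).pow_const 2) (fun u => sq_nonneg _) (fun u => hsq u k) s).1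
    -- With `S` the partial sum, `|S| ≤ 1 + S ^ 2`, and `E[S ^ 2 * c k ^ 2] ≤ hi * E[c k ^ 2]`
    -- because the squared weights sum to at most one. This keeps the increment proportional to `E[c
    -- k ^ 2]`, so that the increments add up to a bound free of `n`.
    have zB' : ∫ ω, 3 * |weightedSum s (c (types U n ω)) (errors ε n ω)| * c (types U n ω) k ^ 2 ∂P
        ≤ 3 * ((1 + hi) * ∫ ω, c (types U n ω) k ^ 2 ∂P) := by
      have Q : Integrable (fun ω => (∑ i ∈ s, c (types U n ω) i ^ 2) * c (types U n ω) k ^ 2) P := by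
        simp only [Finset.sum_mul]
        refine integrable_finsetSum _ fun i _ => hU.integrable_types (g := fun u => c u i ^ 2 *
          c u k ^ 2) (((hcm i).pow_const 2).mul ((hcm k).pow_const 2)) (C := 1) fun u => ?_
        rw [abs_mul]; exact mul_le_one₀ (hcsq i u) (abs_nonneg _) (hcsq k u)
      have q1 : ∫ ω, (∑ i ∈ s, c (types U n ω) i ^ 2) * c (types U n ω) k ^ 2 ∂P
          ≤ ∫ ω, c (types U n ω) k ^ 2 ∂P := by
        refine integral_mono Q (hcI k) fun ω => ?_
        refine mul_le_of_le_one_left (sq_nonneg _) (le_trans ?_ (hc1 (types U n ω)))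
        exact Finset.sum_le_sum_of_subset_of_nonneg (Finset.subset_univ _) fun i _ _ => sq_nonneg _
      calc _ ≤ ∫ ω, 3 * (c (types U n ω) k ^ 2 +
            weightedSum s (c (types U n ω)) (errors ε n ω) ^ 2 * c (types U n ω) k ^ 2) ∂P := by
            refine integral_mono IB' (((hcI k).add IS).const_mul 3) fun ω => ?_
            have h1 : |weightedSum s (c (types U n ω)) (errors ε n ω)| ≤
                1 + weightedSum s (c (types U n ω)) (errors ε n ω) ^ 2 := by
              rw [← sq_abs]
              nlinarith [sq_nonneg (|weightedSum s (c (types U n ω)) (errors ε n ω)| - 1)]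
            have h2 := mul_le_mul_of_nonneg_right h1 (sq_nonneg (c (types U n ω) k))
            simp only
            nlinarith
        _ = 3 * (∫ ω, c (types U n ω) k ^ 2 ∂P + ∫ ω, weightedSum s (c (types U n ω))
              (errors ε n ω) ^ 2 * c (types U n ω) k ^ 2 ∂P) := by
            rw [integral_const_mul, integral_add (hcI k) IS]
        _ ≤ _ := by nlinarith [mul_le_mul_of_nonneg_left q1 hhi]
    have zC' : ∫ ω, |c (types U n ω) k| ^ 3 ∂P ≤ ∫ ω, c (types U n ω) k ^ 2 ∂P := by
      refine integral_mono IC' (hcI k) fun ω => ?_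
      have h1 := hca (types U n ω) k
      have := abs_nonneg (c (types U n ω) k)
      change |c (types U n ω) k| ^ 3 ≤ c (types U n ω) k ^ 2
      rw [← sq_abs]
      nlinarith [mul_nonneg (mul_nonneg this this) (sub_nonneg.2 h1)]
    have e1 : ∫ ω, ∑ i ∈ insert k s, c (types U n ω) i ^ 2 ∂P
        = ∫ ω, ∑ i ∈ s, c (types U n ω) i ^ 2 ∂P + ∫ ω, c (types U n ω) k ^ 2 ∂P := by
      rw [← integral_add (integrable_finsetSum _ fun i _ => hcI i) (hcI k)]
      congr 1; funext ω; rw [Finset.sum_insert hk]; ring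
    -- Of the four terms of the cubic expansion, the first is the induction hypothesis, the second
    -- has mean zero, and the other two cost at most `3 * hi * (1 + hi)` and `κ` times `E[c k ^ 2]`.
    calc _ ≤ ∫ ω, (|weightedSum s (c (types U n ω)) (errors ε n ω)| ^ 3
          + ε k ω * (3 * (weightedSum s (c (types U n ω)) (errors ε n ω) *
            |weightedSum s (c (types U n ω)) (errors ε n ω)|) * c (types U n ω) k)
          + ε k ω ^ 2 * (3 * |weightedSum s (c (types U n ω)) (errors ε n ω)| *
            c (types U n ω) k ^ 2)
          + |ε k ω| ^ 3 * |c (types U n ω) k| ^ 3) ∂P := by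
          refine integral_mono (I0 _) ((((I0 s).add IA).add IB).add IC) fun ω => ?_
          have := abs_add_pow_three_le (weightedSum s (c (types U n ω)) (errors ε n ω))
            (c (types U n ω) k * errors ε n ω k)
          simp only [weightedSum_insert hk]
          refine this.trans (le_of_eq ?_)
          rw [abs_mul, mul_pow, mul_pow]
          simp only [errors]
          ring
      _ = ∫ ω, |weightedSum s (c (types U n ω)) (errors ε n ω)| ^ 3 ∂P + 0
          + ∫ ω, ε k ω ^ 2 * (3 * |weightedSum s (c (types U n ω)) (errors ε n ω)| *
            c (types U n ω) k ^ 2) ∂P + ∫ ω, |ε k ω| ^ 3 * |c (types U n ω) k| ^ 3 ∂P := by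
          rw [← zA, ← integral_add_three (I0 s) IA IB]
          exact integral_add (((I0 s).add IA).add IB) IC
      _ ≤ _ := by
          rw [e1]
          have t1 := mul_le_mul_of_nonneg_left zB' hhi
          have t2 := mul_le_mul_of_nonneg_left zC' hκ
          nlinarith

end CentralityOLS

/-! ### Scores with unit weights and the consistency criterion -/

namespace CentralityOLS

variable {Ω : Type*} [MeasurableSpace Ω] {P : Measure Ω} [IsProbabilityMeasure P]
  {U : ℕ → Ω → I} {ε : ℕ → Ω → ℝ} {lo hi κ : ℝ}

/-- The inner product of the errors with weights depending on the types. -/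
def score (U : ℕ → Ω → I) (ε : ℕ → Ω → ℝ) {n : ℕ} (c : (Fin n → I) → Fin n → ℝ) (ω : Ω) : ℝ :=
  errors ε n ω ⬝ᵥ c (types U n ω)

omit [MeasurableSpace Ω] in
lemma score_eq_weightedSum {n : ℕ} (c : (Fin n → I) → Fin n → ℝ) (ω : Ω) :
    score U ε c ω = weightedSum Finset.univ (c (types U n ω)) (errors ε n ω) := by
  simp only [score, weightedSum, dotProduct, mul_comm]

lemma abs_le_one_of_dotProduct_self_eq_one {n : ℕ} {c : Fin n → ℝ} (hc : c ⬝ᵥ c = 1) (i : Fin n) :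
    |c i| ≤ 1 := by
  have h : c i * c i ≤ 1 := by
    rw [← hc]
    exact Finset.single_le_sum (f := fun i => c i * c i) (fun i _ => mul_self_nonneg _)
      (Finset.mem_univ i)
  have := abs_mul_abs_self (c i)
  nlinarith [abs_nonneg (c i)]

lemma sum_sq_eq_dotProduct_self {n : ℕ} (c : Fin n → ℝ) : ∑ i, c i ^ 2 = c ⬝ᵥ c :=
  Finset.sum_congr rfl fun i _ => sq (c i)

section Moments

variable {n : ℕ} {c : (Fin n → I) → Fin n → ℝ}

omit [IsProbabilityMeasure P] in
lemma IsSample.measurable_score (hU : IsSample P U ε) (hc : Measurable c) :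
    Measurable (score U ε c) := by
  have := (measurable_weightedSum hc Finset.univ).comp
    ((hU.measurable_types n).prodMk (hU.measurable_errors n))
  convert this using 1
  funext ω
  exact score_eq_weightedSum c ω

lemma ErrorMoments.integrable_score_cube (hε : ErrorMoments P U ε lo hi κ) (hU : IsSample P U ε)
    (hc : Measurable c) (hc1 : ∀ u, c u ⬝ᵥ c u = 1) :
    Integrable (fun ω => |score U ε c ω| ^ 3) P := by
  simp only [score_eq_weightedSum]
  refine hε.integrable_of_cubic_bound hU (F := fun u e => |weightedSum Finset.univ (c u) e| ^ 3)
    ((measurable_weightedSum hc _).norm.pow_const 3) (C := 1) fun u e => ?_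
  have h1 := abs_weightedSum_le Finset.univ (abs_le_one_of_dotProduct_self_eq_one (hc1 u)) e
  rw [abs_pow, abs_abs, one_mul]
  calc _ ≤ (∑ i, |e i|) ^ 3 := by gcongr
    _ ≤ _ := by linarith

lemma ErrorMoments.integrable_score_sq (hε : ErrorMoments P U ε lo hi κ) (hU : IsSample P U ε)
    (hc : Measurable c) (hc1 : ∀ u, c u ⬝ᵥ c u = 1) :
    Integrable (fun ω => score U ε c ω ^ 2) P := by
  refine ((integrable_const (1 : ℝ)).add (hε.integrable_score_cube hU hc hc1)).mono'
    ((hU.measurable_score hc).pow_const 2).aestronglyMeasurable (ae_of_all _ fun ω => ?_)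
  rw [Real.norm_eq_abs, abs_pow]
  exact (cubic_dominates (abs_nonneg _)).2

lemma ErrorMoments.integral_score_sq (hε : ErrorMoments P U ε lo hi κ) (hU : IsSample P U ε)
    (hc : Measurable c) (hc1 : ∀ u, c u ⬝ᵥ c u = 1) :
    ∫ ω, score U ε c ω ^ 2 ∂P ≤ hi ∧ lo ≤ ∫ ω, score U ε c ω ^ 2 ∂P := by
  have := hε.integral_weightedSum_sq hU hc
    (fun u => abs_le_one_of_dotProduct_self_eq_one (hc1 u)) (g := fun _ => 1) measurable_const
    (fun _ => zero_le_one) (fun _ => le_rfl) Finset.univ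
  simpa [sum_sq_eq_dotProduct_self, hc1, score_eq_weightedSum] using this

lemma ErrorMoments.integral_score_cube_le (hε : ErrorMoments P U ε lo hi κ) (hU : IsSample P U ε)
    (hc : Measurable c) (hc1 : ∀ u, c u ⬝ᵥ c u = 1) :
    ∫ ω, |score U ε c ω| ^ 3 ∂P ≤ 3 * hi * (1 + hi) + κ := by
  have := hε.integral_weightedSum_cube_le hU hc
    (fun u => by rw [sum_sq_eq_dotProduct_self, hc1]) Finset.univ
  simpa [sum_sq_eq_dotProduct_self, hc1, score_eq_weightedSum] using this

lemma ErrorMoments.measure_score_ge_le (hε : ErrorMoments P U ε lo hi κ) (hU : IsSample P U ε)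
    (hc : Measurable c) (hc1 : ∀ u, c u ⬝ᵥ c u = 1) {x : ℝ} (hx : 0 < x) :
    P {ω | x ≤ |score U ε c ω|} ≤ ENNReal.ofReal (hi / x ^ 2) := by
  -- Chebyshev's inequality, as Markov's inequality for the squared score.
  have h := mul_meas_ge_le_integral_of_nonneg (μ := P) (f := fun ω => score U ε c ω ^ 2)
    (ae_of_all _ fun ω => sq_nonneg _) (hε.integrable_score_sq hU hc hc1) (x ^ 2)
  have hset : {ω | x ≤ |score U ε c ω|} = {ω | x ^ 2 ≤ score U ε c ω ^ 2} := by
    ext ω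
    simp only [Set.mem_ofPred_eq]
    rw [← sq_abs (score U ε c ω), sq_le_sq₀ hx.le (abs_nonneg _)]
  rw [hset, ← ENNReal.ofReal_toReal (measure_ne_top P {ω | x ^ 2 ≤ score U ε c ω ^ 2})]
  refine ENNReal.ofReal_le_ofReal ?_
  rw [le_div_iff₀ (by positivity), mul_comm]
  exact h.trans (hε.integral_score_sq hU hc hc1).1

/-- A score with weights of norm one stays away from zero with probability bounded below,
uniformly in the sample size and in the weights. -/
lemma ErrorMoments.le_measure_score_ge (hε : ErrorMoments P U ε lo hi κ) (hU : IsSample P U ε)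
    (hc : Measurable c) (hc1 : ∀ u, c u ⬝ᵥ c u = 1) :
    ENNReal.ofReal (lo / 2 / (4 * (3 * hi * (1 + hi) + κ) / lo) ^ 2) ≤
      P {ω | √lo / 2 ≤ |score U ε c ω|} := by
  have hlo := hε.lo_pos
  have hb := hε.integral_score_sq hU hc hc1
  have hhi : 0 < hi := hlo.trans_le (hb.2.trans hb.1)
  have hκ := hε.third_nonneg
  set M := 3 * hi * (1 + hi) + κ with hM
  have hMpos : 0 < M := by positivity
  -- The truncation level is chosen so that the cubic term below has expectation at most `lo / 4`.
  set R := 4 * M / lo with hR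
  have hRpos : 0 < R := by positivity
  set E := {ω | √lo / 2 ≤ |score U ε c ω|} with hE
  have hEm : MeasurableSet E := measurableSet_le measurable_const (hU.measurable_score hc).norm
  -- The three terms cover a score off `E`, a score in `E` of size at most `R`, and a score larger
  -- than `R`. In expectation `lo ≤ lo / 4 + R ^ 2 * P(E) + lo / 4`, which bounds `P(E)` from below.
  have hpt : ∀ ω, score U ε c ω ^ 2 ≤
      lo / 4 + E.indicator (fun _ => R ^ 2) ω + |score U ε c ω| ^ 3 / R := by
    intro ω
    have h0 := abs_nonneg (score U ε c ω)
    rw [← sq_abs]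
    have h3 : 0 ≤ |score U ε c ω| ^ 3 / R := by positivity
    by_cases h : ω ∈ E
    · rw [Set.indicator_of_mem h]
      rcases le_total (|score U ε c ω|) R with h1 | h1
      · nlinarith
      · have : |score U ε c ω| ^ 2 ≤ |score U ε c ω| ^ 3 / R := by
          rw [le_div_iff₀ hRpos]
          nlinarith [mul_nonneg (sq_nonneg (|score U ε c ω|)) (sub_nonneg.2 h1)]
        nlinarith [sq_nonneg R]
    · rw [Set.indicator_of_notMem h]
      have h1 : |score U ε c ω| < √lo / 2 := not_le.1 h
      have h2 := Real.sq_sqrt hlo.le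
      nlinarith
  have I1 : Integrable (E.indicator fun _ => R ^ 2) P := (integrable_const _).indicator hEm
  have I2 : Integrable (fun ω => |score U ε c ω| ^ 3 / R) P :=
    (hε.integrable_score_cube hU hc hc1).div_const R
  have hint : ∫ ω, score U ε c ω ^ 2 ∂P ≤
      ∫ ω, (lo / 4 + E.indicator (fun _ => R ^ 2) ω + |score U ε c ω| ^ 3 / R) ∂P :=
    integral_mono (hε.integrable_score_sq hU hc hc1) (((integrable_const _).add I1).add I2) hpt
  rw [integral_add_three (integrable_const _) I1 I2, integral_indicator hEm,
    integral_div R] at hint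
  simp only [integral_const, measureReal_restrict_apply_univ, probReal_univ, smul_eq_mul,
    one_mul] at hint
  have h3 : (∫ ω, |score U ε c ω| ^ 3 ∂P) / R ≤ lo / 4 := by
    rw [div_le_iff₀ hRpos]
    refine (hε.integral_score_cube_le hU hc hc1).trans (le_of_eq ?_)
    rw [← hM, hR]; field_simp
  have h4 : lo / 2 / R ^ 2 ≤ P.real E := by
    rw [div_le_iff₀ (by positivity)]
    linarith [hb.2]
  rw [← ENNReal.ofReal_toReal (measure_ne_top P E)]
  exact ENNReal.ofReal_le_ofReal h4

end Moments

/-- An estimator whose error is, outside of events of vanishing probability, a score with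
normalised weights divided by a number of the exact order `R n`, is consistent if and only if
`R n → ∞`. -/
lemma ErrorMoments.tendstoInMeasure_iff (hε : ErrorMoments P U ε lo hi κ) (hU : IsSample P U ε)
    {c : (n : ℕ) → (Fin n → I) → Fin n → ℝ} (hc : ∀ n, Measurable (c n))
    (hc1 : ∀ n, 0 < n → ∀ u, c n u ⬝ᵥ c n u = 1) {N : ℕ → Set Ω}
    (hN : Tendsto (fun n => P (N n)) atTop (𝓝 0)) {β : ℝ} {est : ℕ → Ω → ℝ} {R : ℕ → ℝ}
    (hR : ∀ n, 0 < n → 0 < R n)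
    (hupper : ∀ n, 0 < n → ∀ ω, ω ∉ N n → |est n ω - β| * R n ≤ |score U ε (c n) ω|)
    (hlower : ∀ K : ℝ, ∃ K' : ℝ, 0 < K' ∧ ∀ n, 0 < n → R n ≤ K → ∀ ω, ω ∉ N n →
      |score U ε (c n) ω| ≤ K' * |est n ω - β|) :
    TendstoInMeasure P est atTop (fun _ => β) ↔ Tendsto R atTop atTop := by
  rw [tendstoInMeasure_iff_dist]
  simp only [Real.dist_eq]
  constructor
  · intro h
    by_contra hcon
    -- If `R` does not diverge, it stays below some `K` along a subsequence. There the score is at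
    -- most `K'` times the estimation error, so a score of size `√lo / 2` forces an error of size
    -- `√lo / 2 / K'`, with probability bounded below.
    obtain ⟨K, hK⟩ : ∃ K, ∃ᶠ n in atTop, R n < K := by
      rw [tendsto_atTop] at hcon
      push Not at hcon
      obtain ⟨K, hK⟩ := hcon
      exact ⟨K, hK.mono fun n hn => by simpa using hn⟩
    obtain ⟨K', hK', hlow⟩ := hlower K
    have hlo := hε.lo_pos
    set q := ENNReal.ofReal (lo / 2 / (4 * (3 * hi * (1 + hi) + κ) / lo) ^ 2) with hq
    have hhi : 0 < hi := by
      have hb := hε.integral_score_sq hU (hc 1) (hc1 1 one_pos)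
      exact hlo.trans_le (hb.2.trans hb.1)
    have hqpos : 0 < q := by
      have := hε.third_nonneg
      exact ENNReal.ofReal_pos.2 (by positivity)
    have hs := Real.sqrt_pos.2 hlo
    have ht := (h (√lo / 2 / K') (by positivity)).add hN
    rw [add_zero] at ht
    have hev := ht.eventually_lt_const hqpos
    obtain ⟨n, hn1, hn2, hn3⟩ := (hK.and_eventually (hev.and (eventually_gt_atTop 0))).exists
    refine absurd hn2 (not_lt.2 ?_)
    refine (hε.le_measure_score_ge hU (hc n) (hc1 n hn3)).trans
      ((measure_mono ?_).trans (measure_union_le _ _))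
    -- Only monotonicity and subadditivity of `P` are used, so the exceptional sets `N n` need not
    -- be measurable.
    intro ω hω
    by_cases hm : ω ∈ N n
    · exact Or.inr hm
    · left
      have h1 : √lo / 2 ≤ |score U ε (c n) ω| := hω
      change √lo / 2 / K' ≤ _
      rw [div_le_iff₀ hK', mul_comm]
      exact h1.trans (hlow n hn3 hn1.le ω hm)
  · intro h x hx
    have hlim : Tendsto (fun n => ENNReal.ofReal (hi / (x * R n) ^ 2) + P (N n)) atTop (𝓝 0) := by
      have h1 : Tendsto (fun n => hi / (x * R n) ^ 2) atTop (𝓝 0) :=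
        tendsto_const_nhds.div_atTop
          ((tendsto_pow_atTop two_ne_zero).comp (h.const_mul_atTop hx))
      have h2 := ENNReal.tendsto_ofReal h1
      rw [ENNReal.ofReal_zero] at h2
      simpa using h2.add hN
    refine tendsto_of_tendsto_of_tendsto_of_le_of_le' tendsto_const_nhds hlim
      (Eventually.of_forall fun _ => zero_le) ?_
    -- Chebyshev at level `x * R n`. The case `n = 0` is excluded since dimension zero has no unit
    -- vector.
    filter_upwards [eventually_gt_atTop 0] with n hn
    have hRn := hR n hn
    refine le_trans ?_ (add_le_add_left
      (hε.measure_score_ge_le hU (hc n) (hc1 n hn) (mul_pos hx hRn)) _)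
    refine (measure_mono ?_).trans (measure_union_le _ _)
    intro ω hω
    by_cases hm : ω ∈ N n
    · exact Or.inr hm
    · left
      have h1 : x ≤ |est n ω - β| := hω
      exact (mul_le_mul_of_nonneg_right h1 hRn.le).trans (hupper n hn ω hm)

end CentralityOLS

/-! ### Laws of large numbers for the types -/

namespace CentralityOLS

variable {Ω : Type*} [MeasurableSpace Ω] {P : Measure Ω} [IsProbabilityMeasure P]
  {U : ℕ → Ω → I} {ε : ℕ → Ω → ℝ}

omit [IsProbabilityMeasure P] in
lemma IsSample.iIndepFun_type (hU : IsSample P U ε) : iIndepFun U P :=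
  hU.indep.comp (fun _ => Prod.fst) fun _ => measurable_fst

lemma IsSample.map_type_pair (hU : IsSample P U ε) {i j : ℕ} (hij : i ≠ j) :
    P.map (fun ω => (U i ω, U j ω)) = (volume : Measure (I × I)) := by
  have h := (hU.iIndepFun_type.indepFun hij).map_prod_eq_prod_map_map
    (hU.measurable_type i).aemeasurable (hU.measurable_type j).aemeasurable
  rw [h, hU.uniform, hU.uniform]
  rfl

lemma IsSample.integral_pair (hU : IsSample P U ε) {i j : ℕ} (hij : i ≠ j) {h : I → I → ℝ}
    (hm : Measurable fun z : I × I => h z.1 z.2) :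
    ∫ ω, h (U i ω) (U j ω) ∂P = ∫ z : I × I, h z.1 z.2 := by
  rw [← hU.map_type_pair hij, integral_map
    ((hU.measurable_type i).prodMk (hU.measurable_type j)).aemeasurable hm.aestronglyMeasurable]

/-- Each of the four coincidences ties one of four indices to another, leaving at most `n ^ 3`
quadruples. Only pairs of pairs sharing an index contribute to the variance of a sum over pairs, so
this count is what makes the variance `O(n ^ 3)`. -/
lemma sum_coincidences_le (n : ℕ) (s : Finset (Fin n × Fin n)) :
    ∑ q ∈ s, ∑ r ∈ s, ((if q.1 = r.1 then (1 : ℝ) else 0) + (if q.1 = r.2 then 1 else 0)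
      + (if q.2 = r.1 then 1 else 0) + (if q.2 = r.2 then 1 else 0)) ≤ 4 * (n : ℝ) ^ 3 := by
  have h0 : ∀ q r : Fin n × Fin n, 0 ≤ ((if q.1 = r.1 then (1 : ℝ) else 0) +
      (if q.1 = r.2 then 1 else 0) + (if q.2 = r.1 then 1 else 0) + (if q.2 = r.2 then 1 else 0)) :=
    fun q r => by positivity
  calc _ ≤ ∑ q ∈ s, ∑ r : Fin n × Fin n, ((if q.1 = r.1 then (1 : ℝ) else 0) +
        (if q.1 = r.2 then 1 else 0) + (if q.2 = r.1 then 1 else 0) +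
        (if q.2 = r.2 then 1 else 0)) :=
        Finset.sum_le_sum fun q _ => Finset.sum_le_sum_of_subset_of_nonneg (Finset.subset_univ _)
          fun r _ _ => h0 q r
    _ ≤ ∑ q : Fin n × Fin n, ∑ r : Fin n × Fin n, ((if q.1 = r.1 then (1 : ℝ) else 0) +
        (if q.1 = r.2 then 1 else 0) + (if q.2 = r.1 then 1 else 0) +
        (if q.2 = r.2 then 1 else 0)) :=
        Finset.sum_le_sum_of_subset_of_nonneg (Finset.subset_univ _)
          fun q _ _ => Finset.sum_nonneg fun r _ => h0 q r
    _ = 4 * (n : ℝ) ^ 3 := by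
        have e : ∀ a : Fin n, ∑ b : Fin n, (if a = b then (1 : ℝ) else 0) = 1 := fun a => by simp
        have e1 : ∀ a : Fin n, ∑ r : Fin n × Fin n, (if a = r.1 then (1 : ℝ) else 0) = n :=
          fun a => by
            refine (Fintype.sum_prod_type' fun b (_ : Fin n) => if a = b then (1 : ℝ) else 0).trans ?_
            simp only [Finset.sum_const, Finset.card_univ, Fintype.card_fin, nsmul_eq_mul,
              ← Finset.mul_sum, e, mul_one]
        have e2 : ∀ a : Fin n, ∑ r : Fin n × Fin n, (if a = r.2 then (1 : ℝ) else 0) = n :=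
          fun a => by
            refine (Fintype.sum_prod_type' fun (_ : Fin n) b => if a = b then (1 : ℝ) else 0).trans ?_
            simp only [Finset.sum_const, Finset.card_univ, Fintype.card_fin, nsmul_eq_mul, e,
              mul_one]
        simp only [Finset.sum_add_distrib, e1, e2, Finset.sum_const, Finset.card_univ,
          Fintype.card_prod, Fintype.card_fin, nsmul_eq_mul, Nat.cast_mul]
        ring

/-- The variance of a sum over pairs of a bounded kernel evaluated at the types. -/
lemma IsSample.integral_sq_sum_pairs_le (hU : IsSample P U ε) {h : I → I → ℝ}
    (hm : Measurable fun z : I × I => h z.1 z.2) {B : ℝ} (hB : ∀ u v, |h u v| ≤ B)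
    {n : ℕ} {s : Finset (Fin n × Fin n)} (hs : ∀ q ∈ s, q.1 ≠ q.2) :
    ∫ ω, (∑ q ∈ s, (h (U q.1 ω) (U q.2 ω) - ∫ z : I × I, h z.1 z.2)) ^ 2 ∂P
      ≤ 16 * B ^ 2 * (n : ℝ) ^ 3 := by
  set m := ∫ z : I × I, h z.1 z.2 with hmdef
  have hmB : |m| ≤ B := by
    have := norm_integral_le_of_norm_le_const (μ := (volume : Measure (I × I)))
      (f := fun z => h z.1 z.2) (ae_of_all _ fun z => hB z.1 z.2)
    simpa using this
  let X : Fin n × Fin n → Ω → ℝ := fun q ω => h (U q.1 ω) (U q.2 ω) - m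
  have hXm : ∀ q, Measurable (X q) := fun q =>
    (hm.comp ((hU.measurable_type q.1).prodMk (hU.measurable_type q.2))).sub_const m
  have hXB : ∀ q ω, |X q ω| ≤ 2 * B := fun q ω => by
    refine (abs_sub _ _).trans ?_
    linarith [hB (U q.1 ω) (U q.2 ω)]
  have hXI : ∀ q, Integrable (X q) P := fun q =>
    Integrable.of_bound (hXm q).aestronglyMeasurable (2 * B) (ae_of_all _ (hXB q))
  have hXXb : ∀ q r ω, |X q ω * X r ω| ≤ 4 * B ^ 2 := fun q r ω => by
    rw [abs_mul]
    have h1 := hXB q ω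
    have h2 := hXB r ω
    nlinarith [abs_nonneg (X q ω), abs_nonneg (X r ω)]
  have hXX : ∀ q r, Integrable (fun ω => X q ω * X r ω) P := fun q r =>
    Integrable.of_bound ((hXm q).mul (hXm r)).aestronglyMeasurable (4 * B ^ 2)
      (ae_of_all _ (hXXb q r))
  have h0 : ∀ q ∈ s, ∫ ω, X q ω ∂P = 0 := fun q hq => by
    have hne : (q.1 : ℕ) ≠ q.2 := fun h => hs q hq (Fin.ext h)
    have hI : Integrable (fun ω => h (U q.1 ω) (U q.2 ω)) P :=
      ((hXI q).add (integrable_const m)).congr (ae_of_all _ fun ω => by simp [X])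
    simp only [X]
    rw [integral_sub hI (integrable_const m), hU.integral_pair hne hm]
    simp [hmdef]
  have hE : ∀ q ∈ s, ∀ r ∈ s, ∫ ω, X q ω * X r ω ∂P ≤
      4 * B ^ 2 * ((if q.1 = r.1 then (1 : ℝ) else 0) + (if q.1 = r.2 then 1 else 0)
      + (if q.2 = r.1 then 1 else 0) + (if q.2 = r.2 then 1 else 0)) := by
    intro q hq r hr
    -- Disjoint pairs of types are independent, so their covariance vanishes; otherwise the crude
    -- bound is used and the sum of indicators is at least one.
    by_cases hd : q.1 ≠ r.1 ∧ q.1 ≠ r.2 ∧ q.2 ≠ r.1 ∧ q.2 ≠ r.2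
    · obtain ⟨d1, d2, d3, d4⟩ := hd
      have hind : IndepFun (X q) (X r) P := by
        have := hU.iIndepFun_type.indepFun_prodMk_prodMk hU.measurable_type q.1 q.2 r.1 r.2
          (fun h => d1 (Fin.ext h)) (fun h => d2 (Fin.ext h)) (fun h => d3 (Fin.ext h))
          (fun h => d4 (Fin.ext h))
        exact this.comp (φ := fun z => h z.1 z.2 - m) (ψ := fun z => h z.1 z.2 - m)
          (hm.sub_const m) (hm.sub_const m)
      have := hind.integral_fun_mul_eq_mul_integral (hXm q).aestronglyMeasurable
        (hXm r).aestronglyMeasurable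
      rw [this, h0 q hq]
      simp [d1, d2, d3, d4]
    · have h1 : ∫ ω, X q ω * X r ω ∂P ≤ 4 * B ^ 2 := by
        calc _ ≤ ∫ _, 4 * B ^ 2 ∂P := integral_mono (hXX q r) (integrable_const _)
              fun ω => (le_abs_self _).trans (hXXb q r ω)
          _ = _ := by simp
      refine h1.trans (le_mul_of_one_le_right (by positivity) ?_)
      have : q.1 = r.1 ∨ q.1 = r.2 ∨ q.2 = r.1 ∨ q.2 = r.2 := by tauto
      rcases this with h | h | h | h <;> rw [if_pos h] <;> split_ifs <;> norm_num
  calc ∫ ω, (∑ q ∈ s, X q ω) ^ 2 ∂P = ∫ ω, ∑ q ∈ s, ∑ r ∈ s, X q ω * X r ω ∂P := by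
        congr 1; funext ω; rw [sq, Finset.sum_mul_sum]
    _ = ∑ q ∈ s, ∑ r ∈ s, ∫ ω, X q ω * X r ω ∂P := by
        rw [integral_finsetSum _ fun q _ => integrable_finsetSum _ fun r _ => hXX q r]
        exact Finset.sum_congr rfl fun q _ => integral_finsetSum _ fun r _ => hXX q r
    _ ≤ ∑ q ∈ s, ∑ r ∈ s, 4 * B ^ 2 * ((if q.1 = r.1 then (1 : ℝ) else 0) +
          (if q.1 = r.2 then 1 else 0) + (if q.2 = r.1 then 1 else 0) +
          (if q.2 = r.2 then 1 else 0)) :=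
        Finset.sum_le_sum fun q hq => Finset.sum_le_sum fun r hr => hE q hq r hr
    _ ≤ 4 * B ^ 2 * (4 * (n : ℝ) ^ 3) := by
        simp only [← Finset.mul_sum]
        exact mul_le_mul_of_nonneg_left (sum_coincidences_le n s) (by positivity)
    _ = _ := by ring

/-- A law of large numbers for sums over pairs of a bounded kernel evaluated at the types. -/
lemma IsSample.tendsto_measure_sum_pairs (hU : IsSample P U ε) {h : I → I → ℝ}
    (hm : Measurable fun z : I × I => h z.1 z.2) {B : ℝ} (hB : ∀ u v, |h u v| ≤ B)
    {s : (n : ℕ) → Finset (Fin n × Fin n)} (hs : ∀ n, ∀ q ∈ s n, q.1 ≠ q.2) {η : ℝ} (hη : 0 < η) :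
    Tendsto (fun n : ℕ => P {ω | η * (n : ℝ) ^ 2 ≤
      |∑ q ∈ s n, (h (U q.1 ω) (U q.2 ω) - ∫ z : I × I, h z.1 z.2)|}) atTop (𝓝 0) := by
  set m := ∫ z : I × I, h z.1 z.2 with hmdef
  have hlim : Tendsto (fun n : ℕ => ENNReal.ofReal (16 * B ^ 2 / η ^ 2 / n)) atTop (𝓝 0) := by
    have := ENNReal.tendsto_ofReal (tendsto_const_div_atTop_nhds_zero_nat (16 * B ^ 2 / η ^ 2))
    rwa [ENNReal.ofReal_zero] at this
  refine tendsto_of_tendsto_of_tendsto_of_le_of_le' tendsto_const_nhds hlim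
    (Eventually.of_forall fun _ => zero_le) ?_
  filter_upwards [eventually_gt_atTop 0] with n hn
  have hn' : (0 : ℝ) < n := by exact_mod_cast hn
  let S : Ω → ℝ := fun ω => ∑ q ∈ s n, (h (U q.1 ω) (U q.2 ω) - m)
  have hSm : Measurable S := Finset.measurable_sum _ fun q _ =>
    (hm.comp ((hU.measurable_type q.1).prodMk (hU.measurable_type q.2))).sub_const m
  have hSb : ∀ ω, |S ω| ≤ ∑ q ∈ s n, (B + |m|) := fun ω =>
    (Finset.abs_sum_le_sum_abs _ _).trans (Finset.sum_le_sum fun q _ => (abs_sub _ _).trans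
      (add_le_add (hB _ _) le_rfl))
  have hSI : Integrable (fun ω => S ω ^ 2) P :=
    Integrable.of_bound (hSm.pow_const 2).aestronglyMeasurable ((∑ q ∈ s n, (B + |m|)) ^ 2)
      (ae_of_all _ fun ω => by
        rw [Real.norm_eq_abs, abs_pow]
        exact pow_le_pow_left₀ (abs_nonneg _) (hSb ω) 2)
  have hch := mul_meas_ge_le_integral_of_nonneg (μ := P) (f := fun ω => S ω ^ 2)
    (ae_of_all _ fun ω => sq_nonneg _) hSI ((η * (n : ℝ) ^ 2) ^ 2)
  have hset : {ω | η * (n : ℝ) ^ 2 ≤ |S ω|} = {ω | (η * (n : ℝ) ^ 2) ^ 2 ≤ S ω ^ 2} := by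
    ext ω
    simp only [Set.mem_ofPred_eq]
    rw [← sq_abs (S ω), sq_le_sq₀ (by positivity) (abs_nonneg _)]
  change P {ω | η * (n : ℝ) ^ 2 ≤ |S ω|} ≤ _
  rw [hset, ← ENNReal.ofReal_toReal (measure_ne_top P {ω | (η * (n : ℝ) ^ 2) ^ 2 ≤ S ω ^ 2})]
  refine ENNReal.ofReal_le_ofReal ?_
  -- A variance of order `n ^ 3` against a squared threshold of order `n ^ 4` leaves a probability
  -- of order `1 / n`.
  have h2 := hch.trans (hU.integral_sq_sum_pairs_le hm hB (hs n))
  rw [div_div, le_div_iff₀ (by positivity)]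
  have h3 : (η * (n : ℝ) ^ 2) ^ 2 = (η ^ 2 * n) * (n : ℝ) ^ 3 := by ring
  have h4 : (0 : ℝ) < (n : ℝ) ^ 3 := by positivity
  refine le_of_mul_le_mul_right ?_ h4
  calc _ = (η ^ 2 * n) * (n : ℝ) ^ 3 *
        P.real {ω | (η * (n : ℝ) ^ 2) ^ 2 ≤ S ω ^ 2} := by
          rw [Measure.real]; ring
    _ ≤ _ := by rw [← h3]; exact h2

/-- A weak law of large numbers for bounded functions of the types. -/
lemma IsSample.tendsto_measure_sum (hU : IsSample P U ε) {g : I → ℝ}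
    (hg : Measurable g) {B : ℝ} (hB : ∀ u, |g u| ≤ B) {η : ℝ} (hη : 0 < η) :
    Tendsto (fun n : ℕ => P {ω | η * (n : ℝ) ≤ |∑ i : Fin n, (g (U i ω) - ∫ u, g u)|})
      atTop (𝓝 0) := by
  have hint : ∫ z : I × I, g z.1 = ∫ u, g u := by
    have := integral_fun_fst (μ := (volume : Measure I)) (ν := (volume : Measure I)) g
    rw [probReal_univ, one_smul] at this
    exact this
  have hlim := hU.tendsto_measure_sum_pairs (h := fun u _ => g u) (hg.comp measurable_fst)
    (fun u _ => hB u) (s := fun n => Finset.univ.offDiag)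
    (fun n q hq => (Finset.mem_offDiag.1 hq).2.2) (half_pos hη)
  refine tendsto_of_tendsto_of_tendsto_of_le_of_le' tendsto_const_nhds hlim
    (Eventually.of_forall fun _ => zero_le) ?_
  filter_upwards [eventually_ge_atTop 2] with n hn
  have hn' : (2 : ℝ) ≤ n := by exact_mod_cast hn
  refine measure_mono fun ω hω => ?_
  simp only [Set.mem_ofPred_eq] at hω ⊢
  rw [hint]
  -- Each agent is the first entry of `n - 1` off-diagonal pairs, which reduces the single sum to a
  -- sum over pairs. Since `n - 1 ≥ n / 2` for `n ≥ 2`, the threshold `η / 2` suffices there.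
  have hsum : ∑ q ∈ (Finset.univ : Finset (Fin n)).offDiag, (g (U q.1 ω) - ∫ u, g u)
      = (n - 1) * ∑ i : Fin n, (g (U i ω) - ∫ u, g u) := by
    have h1 : ∑ q ∈ (Finset.univ : Finset (Fin n)).offDiag, (g (U q.1 ω) - ∫ u, g u)
        = ∑ i : Fin n, ∑ j ∈ Finset.univ.erase i, (g (U i ω) - ∫ u, g u) := by
      rw [Finset.sum_sigma']
      refine Finset.sum_bij' (fun q _ => ⟨q.1, q.2⟩) (fun p _ => (p.1, p.2)) ?_ ?_ ?_ ?_ ?_ <;>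
        simp [eq_comm]
    rw [h1, Finset.mul_sum]
    refine Finset.sum_congr rfl fun i _ => ?_
    rw [Finset.sum_const, Finset.card_erase_of_mem (Finset.mem_univ i), Finset.card_univ,
      Fintype.card_fin, nsmul_eq_mul, Nat.cast_sub (by omega), Nat.cast_one]
  rw [hsum, abs_mul, abs_of_nonneg (by linarith : (0 : ℝ) ≤ n - 1)]
  calc η / 2 * (n : ℝ) ^ 2 = (n / 2) * (η * n) := by ring
    _ ≤ (n - 1) * (η * n) := by gcongr; linarith
    _ ≤ _ := mul_le_mul_of_nonneg_left hω (by linarith)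

end CentralityOLS

/-! ### Degree and diffusion centralities -/

noncomputable section

namespace CentralityOLS

section Normalize

variable {n : ℕ}

/-- The unit vector in the direction of `c`, or a constant unit vector if `c = 0`. -/
def normalize (c : Fin n → ℝ) : Fin n → ℝ :=
  if c ⬝ᵥ c = 0 then fun _ => (√n)⁻¹ else (√(c ⬝ᵥ c))⁻¹ • c

lemma dotProduct_self_nonneg (c : Fin n → ℝ) : 0 ≤ c ⬝ᵥ c :=
  Finset.sum_nonneg fun i _ => mul_self_nonneg (c i)

lemma normalize_dotProduct_self (hn : 0 < n) (c : Fin n → ℝ) : normalize c ⬝ᵥ normalize c = 1 := by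
  have hn' : (0 : ℝ) < n := by exact_mod_cast hn
  unfold normalize
  split_ifs with h
  · simp only [dotProduct, Finset.sum_const, Finset.card_univ, Fintype.card_fin, nsmul_eq_mul]
    rw [← mul_inv, Real.mul_self_sqrt hn'.le, mul_inv_cancel₀ hn'.ne']
  · rw [smul_dotProduct, dotProduct_smul, smul_eq_mul, smul_eq_mul, ← mul_assoc, ← mul_inv,
      Real.mul_self_sqrt (dotProduct_self_nonneg c), inv_mul_cancel₀ h]

lemma measurable_dotProduct_self : Measurable fun c : Fin n → ℝ => c ⬝ᵥ c := by
  unfold dotProduct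
  fun_prop

lemma measurable_normalize : Measurable (normalize : (Fin n → ℝ) → Fin n → ℝ) := by
  unfold normalize
  refine Measurable.ite (measurableSet_eq_fun measurable_dotProduct_self measurable_const)
    measurable_const ?_
  exact (measurable_dotProduct_self.sqrt.inv).smul measurable_id

/-- The error of the least squares slope is the score of the normalised regressor divided by the
norm of the regressor. -/
lemma abs_olsSlope_sub_mul (β : ℝ) (e c : Fin n → ℝ) (hc : c ⬝ᵥ c ≠ 0) :
    |olsSlope (fun i => β * c i + e i) c - β| * √(c ⬝ᵥ c) = |e ⬝ᵥ normalize c| := by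
  have hpos : 0 < √(c ⬝ᵥ c) :=
    Real.sqrt_pos.2 (lt_of_le_of_ne (dotProduct_self_nonneg c) (Ne.symm hc))
  have h1 : (fun i => β * c i + e i) ⬝ᵥ c = β * (c ⬝ᵥ c) + e ⬝ᵥ c := by
    simp only [dotProduct, Finset.mul_sum, ← Finset.sum_add_distrib]
    exact Finset.sum_congr rfl fun i _ => by ring
  have h2 : olsSlope (fun i => β * c i + e i) c - β = (e ⬝ᵥ c) / (c ⬝ᵥ c) := by
    rw [olsSlope, h1]; field_simp; ring
  rw [h2, normalize, if_neg hc, dotProduct_smul, smul_eq_mul, abs_div, abs_mul, abs_inv,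
    abs_of_pos hpos, abs_of_nonneg (dotProduct_self_nonneg c)]
  nth_rewrite 1 [← Real.mul_self_sqrt (dotProduct_self_nonneg c)]
  field_simp

end Normalize

section Adjacency

variable {f : I → I → ℝ} {p : ℝ} {n : ℕ}

lemma IsGraphon.adjacency_nonneg (hf : IsGraphon f) (hp : 0 ≤ p) (u : Fin n → I) (i j : Fin n) :
    0 ≤ adjacency f p u i j := by
  simp only [adjacency, Matrix.of_apply]
  split_ifs
  · exact le_rfl
  · exact mul_nonneg hp (hf.nonneg _ _)

lemma IsGraphon.adjacency_le (hf : IsGraphon f) (hp : 0 ≤ p) (u : Fin n → I) (i j : Fin n) :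
    adjacency f p u i j ≤ p := by
  simp only [adjacency, Matrix.of_apply]
  split_ifs
  · exact hp
  · exact mul_le_of_le_one_right hp (hf.le_one _ _)

lemma IsGraphon.measurable_adjacency (hf : IsGraphon f) (p : ℝ) (i j : Fin n) :
    Measurable fun u : Fin n → I => adjacency f p u i j := by
  simp only [adjacency, Matrix.of_apply]
  split_ifs
  · exact measurable_const
  · have h : Measurable fun u : Fin n → I => (u (min i j), u (max i j)) := by fun_prop
    exact (hf.measurable.comp h).const_mul p

lemma measurable_pow_mulVec {α : Type*} [MeasurableSpace α] {A : α → Matrix (Fin n) (Fin n) ℝ}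
    (hA : ∀ i j, Measurable fun a => A a i j) (x : Fin n → ℝ) (t : ℕ) :
    Measurable fun a => (A a ^ t) *ᵥ x := by
  induction t with
  | zero => simp
  | succ t ih =>
    refine measurable_pi_lambda _ fun i => ?_
    simp only [pow_succ', ← Matrix.mulVec_mulVec]
    simp only [Matrix.mulVec, dotProduct] at ih ⊢
    exact Finset.measurable_sum _ fun j _ => (hA i j).mul ((measurable_pi_apply j).comp ih)

/-- Every row sum lies between `0` and `n * p`, so each multiplication by `A` multiplies the upper
bound by at most `n * p`. -/
lemma pow_mulVec_one_bounds {A : Matrix (Fin n) (Fin n) ℝ} (h0 : ∀ i j, 0 ≤ A i j)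
    (hp : ∀ i j, A i j ≤ p) (t : ℕ) (i : Fin n) :
    0 ≤ ((A ^ t) *ᵥ fun _ => (1 : ℝ)) i ∧ ((A ^ t) *ᵥ fun _ => (1 : ℝ)) i ≤ (n * p) ^ t := by
  induction t generalizing i with
  | zero => simp
  | succ t ih =>
    rw [pow_succ', ← Matrix.mulVec_mulVec]
    simp only [Matrix.mulVec, dotProduct] at ih ⊢
    refine ⟨Finset.sum_nonneg fun j _ => mul_nonneg (h0 i j) (ih j).1, ?_⟩
    calc _ ≤ ∑ j : Fin n, p * (n * p) ^ t := Finset.sum_le_sum fun j _ =>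
          mul_le_mul (hp i j) (ih j).2 (ih j).1 ((h0 i j).trans (hp i j))
      _ = _ := by
          rw [Finset.sum_const, Finset.card_univ, Fintype.card_fin, nsmul_eq_mul]; ring

lemma diffusionCentrality_eq (δ : ℝ) (T : ℕ) (A : Matrix (Fin n) (Fin n) ℝ) :
    diffusionCentrality δ T A = ∑ t ∈ Finset.Icc 1 T, δ ^ t • ((A ^ t) *ᵥ fun _ => (1 : ℝ)) := by
  rw [diffusionCentrality, Matrix.sum_mulVec]
  exact Finset.sum_congr rfl fun t _ => Matrix.smul_mulVec _ _ _

lemma degreeCentrality_eq_diffusionCentrality (A : Matrix (Fin n) (Fin n) ℝ) :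
    degreeCentrality A = diffusionCentrality 1 1 A := by
  simp [degreeCentrality, diffusionCentrality]

lemma IsGraphon.measurable_diffusionCentrality (hf : IsGraphon f) (p δ : ℝ) (T : ℕ) :
    Measurable fun u : Fin n → I => diffusionCentrality δ T (adjacency f p u) := by
  simp only [diffusionCentrality_eq]
  exact Finset.measurable_sum _ fun t _ =>
    (measurable_pow_mulVec (fun i j => hf.measurable_adjacency p i j) _ t).const_smul (δ ^ t)

/-- The lower bound keeps only the term `t = 1`. For the upper bound one factor `n * p` is taken out
of each power and the others are absorbed in `L ^ T`, which needs `1 ≤ L`; the result stays linear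
in `n * p`, as the norm estimate requires. -/
lemma diffusionCentrality_bounds {A : Matrix (Fin n) (Fin n) ℝ} (h0 : ∀ i j, 0 ≤ A i j)
    (hp : ∀ i j, A i j ≤ p) (hp0 : 0 ≤ p) {δ : ℝ} (hδ : 0 < δ) (hδ1 : δ ≤ 1) {T : ℕ} (hT : 1 ≤ T)
    {L : ℝ} (hL : 1 ≤ L) (i : Fin n) :
    δ * ∑ j, A i j ≤ diffusionCentrality δ T A i ∧
      (n * p ≤ L → diffusionCentrality δ T A i ≤ T * L ^ T * (n * p)) := by
  have hb := pow_mulVec_one_bounds h0 hp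
  rw [diffusionCentrality_eq, Finset.sum_apply]
  simp only [Pi.smul_apply, smul_eq_mul]
  constructor
  · have h1 := Finset.single_le_sum
      (f := fun t => δ ^ t * ((A ^ t) *ᵥ fun _ => (1 : ℝ)) i) (s := Finset.Icc 1 T)
      (fun t _ => mul_nonneg (pow_nonneg hδ.le t) (hb t i).1) (Finset.mem_Icc.2 ⟨le_rfl, hT⟩)
    refine le_trans (le_of_eq ?_) h1
    simp [Matrix.mulVec, dotProduct]
  · intro hnp
    have hnp0 : 0 ≤ n * p := by positivity
    calc _ ≤ ∑ t ∈ Finset.Icc 1 T, L ^ T * (n * p) := by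
          refine Finset.sum_le_sum fun t ht => ?_
          obtain ⟨ht1, ht2⟩ := Finset.mem_Icc.1 ht
          obtain ⟨r, rfl⟩ := Nat.exists_eq_succ_of_ne_zero (by omega : t ≠ 0)
          calc _ ≤ 1 * (n * p) ^ (r + 1) :=
                mul_le_mul (pow_le_one₀ hδ.le hδ1) (hb _ i).2 (hb _ i).1 zero_le_one
            _ = (n * p) ^ r * (n * p) := by ring
            _ ≤ L ^ r * (n * p) := by gcongr
            _ ≤ L ^ T * (n * p) := by gcongr; omega
      _ = _ := by simp [mul_assoc]

end Adjacency

lemma four_mul_card_lt_pairs (n : ℕ) (hn : 2 ≤ n) :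
    n ^ 2 ≤ 4 * (Finset.univ.filter fun q : Fin n × Fin n => q.1 < q.2).card := by
  have h1 : (Finset.univ.filter fun q : Fin n × Fin n => q.1 < q.2).card =
      (Finset.univ.filter fun q : Fin n × Fin n => q.2 < q.1).card :=
    Finset.card_nbij' Prod.swap Prod.swap (fun q hq => by simpa using hq)
      (fun q hq => by simpa using hq) (fun q _ => Prod.swap_swap q) (fun q _ => Prod.swap_swap q)
  have h2 : (Finset.univ : Finset (Fin n)).offDiag =
      (Finset.univ.filter fun q : Fin n × Fin n => q.1 < q.2) ∪
      (Finset.univ.filter fun q : Fin n × Fin n => q.2 < q.1) := by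
    ext q
    simp [lt_or_lt_iff_ne]
  have h3 : (Finset.univ : Finset (Fin n)).offDiag.card ≤ _ := (congrArg _ h2).trans_le
    (Finset.card_union_le _ _)
  rw [Finset.offDiag_card, Finset.card_univ, Fintype.card_fin, ← h1] at h3
  have h4 : 2 * n ≤ n * n := by nlinarith
  have : n ^ 2 = n * n := sq n
  omega

variable {Ω : Type*} [MeasurableSpace Ω] {P : Measure Ω} [IsProbabilityMeasure P]
  {U : ℕ → Ω → I} {ε : ℕ → Ω → ℝ} {lo hi κ : ℝ} {f : I → I → ℝ} {p : ℕ → ℝ}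

omit [IsProbabilityMeasure P] [MeasurableSpace Ω] in
lemma network_eq (U : ℕ → Ω → I) (n : ℕ) (ω : Ω) :
    network f p U n ω = adjacency f (p n) (types U n ω) := rfl

/-- With probability tending to one, the total weight of the network is of order `p n * n ^ 2`. -/
lemma IsGraphon.tendsto_measure_sum_network_lt (hf : IsGraphon f) (hU : IsSample P U ε)
    (hp : ∀ n, 0 < p n) :
    Tendsto (fun n : ℕ => P {ω | ∑ i, ∑ j, network f p U n ω i j <
      (∫ z : I × I, f z.1 z.2) / 8 * (p n * (n : ℝ) ^ 2)}) atTop (𝓝 0) := by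
  set m := ∫ z : I × I, f z.1 z.2 with hm
  have hmpos : 0 < m := hf.integral_pos
  have hlim := hU.tendsto_measure_sum_pairs hf.measurable (B := 1)
    (fun u v => by rw [abs_of_nonneg (hf.nonneg u v)]; exact hf.le_one u v)
    (s := fun n => Finset.univ.filter fun q : Fin n × Fin n => q.1 < q.2)
    (fun n q hq => (Finset.mem_filter.1 hq).2.ne) (η := m / 8) (by positivity)
  refine tendsto_of_tendsto_of_tendsto_of_le_of_le' tendsto_const_nhds hlim
    (Eventually.of_forall fun _ => zero_le) ?_
  filter_upwards [eventually_ge_atTop 2] with n hn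
  refine measure_mono fun ω hω => ?_
  simp only [Set.mem_ofPred_eq] at hω ⊢
  set s := Finset.univ.filter fun q : Fin n × Fin n => q.1 < q.2 with hs
  -- There are at least `n ^ 2 / 4` pairs `i < j`, so `f` summed over them has mean at least `m * n
  -- ^ 2 / 4`; falling below half of that is a deviation of at least `m / 8 * n ^ 2`. Only the
  -- entries above the diagonal are kept.
  have hcard : (n : ℝ) ^ 2 ≤ 4 * (s.card : ℝ) := by exact_mod_cast four_mul_card_lt_pairs n hn
  have h1 : p n * ∑ q ∈ s, f (U q.1 ω) (U q.2 ω) ≤ ∑ i, ∑ j, network f p U n ω i j := by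
    refine le_trans ?_ (le_of_eq (Fintype.sum_prod_type' fun i j => network f p U n ω i j))
    rw [Finset.mul_sum]
    calc _ = ∑ q ∈ s, network f p U n ω q.1 q.2 := by
          refine Finset.sum_congr rfl fun q hq => ?_
          have hlt : q.1 < q.2 := (Finset.mem_filter.1 hq).2
          simp only [network, adjacency, Matrix.of_apply, if_neg hlt.ne, min_eq_left hlt.le,
            max_eq_right hlt.le]
      _ ≤ _ := Finset.sum_le_sum_of_subset_of_nonneg (Finset.subset_univ _)
          fun q _ _ => hf.adjacency_nonneg (hp n).le _ _ _
  have h2 : ∑ q ∈ s, f (U q.1 ω) (U q.2 ω) < m / 8 * (n : ℝ) ^ 2 := by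
    refine lt_of_mul_lt_mul_left ?_ (hp n).le
    calc _ ≤ _ := h1
      _ < _ := hω
      _ = _ := by ring
  rw [Finset.sum_sub_distrib, Finset.sum_const, nsmul_eq_mul, abs_sub_comm]
  refine le_trans ?_ (le_abs_self _)
  nlinarith

/-- Least squares on the diffusion centrality is consistent exactly when `p n ≻ n ^ (-3/2)`. -/
theorem consistent_diffusion_iff (hf : IsGraphon f) (hp : ∀ n, 0 < p n)
    (hU : IsSample P U ε) (hε : ErrorMoments P U ε lo hi κ) (β : ℝ)
    {δ : ℝ} (hδ : 0 < δ) (hδ1 : δ ≤ 1) {T : ℕ} (hT : 1 ≤ T) :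
    OLSConsistent P β ε (fun n ω => diffusionCentrality δ T (network f p U n ω)) ↔
      Tendsto (fun n : ℕ => p n / (n : ℝ) ^ (-(3 / 2) : ℝ)) atTop atTop := by
  set m := ∫ z : I × I, f z.1 z.2 with hm
  have hmpos : 0 < m := hf.integral_pos
  set b := δ * (m / 8) with hb
  have hbpos : 0 < b := by positivity
  have hroot : ∀ n : ℕ, p n / (n : ℝ) ^ (-(3 / 2) : ℝ) = p n * (n * √n) := by
    intro n
    rcases Nat.eq_zero_or_pos n with rfl | hn
    · simp
    · have hn' : (0 : ℝ) < n := by exact_mod_cast hn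
      rw [Real.rpow_neg hn'.le, div_inv_eq_mul, show (3 / 2 : ℝ) = 1 + 1 / 2 by norm_num,
        Real.rpow_add hn', Real.rpow_one, ← Real.sqrt_eq_rpow]
  simp only [hroot]
  have hiff : Tendsto (fun n : ℕ => b * (p n * (n * √n))) atTop atTop ↔
      Tendsto (fun n : ℕ => p n * (n * √n)) atTop atTop :=
    tendsto_const_mul_atTop_of_pos hbpos
  rw [← hiff, OLSConsistent]
  let C : (n : ℕ) → (Fin n → I) → Fin n → ℝ := fun n u =>
    diffusionCentrality δ T (adjacency f (p n) u)
  -- Off the exceptional event the entries of `C` sum to at least `b * p n * n ^ 2`. By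
  -- Cauchy-Schwarz `‖C‖ ^ 2` is at least the square of that sum divided by `n`, which produces the
  -- exponent `3 / 2`.
  have hlow : ∀ n, 0 < n → ∀ ω,
      ω ∉ {ω | ∑ i, ∑ j, network f p U n ω i j < m / 8 * (p n * (n : ℝ) ^ 2)} →
      b * (p n * (n * √n)) ≤ √(C n (types U n ω) ⬝ᵥ C n (types U n ω)) := by
    intro n hn ω hω
    have hn' : (0 : ℝ) < n := by exact_mod_cast hn
    simp only [Set.mem_ofPred_eq, not_lt] at hω
    have hpn := hp n
    have h0 := fun i j => hf.adjacency_nonneg (hp n).le (types U n ω) i j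
    have h1 := fun i j => hf.adjacency_le (hp n).le (types U n ω) i j
    refine Real.le_sqrt_of_sq_le ?_
    have hs : b * (p n * (n : ℝ) ^ 2) ≤ ∑ i, C n (types U n ω) i := by
      calc b * (p n * (n : ℝ) ^ 2) = δ * (m / 8 * (p n * (n : ℝ) ^ 2)) := by rw [hb]; ring
        _ ≤ δ * ∑ i, ∑ j, network f p U n ω i j := by gcongr
        _ = ∑ i, δ * ∑ j, network f p U n ω i j := by rw [Finset.mul_sum]
        _ ≤ _ := Finset.sum_le_sum fun i _ =>
            (diffusionCentrality_bounds h0 h1 hpn.le hδ hδ1 hT le_rfl i).1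
    have hcs := sq_sum_le_card_mul_sum_sq (s := Finset.univ) (f := C n (types U n ω))
    rw [Finset.card_univ, Fintype.card_fin, sum_sq_eq_dotProduct_self] at hcs
    have hs2 := pow_le_pow_left₀ (by positivity) hs 2
    refine le_of_mul_le_mul_left ?_ hn'
    calc (n : ℝ) * (b * (p n * (n * √n))) ^ 2
        = (b * p n) ^ 2 * n ^ 3 * √n ^ 2 := by ring
      _ = (b * (p n * (n : ℝ) ^ 2)) ^ 2 := by rw [Real.sq_sqrt hn'.le]; ring
      _ ≤ _ := hs2.trans hcs
  have hpos : ∀ n, 0 < n → 0 < b * (p n * (n * √n)) := fun n hn => by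
    have hn' : (0 : ℝ) < n := by exact_mod_cast hn
    have := hp n
    have := Real.sqrt_pos.2 hn'
    positivity
  have hols : ∀ n, 0 < n → ∀ ω,
      ω ∉ {ω | ∑ i, ∑ j, network f p U n ω i j < m / 8 * (p n * (n : ℝ) ^ 2)} →
      |olsSlope (outcome β ε (fun n ω => C n (types U n ω)) n ω) (C n (types U n ω)) - β| *
        √(C n (types U n ω) ⬝ᵥ C n (types U n ω)) =
      |score U ε (fun u => normalize (C n u)) ω| := by
    intro n hn ω hω
    exact abs_olsSlope_sub_mul β (errors ε n ω) _
      (Real.sqrt_pos.1 ((hpos n hn).trans_le (hlow n hn ω hω))).ne'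
  -- The fallback value of `normalize` gives unit weights for every profile of types, including
  -- those with `C = 0`, which lie in the exceptional event.
  refine hε.tendstoInMeasure_iff hU (c := fun n u => normalize (C n u))
    (fun n => measurable_normalize.comp (hf.measurable_diffusionCentrality (p n) δ T))
    (fun n hn u => normalize_dotProduct_self hn _) (hf.tendsto_measure_sum_network_lt hU hp) hpos
    ?_ ?_
  · intro n hn ω hω
    rw [← hols n hn ω hω]
    exact mul_le_mul_of_nonneg_left (hlow n hn ω hω) (abs_nonneg _)
  · intro K
    -- A bound on `p n * n * √n` also bounds `n * p n`, as `√n ≥ 1`. Each entry of `C` is then at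
    -- most `T * L ^ T * (n * p n)`, and the norm gains a factor `√n`.
    set L := max 1 (K / b) with hL
    have hL1 : 1 ≤ L := le_max_left _ _
    have hT' : (0 : ℝ) < T := by exact_mod_cast hT
    refine ⟨T * L ^ T * L, by positivity, fun n hn hK ω hω => ?_⟩
    have hn' : (1 : ℝ) ≤ n := by exact_mod_cast hn
    have hpn := hp n
    have h0 := fun i j => hf.adjacency_nonneg (hp n).le (types U n ω) i j
    have h1 := fun i j => hf.adjacency_le (hp n).le (types U n ω) i j
    have hrL : p n * (n * √n) ≤ L := by
      refine le_trans ?_ (le_max_right _ _)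
      rw [le_div_iff₀ hbpos]; linarith
    have hs1 : 1 ≤ √(n : ℝ) := Real.one_le_sqrt.2 hn'
    have hnp : n * p n ≤ L := by
      refine le_trans ?_ hrL
      calc n * p n = p n * (n * 1) := by ring
        _ ≤ _ := by gcongr
    rw [← hols n hn ω hω, mul_comm]
    refine mul_le_mul_of_nonneg_right ?_ (abs_nonneg _)
    refine Real.sqrt_le_iff.2 ⟨by positivity, ?_⟩
    have hCi : ∀ i, C n (types U n ω) i ^ 2 ≤ (T * L ^ T * (n * p n)) ^ 2 := fun i => by
      have hd := diffusionCentrality_bounds h0 h1 hpn.le hδ hδ1 hT hL1 i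
      refine pow_le_pow_left₀ (le_trans ?_ hd.1) (hd.2 hnp) 2
      exact mul_nonneg hδ.le (Finset.sum_nonneg fun j _ => h0 i j)
    rw [← sum_sq_eq_dotProduct_self]
    calc _ ≤ ∑ i : Fin n, (T * L ^ T * (n * p n)) ^ 2 := Finset.sum_le_sum fun i _ => hCi i
      _ = (T * L ^ T) ^ 2 * (p n * n) ^ 2 * n := by
          rw [Finset.sum_const, Finset.card_univ, Fintype.card_fin, nsmul_eq_mul]; ring
      _ = (T * L ^ T) ^ 2 * (p n * (n * √n)) ^ 2 := by
          have e : (p n * (n * √n)) ^ 2 = (p n * n) ^ 2 * √n ^ 2 := by ring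
          rw [e, Real.sq_sqrt (by linarith : (0 : ℝ) ≤ n)]; ring
      _ ≤ (T * L ^ T) ^ 2 * L ^ 2 := by gcongr
      _ = _ := by ring

end CentralityOLS

end

/-! ### Leading eigenvectors of nonnegative symmetric matrices -/

noncomputable section

namespace CentralityOLS

section Spectral

variable {n : ℕ} {A : Matrix (Fin n) (Fin n) ℝ}

/-- An orthonormal eigenbasis of a real symmetric matrix, in terms of plain vectors. -/
lemma exists_orthonormal_eigenbasis (hA : A.IsSymm) :
    ∃ (b : Fin n → Fin n → ℝ) (μ : Fin n → ℝ), (∀ i j, b i ⬝ᵥ b j = if i = j then 1 else 0) ∧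
      (∀ i, A *ᵥ b i = μ i • b i) ∧ ∀ x, x = ∑ i, (b i ⬝ᵥ x) • b i := by
  have hH : A.IsHermitian := by
    rw [Matrix.IsHermitian, Matrix.conjTranspose_eq_transpose_of_trivial]; exact hA
  have hin : ∀ x y : EuclideanSpace ℝ (Fin n), inner ℝ x y = (x : Fin n → ℝ) ⬝ᵥ (y : Fin n → ℝ) :=
    fun x y => by
      simp only [PiLp.inner_apply, dotProduct, RCLike.inner_apply, conj_trivial, mul_comm]
  refine ⟨fun i => hH.eigenvectorBasis i, hH.eigenvalues, fun i j => ?_,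
    fun i => hH.mulVec_eigenvectorBasis i, fun x => ?_⟩
  · rw [← hin]
    exact orthonormal_iff_ite.1 hH.eigenvectorBasis.orthonormal i j
  · have h := hH.eigenvectorBasis.sum_repr' (WithLp.toLp 2 x)
    have h2 := congrArg (WithLp.ofLp) h
    simp only [WithLp.ofLp_sum, WithLp.ofLp_smul, hin] at h2
    exact h2.symm

lemma dotProduct_mulVec_comm (hA : A.IsSymm) (x y : Fin n → ℝ) :
    x ⬝ᵥ A *ᵥ y = (A *ᵥ x) ⬝ᵥ y := by
  rw [Matrix.dotProduct_mulVec, ← Matrix.mulVec_transpose, hA.eq]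

lemma hasEigenvalue_of_mulVec {v : Fin n → ℝ} {l : ℝ} (hv : v ≠ 0) (h : A *ᵥ v = l • v) :
    Module.End.HasEigenvalue (Matrix.toLin' A) l :=
  Module.End.hasEigenvalue_of_hasEigenvector
    ⟨Module.End.mem_eigenspace_iff.2 (by rw [Matrix.toLin'_apply, h]), hv⟩

lemma exists_mulVec_of_hasEigenvalue {l : ℝ}
    (h : Module.End.HasEigenvalue (Matrix.toLin' A) l) : ∃ v ≠ 0, A *ᵥ v = l • v := by
  obtain ⟨v, hv⟩ := h.exists_hasEigenvector
  exact ⟨v, hv.2, by simpa [Matrix.toLin'_apply] using hv.apply_eq_smul⟩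

lemma dotProduct_self_pos {v : Fin n → ℝ} (hv : v ≠ 0) : 0 < v ⬝ᵥ v :=
  lt_of_le_of_ne (dotProduct_self_nonneg v) fun h => hv (dotProduct_self_eq_zero.1 h.symm)

/-- The triangle inequality with nonnegative entries. Passing from `x` to `|x|` keeps the norm and
cannot lower the Rayleigh quotient, which is the source of the nonnegative eigenvector. -/
lemma abs_dotProduct_mulVec_le (h0 : ∀ i j, 0 ≤ A i j) (x : Fin n → ℝ) :
    |x ⬝ᵥ A *ᵥ x| ≤ |x| ⬝ᵥ A *ᵥ |x| := by
  simp only [dotProduct, Matrix.mulVec, Finset.mul_sum]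
  refine (Finset.abs_sum_le_sum_abs _ _).trans (Finset.sum_le_sum fun i _ => ?_)
  refine (Finset.abs_sum_le_sum_abs _ _).trans (Finset.sum_le_sum fun j _ => ?_)
  rw [abs_mul, abs_mul, abs_of_nonneg (h0 i j)]
  rfl

lemma abs_dotProduct_abs (x : Fin n → ℝ) : |x| ⬝ᵥ |x| = x ⬝ᵥ x := by
  simp only [dotProduct, Pi.abs_apply, abs_mul_abs_self]

/-- Perron-Frobenius for symmetric matrices with nonnegative entries: the maximum of the Rayleigh
quotient is the leading eigenvalue, and it has a nonnegative eigenvector. -/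
lemma exists_leading_eigenvalue (hn : 0 < n) (hA : A.IsSymm) (h0 : ∀ i j, 0 ≤ A i j) :
    ∃ (l : ℝ) (w : Fin n → ℝ), (∀ i, 0 ≤ w i) ∧ w ⬝ᵥ w = 1 ∧ A *ᵥ w = l • w ∧
      IsLeadingEigenvalue A l ∧ ∀ x, x ⬝ᵥ A *ᵥ x ≤ l * (x ⬝ᵥ x) := by
  obtain ⟨b, μ, hb, hμ, hx⟩ := exists_orthonormal_eigenbasis hA
  have : Nonempty (Fin n) := ⟨⟨0, hn⟩⟩
  obtain ⟨i₀, hi₀⟩ := Finite.exists_max μ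
  have hexp : ∀ x y : Fin n → ℝ, x ⬝ᵥ y = ∑ i, (b i ⬝ᵥ x) * (b i ⬝ᵥ y) := fun x y => by
    nth_rewrite 1 [hx x]
    rw [sum_dotProduct]
    simp only [smul_dotProduct, smul_eq_mul]
  have hAb : ∀ i x, b i ⬝ᵥ A *ᵥ x = μ i * (b i ⬝ᵥ x) := fun i x => by
    rw [dotProduct_mulVec_comm hA, hμ, smul_dotProduct, smul_eq_mul]
  have hray : ∀ x, x ⬝ᵥ A *ᵥ x ≤ μ i₀ * (x ⬝ᵥ x) := fun x => by
    rw [hexp x (A *ᵥ x), hexp x x, Finset.mul_sum]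
    refine Finset.sum_le_sum fun i _ => ?_
    rw [hAb]
    nlinarith [mul_le_mul_of_nonneg_right (hi₀ i) (mul_self_nonneg (b i ⬝ᵥ x))]
  have hw1 : |b i₀| ⬝ᵥ |b i₀| = 1 := by rw [abs_dotProduct_abs, hb, if_pos rfl]
  -- The vector `|b i₀|` also attains the maximal Rayleigh quotient. The positive semidefinite
  -- matrix `μ i₀ - A` has zero form there, hence annihilates it.
  have hw : A *ᵥ |b i₀| = μ i₀ • |b i₀| := by
    have hform : ∀ x : Fin n → ℝ, x ⬝ᵥ (μ i₀ • (1 : Matrix (Fin n) (Fin n) ℝ) - A) *ᵥ x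
        = μ i₀ * (x ⬝ᵥ x) - x ⬝ᵥ A *ᵥ x := fun x => by
      rw [Matrix.sub_mulVec, dotProduct_sub, Matrix.smul_mulVec, Matrix.one_mulVec,
        dotProduct_smul, smul_eq_mul]
    have hpsd : (μ i₀ • (1 : Matrix (Fin n) (Fin n) ℝ) - A).PosSemidef := by
      refine Matrix.PosSemidef.of_dotProduct_mulVec_nonneg ?_ fun x => ?_
      · rw [Matrix.IsHermitian, Matrix.conjTranspose_eq_transpose_of_trivial,
          Matrix.transpose_sub, hA.eq, Matrix.transpose_smul, Matrix.transpose_one]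
      · rw [star_trivial, hform]
        linarith [hray x]
    have hz := (hpsd.dotProduct_mulVec_zero_iff |b i₀|).1 (by
      rw [star_trivial, hform]
      refine le_antisymm ?_ (by linarith [hray |b i₀|])
      have h1 := (le_abs_self _).trans (abs_dotProduct_mulVec_le h0 (b i₀))
      rw [hAb, hb, if_pos rfl] at h1
      rw [hw1]
      linarith)
    rw [Matrix.sub_mulVec, Matrix.smul_mulVec, Matrix.one_mulVec, sub_eq_zero] at hz
    exact hz.symm
  refine ⟨μ i₀, |b i₀|, fun i => abs_nonneg _, hw1, hw,
    ⟨hasEigenvalue_of_mulVec (fun h => ?_) hw, fun m hm => ?_⟩, hray⟩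
  · rw [h] at hw1; simp at hw1
  · obtain ⟨x, hx0, hxm⟩ := exists_mulVec_of_hasEigenvalue hm
    have hpos := dotProduct_self_pos hx0
    have h1 := abs_dotProduct_mulVec_le h0 x
    have h2 := hray |x|
    rw [abs_dotProduct_abs] at h2
    rw [hxm, dotProduct_smul, smul_eq_mul, abs_mul, abs_of_pos hpos] at h1
    exact le_of_mul_le_mul_right (h1.trans h2) hpos

lemma IsLeadingEigenvalue.unique {l l' : ℝ} (h : IsLeadingEigenvalue A l)
    (h' : IsLeadingEigenvalue A l') : l = l' :=
  le_antisymm ((le_abs_self _).trans (h'.2 l h.1)) ((le_abs_self _).trans (h.2 l' h'.1))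

/-- Unit vectors of a line differ by a scalar of square one. Consequently the absolute value of the
score does not depend on the eigenvector chosen. -/
lemma LeadingEigenvalueSimple.eq_or_eq_neg (h : LeadingEigenvalueSimple A) {v w : Fin n → ℝ}
    (hv : IsLeadingEigenvector A v) (hw : IsLeadingEigenvector A w) : v = w ∨ v = -w := by
  obtain ⟨l, hl, hdim⟩ := h
  obtain ⟨hv1, l₁, hl₁, hv2⟩ := hv
  obtain ⟨hw1, l₂, hl₂, hw2⟩ := hw
  rw [hl₁.unique hl] at hv2
  rw [hl₂.unique hl] at hw2
  have hmv : v ∈ Module.End.eigenspace (Matrix.toLin' A) l :=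
    Module.End.mem_eigenspace_iff.2 (by rw [Matrix.toLin'_apply, hv2])
  have hmw : w ∈ Module.End.eigenspace (Matrix.toLin' A) l :=
    Module.End.mem_eigenspace_iff.2 (by rw [Matrix.toLin'_apply, hw2])
  have hw0 : (⟨w, hmw⟩ : Module.End.eigenspace (Matrix.toLin' A) l) ≠ 0 := fun h => by
    have : w = 0 := congrArg Subtype.val h
    rw [this] at hw1; simp at hw1
  obtain ⟨c, hc⟩ := (finrank_eq_one_iff_of_nonzero' _ hw0).1 hdim ⟨v, hmv⟩
  have hcv : c • w = v := congrArg Subtype.val hc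
  have hc2 : c * c = 1 := by
    rw [← hcv, smul_dotProduct, dotProduct_smul, hw1] at hv1
    simpa using hv1
  rcases mul_self_eq_one_iff.1 hc2 with h | h
  · left; rw [← hcv, h, one_smul]
  · right; rw [← hcv, h, neg_one_smul]

/-- The leading eigenvalue is simple if the quadratic form is below it up to a form of rank one. -/
lemma leadingEigenvalueSimple_of_form_le (hn : 0 < n) (hA : A.IsSymm) (h0 : ∀ i j, 0 ≤ A i j)
    {φ y : Fin n → ℝ} {s C : ℝ} (hle : ∀ x, x ⬝ᵥ A *ᵥ x ≤ s * (x ⬝ᵥ x) + C * (φ ⬝ᵥ x) ^ 2)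
    (hy : s * (y ⬝ᵥ y) < y ⬝ᵥ A *ᵥ y) : LeadingEigenvalueSimple A := by
  obtain ⟨l, w, -, hw1, hw, hl, hray⟩ := exists_leading_eigenvalue hn hA h0
  have hsl : s < l :=
    lt_of_mul_lt_mul_right (hy.trans_le (hray y)) (dotProduct_self_nonneg y)
  -- On the hyperplane orthogonal to `φ` the form is at most `s < l` times the squared norm. The
  -- functional `φ ⬝ᵥ ·` is therefore injective on the eigenspace of `l`, whose dimension is one.
  have key : ∀ x, A *ᵥ x = l • x → φ ⬝ᵥ x = 0 → x = 0 := fun x hx hφ => by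
    by_contra hne
    have hpos := dotProduct_self_pos hne
    have := hle x
    rw [hx, hφ, dotProduct_smul, smul_eq_mul] at this
    nlinarith
  have hw0 : w ≠ 0 := fun h => by rw [h] at hw1; simp at hw1
  have hφw : φ ⬝ᵥ w ≠ 0 := fun h => hw0 (key w hw h)
  have hmw : w ∈ Module.End.eigenspace (Matrix.toLin' A) l :=
    Module.End.mem_eigenspace_iff.2 (by rw [Matrix.toLin'_apply, hw])
  refine ⟨l, hl, (finrank_eq_one_iff_of_nonzero'
    (⟨w, hmw⟩ : Module.End.eigenspace (Matrix.toLin' A) l)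
    fun h => hw0 (congrArg Subtype.val h)).2 ?_⟩
  rintro ⟨x, hmx⟩
  have hx : A *ᵥ x = l • x := by
    have := Module.End.mem_eigenspace_iff.1 hmx
    rwa [Matrix.toLin'_apply] at this
  refine ⟨(φ ⬝ᵥ x) / (φ ⬝ᵥ w), Subtype.ext ?_⟩
  have := key (x - ((φ ⬝ᵥ x) / (φ ⬝ᵥ w)) • w)
    (by rw [Matrix.mulVec_sub, Matrix.mulVec_smul, hx, hw, smul_sub, smul_comm])
    (by rw [dotProduct_sub, dotProduct_smul, smul_eq_mul, div_mul_cancel₀ _ hφw, sub_self])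
  exact (sub_eq_zero.1 this).symm

lemma normalize_smul {r : ℝ} (hr : 0 < r) {c : Fin n → ℝ} (hc : c ≠ 0) :
    normalize (r • c) = normalize c := by
  have h1 := (dotProduct_self_pos hc).ne'
  have h2 : (r • c) ⬝ᵥ (r • c) = r ^ 2 * (c ⬝ᵥ c) := by
    rw [smul_dotProduct, dotProduct_smul, smul_eq_mul, smul_eq_mul]; ring
  have h3 : r ^ 2 * (c ⬝ᵥ c) ≠ 0 := mul_ne_zero (by positivity) h1
  rw [normalize, normalize, h2, if_neg h3, if_neg h1, Real.sqrt_mul (sq_nonneg r),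
    Real.sqrt_sq hr.le, smul_smul]
  congr 1
  field_simp

lemma tendsto_normalize {α : Type*} {F : Filter α} {c : α → Fin n → ℝ} {d : Fin n → ℝ}
    (h : Tendsto c F (𝓝 d)) (hd : d ≠ 0) : Tendsto (fun a => normalize (c a)) F (𝓝 (normalize d)) := by
  have hcont : Continuous fun c : Fin n → ℝ => c ⬝ᵥ c := by unfold dotProduct; fun_prop
  have hd1 := dotProduct_self_pos hd
  have h2 : Tendsto (fun a => c a ⬝ᵥ c a) F (𝓝 (d ⬝ᵥ d)) := (hcont.tendsto d).comp h
  have h3 : Tendsto (fun a => (√(c a ⬝ᵥ c a))⁻¹ • c a) F (𝓝 ((√(d ⬝ᵥ d))⁻¹ • d)) :=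
    ((h2.sqrt).inv₀ (Real.sqrt_pos.2 hd1).ne').smul h
  have h4 : normalize d = (√(d ⬝ᵥ d))⁻¹ • d := by rw [normalize, if_neg hd1.ne']
  rw [h4]
  refine h3.congr' ?_
  filter_upwards [h2.eventually_const_lt hd1] with a ha
  rw [normalize, if_neg ha.ne']

/-- The power iteration for `1 + A` started at the vector of ones converges in direction to a
leading eigenvector. -/
lemma exists_tendsto_normalize_pow (hn : 0 < n) (hA : A.IsSymm) (h0 : ∀ i j, 0 ≤ A i j) :
    ∃ v, IsLeadingEigenvector A v ∧
      Tendsto (fun k : ℕ => normalize (((1 + A) ^ k) *ᵥ fun _ => (1 : ℝ))) atTop (𝓝 v) := by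
  obtain ⟨l, w, hw0, hw1, hw, hl, -⟩ := exists_leading_eigenvalue hn hA h0
  obtain ⟨b, μ, hb, hμ, hx⟩ := exists_orthonormal_eigenbasis hA
  set ι : Fin n → ℝ := fun _ => 1 with hι
  have hb0 : ∀ i, b i ≠ 0 := fun i h => by have := hb i i; rw [h] at this; simp at this
  have hμl : ∀ i, |μ i| ≤ l := fun i => hl.2 _ (hasEigenvalue_of_mulVec (hb0 i) (hμ i))
  have hl0 : 0 ≤ l := (abs_nonneg _).trans (hμl ⟨0, hn⟩)
  -- The projection of the vector of ones onto the eigenspace of `l`.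
  set L : Fin n → ℝ := ∑ i, (if μ i = l then b i ⬝ᵥ ι else 0) • b i with hL
  have hpow : ∀ (k : ℕ) (i : Fin n), ((1 + A) ^ k) *ᵥ b i = (1 + μ i) ^ k • b i := by
    intro k i
    induction k with
    | zero => simp
    | succ k ih =>
      rw [pow_succ', ← Matrix.mulVec_mulVec, ih, Matrix.mulVec_smul, Matrix.add_mulVec,
        Matrix.one_mulVec, hμ, pow_succ, mul_smul, add_smul 1 (μ i) (b i), one_smul]
  have hpowι : ∀ k : ℕ, ((1 + A) ^ k) *ᵥ ι = ∑ i, ((1 + μ i) ^ k * (b i ⬝ᵥ ι)) • b i := by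
    intro k
    conv_lhs => rw [hx ι]
    rw [Matrix.mulVec_sum]
    refine Finset.sum_congr rfl fun i _ => ?_
    rw [Matrix.mulVec_smul, hpow, smul_smul, mul_comm]
  have hlim : Tendsto (fun k : ℕ => ((1 + l) ^ k)⁻¹ • ((1 + A) ^ k) *ᵥ ι) atTop (𝓝 L) := by
    simp only [hpowι, Finset.smul_sum, smul_smul]
    refine tendsto_finsetSum _ fun i _ => Tendsto.smul_const ?_ _
    have hrw : ∀ k : ℕ, ((1 + l) ^ k)⁻¹ * ((1 + μ i) ^ k * (b i ⬝ᵥ ι))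
        = ((1 + μ i) / (1 + l)) ^ k * (b i ⬝ᵥ ι) := fun k => by
      rw [div_pow, div_eq_inv_mul, mul_assoc]
    simp only [hrw]
    split_ifs with h
    · rw [h, div_self (by linarith)]
      simp
    -- The shift by the identity matters here: without it an eigenvalue `-l` would not be damped and
    -- the iteration could oscillate.
    · have hlt : |(1 + μ i) / (1 + l)| < 1 := by
        rw [abs_div, abs_of_pos (by linarith : 0 < 1 + l), div_lt_one (by linarith), abs_lt]
        have h1 := abs_le.1 (hμl i)
        have h2 := lt_of_le_of_ne h1.2 h
        constructor <;> linarith [h1.1]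
      simpa using (tendsto_pow_atTop_nhds_zero_of_abs_lt_one hlt).mul_const (b i ⬝ᵥ ι)
  have hAL : A *ᵥ L = l • L := by
    rw [hL, Matrix.mulVec_sum, Finset.smul_sum]
    refine Finset.sum_congr rfl fun i _ => ?_
    rw [Matrix.mulVec_smul, hμ]
    split_ifs with h
    · rw [h, smul_comm]
    · simp
  -- Pairing with the nonnegative eigenvector `w` shows `L ≠ 0`: `w` is orthogonal to the other
  -- eigenspaces, and `w ⬝ᵥ ι` is the positive sum of its entries.
  have hwL : w ⬝ᵥ L = w ⬝ᵥ ι := by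
    conv_rhs => rw [hx ι]
    rw [hL, dotProduct_sum, dotProduct_sum]
    refine Finset.sum_congr rfl fun i _ => ?_
    split_ifs with h
    · rfl
    · have h1 : μ i * (w ⬝ᵥ b i) = l * (w ⬝ᵥ b i) := by
        have := dotProduct_mulVec_comm hA w (b i)
        rw [hμ, hw, dotProduct_smul, smul_dotProduct] at this
        exact this
      have h2 : w ⬝ᵥ b i = 0 := by
        by_contra hne
        exact h (mul_right_cancel₀ hne h1)
      rw [dotProduct_smul, dotProduct_smul, h2, smul_zero, smul_zero]
  have hwι : 0 < w ⬝ᵥ ι := by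
    have hnn : 0 ≤ w ⬝ᵥ ι := Finset.sum_nonneg fun i _ => mul_nonneg (hw0 i) zero_le_one
    refine lt_of_le_of_ne hnn fun h => ?_
    have hz : ∀ i, w i = 0 := fun i => by
      have := (Finset.sum_eq_zero_iff_of_nonneg
        fun j _ => mul_nonneg (hw0 j) zero_le_one).1 h.symm i (Finset.mem_univ i)
      simpa [hι] using this
    have : w = 0 := funext hz
    rw [this] at hw1; simp at hw1
  have hL0 : L ≠ 0 := fun h => by rw [h, dotProduct_zero] at hwL; linarith
  refine ⟨normalize L, ⟨normalize_dotProduct_self hn L, l, hl, ?_⟩, ?_⟩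
  · rw [normalize, if_neg (dotProduct_self_pos hL0).ne', Matrix.mulVec_smul, hAL, smul_comm]
  · refine (tendsto_normalize hlim hL0).congr' ?_
    have hne : ∀ᶠ k : ℕ in atTop, ((1 + l) ^ k)⁻¹ • ((1 + A) ^ k) *ᵥ ι ≠ 0 :=
      hlim.eventually_ne hL0
    filter_upwards [hne] with k hk
    have hpos : 0 < ((1 + l) ^ k)⁻¹ := inv_pos.2 (pow_pos (by linarith) k)
    exact normalize_smul hpos fun h => hk (by rw [h, smul_zero])

/-- A measurable choice of leading eigenvectors of nonnegative symmetric matrices. -/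
lemma exists_measurable_leadingEigenvector {α : Type*} [MeasurableSpace α] (hn : 0 < n)
    {A : α → Matrix (Fin n) (Fin n) ℝ} (hm : ∀ i j, Measurable fun a => A a i j)
    (hA : ∀ a, (A a).IsSymm) (h0 : ∀ a i j, 0 ≤ A a i j) :
    ∃ W : α → Fin n → ℝ, Measurable W ∧ ∀ a, IsLeadingEigenvector (A a) (W a) := by
  choose W hW hlim using fun a => exists_tendsto_normalize_pow hn (hA a) (h0 a)
  refine ⟨W, measurable_of_tendsto_metrizable (fun k => ?_) (tendsto_pi_nhds.2 hlim), hW⟩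
  refine measurable_normalize.comp (measurable_pow_mulVec (A := fun a => 1 + A a) (fun i j => ?_) _ k)
  exact (hm i j).const_add _

end Spectral

lemma isSymm_adjacency (f : I → I → ℝ) (p : ℝ) {n : ℕ} (u : Fin n → I) :
    (adjacency f p u).IsSymm := by
  ext i j
  simp only [adjacency, Matrix.transpose_apply, Matrix.of_apply, eq_comm (a := j), min_comm j,
    max_comm j]

variable {Ω : Type*} [MeasurableSpace Ω] {P : Measure Ω} [IsProbabilityMeasure P]
  {U : ℕ → Ω → I} {ε : ℕ → Ω → ℝ} {lo hi κ : ℝ} {f : I → I → ℝ} {p : ℕ → ℝ}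

/-- If the leading eigenvalue is simple with probability tending to one, least squares on the
eigenvector centrality is consistent exactly when its scale diverges. -/
theorem consistent_eigenvector_iff (hf : IsGraphon f) (hp : ∀ n, 0 < p n)
    (hU : IsSample P U ε) (hε : ErrorMoments P U ε lo hi κ) (β : ℝ)
    (hs : Tendsto (fun n => P {ω | ¬ LeadingEigenvalueSimple (network f p U n ω)}) atTop (𝓝 0))
    {a : ℕ → ℝ} {v : (n : ℕ) → Ω → Fin n → ℝ} (ha : ∀ n, 0 < a n)
    (hv : ∀ n, 0 < n → ∀ ω, IsLeadingEigenvector (network f p U n ω) (v n ω)) :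
    OLSConsistent P β ε (fun n ω => a n • v n ω) ↔ Tendsto a atTop atTop := by
  -- The given `v` may depend on `ω` in any way, measurable or not and not only through the types.
  -- The moment bounds need a measurable function of the types, so the score is formed with `W` and
  -- compared with `v` where the eigenvalue is simple.
  have hex : ∀ n : ℕ, ∃ W : (Fin n → I) → Fin n → ℝ, Measurable W ∧
      (0 < n → ∀ u, IsLeadingEigenvector (adjacency f (p n) u) (W u)) := fun n => by
    rcases Nat.eq_zero_or_pos n with h | h
    · exact ⟨fun _ => 0, measurable_const, fun h' => by omega⟩
    · obtain ⟨W, h1, h2⟩ := exists_measurable_leadingEigenvector h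
        (fun i j => hf.measurable_adjacency (p n) i j) (isSymm_adjacency f (p n))
        (hf.adjacency_nonneg (hp n).le)
      exact ⟨W, h1, fun _ => h2⟩
  choose W hWm hW using hex
  have key : ∀ n, 0 < n → ∀ ω, ω ∉ {ω | ¬ LeadingEigenvalueSimple (network f p U n ω)} →
      |olsSlope (outcome β ε (fun n ω => a n • v n ω) n ω) (a n • v n ω) - β| * a n
        = |score U ε (W n) ω| := by
    intro n hn ω hω
    simp only [Set.mem_ofPred_eq, not_not] at hω
    have hv1 := (hv n hn ω).1
    have hvv : (a n • v n ω) ⬝ᵥ (a n • v n ω) = a n ^ 2 := by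
      rw [smul_dotProduct, dotProduct_smul, hv1]; simp [sq]
    have hne : (a n • v n ω) ⬝ᵥ (a n • v n ω) ≠ 0 := by
      rw [hvv]; exact (pow_pos (ha n) 2).ne'
    have h1 := abs_olsSlope_sub_mul β (errors ε n ω) (a n • v n ω) hne
    have hv0 : v n ω ≠ 0 := fun h => by rw [h] at hv1; simp at hv1
    have hnv : normalize (v n ω) = v n ω := by
      rw [normalize, hv1, if_neg one_ne_zero, Real.sqrt_one, inv_one, one_smul]
    rw [hvv, Real.sqrt_sq (ha n).le, normalize_smul (ha n) hv0, hnv] at h1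
    refine h1.trans ?_
    rw [score]
    rcases hω.eq_or_eq_neg (hv n hn ω) (hW n hn (types U n ω)) with h | h
    · rw [h]
    · rw [h, dotProduct_neg, abs_neg]
  refine hε.tendstoInMeasure_iff hU hWm (fun n hn u => (hW n hn u).1) hs (fun n _ => ha n) ?_ ?_
  · exact fun n hn ω hω => (key n hn ω hω).le
  · refine fun K => ⟨max K 1, by positivity, fun n hn hK ω hω => ?_⟩
    rw [← key n hn ω hω, mul_comm]
    exact mul_le_mul_of_nonneg_right (hK.trans (le_max_left _ _)) (abs_nonneg _)

end CentralityOLS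

end

/-! ### Compact symmetric operators and integral operators on `L²[0,1]` -/

noncomputable section

namespace CentralityOLS

section Hilbert

variable {H : Type*} [NormedAddCommGroup H] [InnerProductSpace ℝ H]

/-- A nonnegative symmetric operator is controlled by its quadratic form. -/
lemma norm_apply_sq_le_of_nonneg {S : H →L[ℝ] H} (hS : ∀ x y, inner ℝ (S x) y = inner ℝ x (S y))
    (h0 : ∀ x, 0 ≤ inner ℝ (S x) x) (x : H) : ‖S x‖ ^ 2 ≤ (‖S‖ + 1) * inner ℝ (S x) x := by
  set M := ‖S‖ + 1 with hM
  have hMpos : 0 < M := by positivity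
  -- One gradient step: expanding the nonnegative form at this point gives `‖S x‖ ^ 2 / M ≤ ⟨S x,
  -- x⟩`. The summand `1` in `M` avoids division by zero when `S = 0`.
  have h1 := h0 (x - M⁻¹ • S x)
  have h2 : inner ℝ (S (S x)) (S x) ≤ M * ‖S x‖ ^ 2 := by
    refine (real_inner_le_norm _ _).trans ?_
    rw [sq, ← mul_assoc]
    refine mul_le_mul_of_nonneg_right ((S.le_opNorm _).trans ?_) (norm_nonneg _)
    exact mul_le_mul_of_nonneg_right (by linarith) (norm_nonneg _)
  have h3 : inner ℝ (S (S x)) x = ‖S x‖ ^ 2 := by rw [hS, real_inner_self_eq_norm_sq]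
  have h4 : inner ℝ (S x) (S x) = ‖S x‖ ^ 2 := real_inner_self_eq_norm_sq _
  rw [map_sub, map_smul, inner_sub_left, inner_sub_right, inner_sub_right, inner_smul_left,
    inner_smul_left, inner_smul_right, inner_smul_right, h3, h4] at h1
  simp only [conj_trivial] at h1
  have h5 : M⁻¹ * (M⁻¹ * inner ℝ (S (S x)) (S x)) ≤ M⁻¹ * ‖S x‖ ^ 2 := by
    refine mul_le_mul_of_nonneg_left ?_ (by positivity)
    rw [inv_mul_le_iff₀ hMpos]; exact h2
  have h6 : M⁻¹ * ‖S x‖ ^ 2 ≤ inner ℝ (S x) x := by linarith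
  rwa [inv_mul_le_iff₀ hMpos] at h6

/-- The supremum of the quadratic form of a compact symmetric operator on the unit sphere, if
positive, is attained at an eigenvector. -/
lemma exists_top_eigenvector {T : H →L[ℝ] H} (hT : ∀ x y, inner ℝ (T x) y = inner ℝ x (T y))
    (hc : IsCompactOperator T) {g : H} (hg : 0 < inner ℝ (T g) g) :
    ∃ (μ : ℝ) (x : H), 0 < μ ∧ x ≠ 0 ∧ T x = μ • x ∧ ∀ y, inner ℝ (T y) y ≤ μ * ‖y‖ ^ 2 := by
  set Q : Set ℝ := (fun x : H => inner ℝ (T x) x) '' Metric.sphere 0 1 with hQ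
  have hnorm : ∀ y : H, y ≠ 0 → inner ℝ (T (‖y‖⁻¹ • y)) (‖y‖⁻¹ • y) = inner ℝ (T y) y / ‖y‖ ^ 2 :=
    fun y hy => by
      rw [map_smul, inner_smul_left, inner_smul_right, conj_trivial]
      field_simp
  have hmem : ∀ y : H, y ≠ 0 → inner ℝ (T y) y / ‖y‖ ^ 2 ∈ Q := fun y hy =>
    ⟨‖y‖⁻¹ • y, by simp [norm_smul, norm_ne_zero_iff.2 hy], hnorm y hy⟩
  have hbdd : BddAbove Q := by
    refine ⟨‖T‖, ?_⟩
    rintro _ ⟨x, hx, rfl⟩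
    have hx1 : ‖x‖ = 1 := by simpa using hx
    refine (real_inner_le_norm _ _).trans ?_
    have := T.le_opNorm x
    rw [hx1, mul_one] at this ⊢
    exact this
  have hg0 : g ≠ 0 := fun h => by rw [h] at hg; simp at hg
  have hgn : 0 < ‖g‖ := norm_pos_iff.2 hg0
  set μ := sSup Q with hμ
  have hμpos : 0 < μ := lt_of_lt_of_le (by positivity) (le_csSup hbdd (hmem g hg0))
  have hform : ∀ y, inner ℝ (T y) y ≤ μ * ‖y‖ ^ 2 := fun y => by
    by_cases hy : y = 0
    · simp [hy]
    · have hyn : 0 < ‖y‖ := norm_pos_iff.2 hy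
      rw [← div_le_iff₀ (by positivity)]
      exact le_csSup hbdd (hmem y hy)
  obtain ⟨r, -, hr, hrQ⟩ := exists_seq_tendsto_sSup ⟨_, hmem g hg0⟩ hbdd
  choose x hx hxr using hrQ
  have hx1 : ∀ k, ‖x k‖ = 1 := fun k => by simpa using hx k
  set S : H →L[ℝ] H := μ • ContinuousLinearMap.id ℝ H - T with hS
  have hSx : ∀ y, S y = μ • y - T y := fun y => by simp [hS]
  have hSf : ∀ y, inner ℝ (S y) y = μ * ‖y‖ ^ 2 - inner ℝ (T y) y := fun y => by
    rw [hSx, inner_sub_left, inner_smul_left, conj_trivial, real_inner_self_eq_norm_sq]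
  have hSsym : ∀ y z, inner ℝ (S y) z = inner ℝ y (S z) := fun y z => by
    rw [hSx, hSx, inner_sub_left, inner_sub_right, inner_smul_left, inner_smul_right, hT,
      conj_trivial]
  -- The operator `S = μ - T` has nonnegative form, and along the maximising sequence its form is `μ
  -- - r k → 0`; the preceding lemma upgrades this to norm convergence.
  have hSlim : Tendsto (fun k => S (x k)) atTop (𝓝 0) := by
    rw [tendsto_zero_iff_norm_tendsto_zero]
    have hup : Tendsto (fun k => (‖S‖ + 1) * (μ - r k)) atTop (𝓝 0) := by
      have := (tendsto_const_nhds (x := μ)).sub hr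
      rw [← hμ, sub_self] at this
      simpa using this.const_mul (‖S‖ + 1)
    have hsq : Tendsto (fun k => ‖S (x k)‖ ^ 2) atTop (𝓝 0) := by
      refine squeeze_zero (fun k => sq_nonneg _) (fun k => ?_) hup
      have := norm_apply_sq_le_of_nonneg hSsym (fun y => by rw [hSf]; linarith [hform y]) (x k)
      rw [hSf, hx1] at this
      have hk : inner ℝ (T (x k)) (x k) = r k := hxr k
      rw [hk] at this
      simpa using this
    have := hsq.sqrt
    simpa [Real.sqrt_sq] using this
  obtain ⟨K, hK, hTK⟩ := hc.image_closedBall_subset_compact (𝕜₁ := ℝ) (f := T.toLinearMap) 1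
  obtain ⟨z, -, φ, hφ, hz⟩ := hK.tendsto_subseq (x := fun k => T (x k))
    (fun k => hTK ⟨x k, by simp [hx1], rfl⟩)
  -- Since `x = μ⁻¹ • (S x + T x)`, convergence of `T x` along a subsequence forces convergence of
  -- `x` itself. This is where `μ > 0` enters; the limit has norm one and so is nonzero.
  have hxlim : Tendsto (fun k => x (φ k)) atTop (𝓝 (μ⁻¹ • z)) := by
    have h1 : Tendsto (fun k => μ⁻¹ • (S (x (φ k)) + T (x (φ k)))) atTop (𝓝 (μ⁻¹ • (0 + z))) :=
      ((hSlim.comp hφ.tendsto_atTop).add hz).const_smul μ⁻¹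
    rw [zero_add] at h1
    refine h1.congr fun k => ?_
    rw [hSx, sub_add_cancel, smul_smul, inv_mul_cancel₀ hμpos.ne', one_smul]
  refine ⟨μ, μ⁻¹ • z, hμpos, fun h => ?_, ?_, hform⟩
  · have h1 := hxlim.norm
    simp only [hx1, h, norm_zero] at h1
    exact one_ne_zero (tendsto_nhds_unique tendsto_const_nhds h1)
  · have h1 : Tendsto (fun k => S (x (φ k))) atTop (𝓝 (S (μ⁻¹ • z))) :=
      (S.continuous.tendsto _).comp hxlim
    have h2 := tendsto_nhds_unique h1 (hSlim.comp hφ.tendsto_atTop)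
    rw [hSx, sub_eq_zero] at h2
    exact h2.symm

end Hilbert

/-- Bounded measurable kernels on the unit interval. -/
structure IsBoundedKernel (h : I → I → ℝ) (B : ℝ) : Prop where
  measurable : Measurable fun z : I × I => h z.1 z.2
  bound : ∀ u v, |h u v| ≤ B

/-- Square integrable functions on the unit interval. -/
abbrev L2I := Lp ℝ 2 (volume : Measure I)

lemma L2I.integrable (g : L2I) : Integrable g volume := (Lp.memLp g).integrable (by norm_num)

lemma sq_integral_mul_le {α : Type*} [MeasurableSpace α] {μ : Measure α} {a b : α → ℝ}
    (ha : MemLp a 2 μ) (hb : MemLp b 2 μ) :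
    (∫ x, a x * b x ∂μ) ^ 2 ≤ (∫ x, a x ^ 2 ∂μ) * ∫ x, b x ^ 2 ∂μ := by
  have hin : ∀ {a b : α → ℝ} (ha : MemLp a 2 μ) (hb : MemLp b 2 μ),
      inner ℝ (ha.toLp a) (hb.toLp b) = ∫ x, a x * b x ∂μ := fun {a b} ha hb => by
    rw [L2.inner_def]
    refine integral_congr_ae ?_
    filter_upwards [ha.coeFn_toLp, hb.coeFn_toLp] with x h1 h2
    rw [h1, h2, RCLike.inner_apply, conj_trivial, mul_comm]
  have h := real_inner_mul_inner_self_le (ha.toLp a) (hb.toLp b)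
  rw [hin ha hb, hin ha ha, hin hb hb] at h
  simpa only [sq] using h

lemma L2I.norm_sq (g : L2I) : ‖g‖ ^ 2 = ∫ x, g x ^ 2 := by
  rw [← real_inner_self_eq_norm_sq, L2.inner_def]
  simp only [RCLike.inner_apply, conj_trivial, sq]

lemma L2I.inner_eq (g g' : L2I) : inner ℝ g g' = ∫ x, g x * g' x := by
  rw [L2.inner_def]
  simp only [RCLike.inner_apply, conj_trivial, mul_comm]

namespace IsBoundedKernel

variable {h : I → I → ℝ} {B : ℝ}

lemma measurable_right (hh : IsBoundedKernel h B) (u : I) : Measurable (h u) :=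
  hh.measurable.comp measurable_prodMk_left

lemma memLp_right (hh : IsBoundedKernel h B) (u : I) : MemLp (h u) 2 volume :=
  MemLp.of_bound (hh.measurable_right u).aestronglyMeasurable B (ae_of_all _ (hh.bound u))

lemma integrable_mul (hh : IsBoundedKernel h B) (u : I) {g : I → ℝ} (hg : Integrable g volume) :
    Integrable (fun v => h u v * g v) volume :=
  hg.bdd_mul (c := B) (hh.measurable_right u).aestronglyMeasurable (ae_of_all _ (hh.bound u))

lemma measurable_integral (hh : IsBoundedKernel h B) (g : L2I) :
    Measurable fun u => ∫ v, h u v * g v := by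
  have hm : StronglyMeasurable fun z : I × I => h z.1 z.2 * g z.2 :=
    (hh.measurable.mul ((Lp.stronglyMeasurable g).measurable.comp
      measurable_snd)).stronglyMeasurable
  exact hm.integral_prod_right.measurable

lemma abs_integral_le (hh : IsBoundedKernel h B) {g : I → ℝ} (hg : Integrable g volume) (u : I) :
    |∫ v, h u v * g v| ≤ B * ∫ v, |g v| := by
  rw [← integral_const_mul]
  refine (norm_integral_le_integral_norm _).trans (integral_mono (hh.integrable_mul u hg).norm
    (hg.abs.const_mul B) fun v => ?_)
  simp only [Real.norm_eq_abs, abs_mul]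
  exact mul_le_mul_of_nonneg_right (hh.bound u v) (abs_nonneg _)

lemma memLp_integral (hh : IsBoundedKernel h B) (g : L2I) :
    MemLp (fun u => ∫ v, h u v * g v) 2 volume :=
  MemLp.of_bound (hh.measurable_integral g).aestronglyMeasurable (B * ∫ v, |g v|)
    (ae_of_all _ fun u => hh.abs_integral_le (L2I.integrable g) u)

lemma integrable_sq (hh : IsBoundedKernel h B) :
    Integrable (fun z : I × I => h z.1 z.2 ^ 2) volume :=
  Integrable.of_bound (hh.measurable.pow_const 2).aestronglyMeasurable (B ^ 2)
    (ae_of_all _ fun z => by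
      rw [Real.norm_eq_abs, abs_pow]
      exact pow_le_pow_left₀ (abs_nonneg _) (hh.bound _ _) 2)

/-- The integral operator on `L²[0,1]` with a bounded measurable kernel, and its Hilbert-Schmidt
bound. -/
lemma exists_operator (hh : IsBoundedKernel h B) :
    ∃ T : L2I →L[ℝ] L2I, (∀ g, T g =ᵐ[volume] fun u => ∫ v, h u v * g v) ∧
      ‖T‖ ≤ √(∫ z : I × I, h z.1 z.2 ^ 2) := by
  let T₀ : L2I →ₗ[ℝ] L2I :=
    { toFun := fun g => (hh.memLp_integral g).toLp _
      map_add' := fun g g' => by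
        rw [← MemLp.toLp_add]
        refine MemLp.toLp_congr _ _ (ae_of_all _ fun u => ?_)
        change _ = (∫ v, h u v * g v) + ∫ v, h u v * g' v
        rw [← integral_add (hh.integrable_mul u (L2I.integrable g)) (hh.integrable_mul u (L2I.integrable g'))]
        refine integral_congr_ae ?_
        filter_upwards [Lp.coeFn_add g g'] with v hv
        rw [hv, Pi.add_apply, mul_add]
      map_smul' := fun c g => by
        rw [RingHom.id_apply, ← MemLp.toLp_const_smul]
        refine MemLp.toLp_congr _ _ (ae_of_all _ fun u => ?_)
        change _ = c * ∫ v, h u v * g v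
        rw [← integral_const_mul]
        refine integral_congr_ae ?_
        filter_upwards [Lp.coeFn_smul c g] with v hv
        rw [hv, Pi.smul_apply, smul_eq_mul, mul_left_comm] }
  have hT₀ : ∀ g, T₀ g =ᵐ[volume] fun u => ∫ v, h u v * g v := fun g =>
    (hh.memLp_integral g).coeFn_toLp
  have hbound : ∀ g, ‖T₀ g‖ ≤ √(∫ z : I × I, h z.1 z.2 ^ 2) * ‖g‖ := fun g => by
    refine le_of_sq_le_sq ?_ (by positivity)
    rw [mul_pow, Real.sq_sqrt (integral_nonneg fun z => sq_nonneg _), L2I.norm_sq]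
    have hint : Integrable (fun u => ∫ v, h u v ^ 2) volume :=
      hh.integrable_sq.integral_prod_left
    calc ∫ u, T₀ g u ^ 2 = ∫ u, (∫ v, h u v * g v) ^ 2 := by
          refine integral_congr_ae ?_
          filter_upwards [hT₀ g] with u hu
          rw [hu]
      _ ≤ ∫ u, (∫ v, h u v ^ 2) * ‖g‖ ^ 2 := by
          refine integral_mono (hh.memLp_integral g).integrable_sq (hint.mul_const _) fun u => ?_
          simp only
          rw [L2I.norm_sq]
          exact sq_integral_mul_le (hh.memLp_right u) (Lp.memLp g)
      _ = (∫ z : I × I, h z.1 z.2 ^ 2) * ‖g‖ ^ 2 := by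
          rw [integral_mul_const]
          congr 1
          exact (integral_prod _ hh.integrable_sq).symm
  exact ⟨T₀.mkContinuous _ hbound, hT₀, T₀.mkContinuous_norm_le (Real.sqrt_nonneg _) hbound⟩

lemma integrable_form (hh : IsBoundedKernel h B) {g g' : I → ℝ} (hg : Integrable g volume)
    (hg' : Integrable g' volume) :
    Integrable (fun z : I × I => h z.1 z.2 * (g z.1 * g' z.2)) volume :=
  (hg.mul_prod hg').bdd_mul (c := B) hh.measurable.aestronglyMeasurable
    (ae_of_all _ fun _ => hh.bound _ _)

lemma inner_operator (hh : IsBoundedKernel h B) {T : L2I →L[ℝ] L2I}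
    (hT : ∀ g, T g =ᵐ[volume] fun u => ∫ v, h u v * g v) (g g' : L2I) :
    inner ℝ g (T g') = ∫ z : I × I, h z.1 z.2 * (g z.1 * g' z.2) := by
  have e : ∫ z : I × I, h z.1 z.2 * (g z.1 * g' z.2) = ∫ u, ∫ v, h u v * (g u * g' v) :=
    integral_prod _ (hh.integrable_form (L2I.integrable g) (L2I.integrable g'))
  rw [L2I.inner_eq, e]
  refine integral_congr_ae ?_
  filter_upwards [hT g'] with u hu
  rw [hu, ← integral_const_mul]
  congr 1; funext v; ring

lemma operator_symm (hh : IsBoundedKernel h B) (hs : ∀ u v, h u v = h v u) {T : L2I →L[ℝ] L2I}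
    (hT : ∀ g, T g =ᵐ[volume] fun u => ∫ v, h u v * g v) (g g' : L2I) :
    inner ℝ (T g) g' = inner ℝ g (T g') := by
  rw [real_inner_comm, hh.inner_operator hT, hh.inner_operator hT]
  have : ∀ F : I × I → ℝ, ∫ z : I × I, F z.swap = ∫ z : I × I, F z := fun F =>
    integral_prod_swap (μ := (volume : Measure I)) (ν := (volume : Measure I)) F
  rw [← this]
  congr 1; funext z
  simp only [Prod.fst_swap, Prod.snd_swap]
  rw [hs z.2 z.1]; ring

end IsBoundedKernel

end CentralityOLS

end

/-! ### Step kernels, compactness and the spectral gap -/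

noncomputable section

namespace CentralityOLS

/-- The cell of the uniform grid of mesh `1 / M` that contains `u`. -/
def gridCell (M : ℕ) (u : I) : Fin (M + 1) :=
  ⟨⌊(M : ℝ) * u⌋₊, by
    have h1 : (M : ℝ) * u ≤ M := mul_le_of_le_one_right (Nat.cast_nonneg M) u.2.2
    have h2 := Nat.floor_le_floor h1
    rw [Nat.floor_natCast] at h2
    omega⟩

/-- The left end of a cell of the uniform grid. -/
def gridPoint (M : ℕ) (a : Fin (M + 1)) : I :=
  ⟨(a : ℝ) / M, by positivity, div_le_one_of_le₀
    (by exact_mod_cast Nat.lt_succ_iff.1 a.2) (Nat.cast_nonneg M)⟩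

lemma measurable_gridCell (M : ℕ) : Measurable (gridCell M) := by
  refine measurable_to_countable' fun a => ?_
  have hm : Measurable fun u : I => ⌊(M : ℝ) * u⌋₊ :=
    Nat.measurable_floor.comp (measurable_subtype_coe.const_mul _)
  convert hm (measurableSet_singleton (a : ℕ)) using 1
  ext u
  simp [gridCell, Fin.ext_iff]

lemma dist_gridPoint_gridCell_le {M : ℕ} (hM : 0 < M) (u : I) :
    dist u (gridPoint M (gridCell M u)) ≤ 1 / M := by
  have hM' : (0 : ℝ) < M := by exact_mod_cast hM
  have h0 : 0 ≤ (M : ℝ) * u := mul_nonneg hM'.le u.2.1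
  have h1 := Nat.floor_le h0
  have h2 := Nat.lt_floor_add_one ((M : ℝ) * u)
  rw [Subtype.dist_eq, Real.dist_eq]
  simp only [gridPoint, gridCell]
  have e : (u : ℝ) - (⌊(M : ℝ) * u⌋₊ : ℝ) / M = ((M : ℝ) * u - ⌊(M : ℝ) * u⌋₊) / M := by
    field_simp
  rw [e, abs_of_nonneg (div_nonneg (by linarith) hM'.le)]
  exact div_le_div_of_nonneg_right (by linarith) hM'.le

namespace IsBoundedKernel

variable {h : I → I → ℝ} {B : ℝ}

/-- Step kernels are dense in `L²` among the bounded measurable kernels. -/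
lemma exists_step_approx (hh : IsBoundedKernel h B) {η : ℝ} (hη : 0 < η) :
    ∃ (m : ℕ) (q : I → Fin m) (H : Fin m → Fin m → ℝ), Measurable q ∧
      ∫ z : I × I, (h z.1 z.2 - H (q z.1) (q z.2)) ^ 2 < η := by
  have hL : MemLp (fun z : I × I => h z.1 z.2) (ENNReal.ofReal 2) volume :=
    MemLp.of_bound hh.measurable.aestronglyMeasurable B (ae_of_all _ fun z => hh.bound _ _)
  -- A continuous `c` approximates `h` with squared error `η / 4`, and `c` varies by at most `√(η /
  -- 8)` when moved to grid points. Together this gives at most `2 * (η / 4) + 2 * (η / 8) < η`.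
  obtain ⟨c, hc, hcL⟩ := hL.exists_boundedContinuous_integral_rpow_sub_le two_pos
    (show 0 < η / 4 by positivity)
  have hcu : UniformContinuous c := CompactSpace.uniformContinuous_of_continuous c.continuous
  obtain ⟨δ, hδ, hcδ⟩ := Metric.uniformContinuous_iff.1 hcu (√(η / 8))
    (Real.sqrt_pos.2 (by positivity))
  obtain ⟨M, hM⟩ := exists_nat_one_div_lt hδ
  refine ⟨M + 1 + 1, gridCell (M + 1), fun a b => c (gridPoint _ a, gridPoint _ b),
    measurable_gridCell _, ?_⟩
  have hclose : ∀ z : I × I, |c z - c (gridPoint _ (gridCell (M + 1) z.1),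
      gridPoint _ (gridCell (M + 1) z.2))| ≤ √(η / 8) := fun z => by
    rw [← Real.dist_eq]
    refine (hcδ ?_).le
    rw [Prod.dist_eq]
    have hM' : 1 / ((M + 1 : ℕ) : ℝ) < δ := by push_cast; exact hM
    exact max_lt ((dist_gridPoint_gridCell_le (Nat.succ_pos M) z.1).trans_lt hM')
      ((dist_gridPoint_gridCell_le (Nat.succ_pos M) z.2).trans_lt hM')
  simp only [Real.norm_eq_abs, Real.rpow_two, sq_abs] at hc
  have hcm : Measurable c := c.continuous.measurable
  have I1 : Integrable (fun z : I × I => (h z.1 z.2 - c z) ^ 2) volume := by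
    have h2 : ENNReal.ofReal 2 = 2 := by simp
    rw [h2] at hL hcL
    exact (hL.sub hcL).integrable_sq
  calc ∫ z : I × I, (h z.1 z.2 - c (gridPoint _ (gridCell (M + 1) z.1),
        gridPoint _ (gridCell (M + 1) z.2))) ^ 2
      ≤ ∫ z : I × I, (2 * (h z.1 z.2 - c z) ^ 2 + 2 * (η / 8)) := by
        refine integral_mono_of_nonneg (ae_of_all _ fun z => sq_nonneg _)
          ((I1.const_mul 2).add (integrable_const _)) (ae_of_all _ fun z => ?_)
        have h1 := hclose z
        have h2 := pow_le_pow_left₀ (abs_nonneg _) h1 2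
        rw [sq_abs, Real.sq_sqrt (by positivity)] at h2
        simp only
        nlinarith [sq_nonneg ((h z.1 z.2 - c z) - (c z - c (gridPoint _ (gridCell (M + 1) z.1),
          gridPoint _ (gridCell (M + 1) z.2))))]
    _ = 2 * (∫ z : I × I, (h z.1 z.2 - c z) ^ 2) + 2 * (η / 8) := by
        rw [integral_add (I1.const_mul 2) (integrable_const _), integral_const_mul]
        simp
    _ < η := by linarith

lemma of_step {m : ℕ} {q : I → Fin m} (hq : Measurable q) (H : Fin m → Fin m → ℝ) :
    IsBoundedKernel (fun u v => H (q u) (q v)) (∑ a, ∑ b, |H a b|) where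
  measurable := by
    have : Measurable fun z : Fin m × Fin m => H z.1 z.2 := measurable_of_finite _
    exact this.comp ((hq.comp measurable_fst).prodMk (hq.comp measurable_snd))
  bound u v := by
    have h1 := Finset.single_le_sum (f := fun b => |H (q u) b|) (fun b _ => abs_nonneg _)
      (Finset.mem_univ (q v))
    have h2 := Finset.single_le_sum (f := fun a => ∑ b, |H a b|)
      (fun a _ => Finset.sum_nonneg fun b _ => abs_nonneg _) (Finset.mem_univ (q u))
    exact h1.trans h2

lemma sub {h' : I → I → ℝ} {B' : ℝ} (hh : IsBoundedKernel h B) (hh' : IsBoundedKernel h' B') :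
    IsBoundedKernel (fun u v => h u v - h' u v) (B + B') where
  measurable := hh.measurable.sub hh'.measurable
  bound u v := (abs_sub _ _).trans (add_le_add (hh.bound u v) (hh'.bound u v))

/-- The range lies in the finite-dimensional span of the indicators of the cells. -/
lemma isCompactOperator_of_step {m : ℕ} {q : I → Fin m} (hq : Measurable q)
    (H : Fin m → Fin m → ℝ) {T : L2I →L[ℝ] L2I}
    (hT : ∀ g, T g =ᵐ[volume] fun u => ∫ v, H (q u) (q v) * g v) : IsCompactOperator T := by
  have hms : ∀ a, MeasurableSet (q ⁻¹' {a}) := fun a => hq (measurableSet_singleton a)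
  let e : Fin m → L2I := fun a => indicatorConstLp 2 (hms a) (measure_ne_top _ _) (1 : ℝ)
  let V : Submodule ℝ L2I := Submodule.span ℝ (Set.range e)
  have : FiniteDimensional ℝ V := FiniteDimensional.span_of_finite ℝ (Set.finite_range e)
  have hmem : ∀ g, T g ∈ V := fun g => by
    have hsum : T g = ∑ a, (∫ v, H a (q v) * g v) • e a := by
      refine Lp.ext ?_
      have h1 : ∀ᵐ u : I, ∀ a, ((∫ v, H a (q v) * g v) • e a : L2I) u =
          (∫ v, H a (q v) * g v) * (q ⁻¹' {a}).indicator (fun _ => (1 : ℝ)) u := by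
        rw [ae_all_iff]
        intro a
        filter_upwards [Lp.coeFn_smul (∫ v, H a (q v) * g v) (e a),
          indicatorConstLp_coeFn (p := 2) (hs := hms a) (hμs := measure_ne_top volume _)
            (c := (1 : ℝ))] with u h1 h2
        rw [h1, Pi.smul_apply, smul_eq_mul]
        congr 1
      have h2 := Lp.coeFn_finsetSum Finset.univ fun a => (∫ v, H a (q v) * g v) • e a
      filter_upwards [hT g, h1, h2] with u h3 h4 h5
      rw [h3, h5, Finset.sum_apply]
      simp only [h4]
      rw [Finset.sum_eq_single (q u)]
      · simp
      · intro b _ hb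
        rw [Set.indicator_of_notMem (by simpa using hb.symm), mul_zero]
      · simp
    rw [hsum]
    exact Submodule.sum_mem _ fun a _ => Submodule.smul_mem _ _
      (Submodule.subset_span (Set.mem_range_self a))
  exact (isCompactOperator_of_locallyCompactSpace_dom (T.codRestrict V hmem)).clm_comp V.subtypeL

/-- Integral operators with bounded measurable kernels are compact. -/
lemma isCompactOperator (hh : IsBoundedKernel h B) {T : L2I →L[ℝ] L2I}
    (hT : ∀ g, T g =ᵐ[volume] fun u => ∫ v, h u v * g v) : IsCompactOperator T := by
  -- The Hilbert-Schmidt bound turns `L²` approximation of kernels into approximation of operators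
  -- in norm, and norm limits of compact operators are compact.
  have hstep : ∀ k : ℕ, ∃ S : L2I →L[ℝ] L2I, IsCompactOperator S ∧ ‖T - S‖ ≤ 1 / ((k : ℝ) + 1) := by
    intro k
    obtain ⟨m, q, H, hq, hH⟩ := hh.exists_step_approx
      (show (0 : ℝ) < (1 / ((k : ℝ) + 1)) ^ 2 by positivity)
    obtain ⟨S, hS, -⟩ := (of_step hq H).exists_operator
    obtain ⟨D, hD, hDn⟩ := (hh.sub (of_step hq H)).exists_operator
    have hTS : T - S = D := by
      ext1 g
      refine Lp.ext ?_
      filter_upwards [hT g, hS g, hD g, Lp.coeFn_sub (T g) (S g)] with u h1 h2 h3 h4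
      rw [_root_.sub_apply, h4, Pi.sub_apply, h1, h2, h3,
        ← integral_sub (hh.integrable_mul u (L2I.integrable g))
          ((of_step hq H).integrable_mul u (L2I.integrable g))]
      congr 1; funext v; ring
    refine ⟨S, isCompactOperator_of_step hq H hS, ?_⟩
    rw [hTS]
    exact hDn.trans (Real.sqrt_le_iff.2 ⟨by positivity, hH.le⟩)
  choose S hSc hSn using hstep
  refine isCompactOperator_of_tendsto (F := S) (l := atTop) ?_ (Eventually.of_forall hSc)
  rw [tendsto_iff_norm_sub_tendsto_zero]
  refine squeeze_zero (fun _ => norm_nonneg _) (fun k => ?_) tendsto_one_div_add_atTop_nhds_zero_nat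
  rw [norm_sub_rev]
  exact hSn k

/-- For a bounded symmetric kernel, a positive supremum of the quadratic form is attained. -/
lemma exists_top_eigenfunction (hh : IsBoundedKernel h B) (hs : ∀ u v, h u v = h v u) {g : L2I}
    (hg : 0 < ∫ z : I × I, h z.1 z.2 * (g z.1 * g z.2)) :
    ∃ (μ : ℝ) (x : L2I), 0 < μ ∧ x ≠ 0 ∧ (∀ᵐ u, ∫ v, h u v * x v = μ * x u) ∧
      ∀ y : L2I, ∫ z : I × I, h z.1 z.2 * (y z.1 * y z.2) ≤ μ * ∫ u, y u ^ 2 := by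
  obtain ⟨T, hT, -⟩ := hh.exists_operator
  have hf : ∀ y : L2I, inner ℝ (T y) y = ∫ z : I × I, h z.1 z.2 * (y z.1 * y z.2) := fun y => by
    rw [real_inner_comm, hh.inner_operator hT]
  obtain ⟨μ, x, hμ, hx0, hx, hy⟩ := exists_top_eigenvector (hh.operator_symm hs hT)
    (hh.isCompactOperator hT) (g := g) (by rwa [hf])
  refine ⟨μ, x, hμ, hx0, ?_, fun y => ?_⟩
  · filter_upwards [hT x, Lp.coeFn_smul μ x] with u h1 h2
    rw [← h1, hx, h2, Pi.smul_apply, smul_eq_mul]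
  · rw [← hf, ← L2I.norm_sq]
    exact hy y

end IsBoundedKernel

lemma IsGraphon.isBoundedKernel {f : I → I → ℝ} (hf : IsGraphon f) : IsBoundedKernel f 1 where
  measurable := hf.measurable
  bound u v := by rw [abs_of_nonneg (hf.nonneg u v)]; exact hf.le_one u v

/-- The spectral gap of a graphon whose leading eigenvalue is simple: after removing the leading
eigenfunction, the quadratic form is bounded by a number below the leading eigenvalue. -/
lemma GraphonLeadingSimple.exists_gap {f : I → I → ℝ} (hf : IsGraphon f)
    (hs : GraphonLeadingSimple f) :
    ∃ (l μ B : ℝ) (φ : I → ℝ), 0 ≤ μ ∧ μ < l ∧ Measurable φ ∧ (∀ u, |φ u| ≤ B) ∧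
      ∫ u, φ u ^ 2 = 1 ∧ ∫ z : I × I, f z.1 z.2 * (φ z.1 * φ z.2) = l ∧
      ∀ y : L2I, ∫ z : I × I, (f z.1 z.2 - l * (φ z.1 * φ z.2)) * (y z.1 * y z.2)
        ≤ μ * ∫ u, y u ^ 2 := by
  obtain ⟨hsym, l, ⟨g₀, hg₀, hg₀ne, hg₀eig⟩, hmax, huniq⟩ := hs
  have hk := hf.isBoundedKernel
  have hEig : ∀ {m : ℝ} {x : L2I}, x ≠ 0 → (∀ᵐ u, ∫ v, f u v * x v = m * x u) →
      IsEigenfunction f m x := fun {m x} hx h =>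
    ⟨Lp.memLp x, fun h0 => hx ((Lp.eq_zero_iff_ae_eq_zero).2 h0), h⟩
  -- The form at the constant function one is `∫ f > 0`, so there is a positive eigenvalue, and `l`
  -- dominates it.
  have hlpos : 0 < l := by
    let one : L2I := (memLp_const (1 : ℝ)).toLp _
    have hone : ∀ᵐ u, one u = 1 := (memLp_const (1 : ℝ)).coeFn_toLp
    have hpos : 0 < ∫ z : I × I, f z.1 z.2 * (one z.1 * one z.2) := by
      have : ∫ z : I × I, f z.1 z.2 * (one z.1 * one z.2) = ∫ z : I × I, f z.1 z.2 := by
        have h1 : ∀ᵐ z : I × I, one z.1 = 1 := Measure.quasiMeasurePreserving_fst.ae hone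
        have h2 : ∀ᵐ z : I × I, one z.2 = 1 := Measure.quasiMeasurePreserving_snd.ae hone
        refine integral_congr_ae ?_
        filter_upwards [h1, h2] with z h1 h2
        rw [h1, h2, mul_one, mul_one]
      rw [this]; exact hf.integral_pos
    obtain ⟨μ, x, hμ, hx0, hx, -⟩ := hk.exists_top_eigenfunction hsym hpos
    exact hμ.trans_le ((le_abs_self μ).trans (hmax μ x (hEig hx0 hx)))
  set G : L2I := hg₀.toLp g₀ with hG
  have hGae : G =ᵐ[volume] g₀ := hg₀.coeFn_toLp
  have hG0 : G ≠ 0 := fun h => hg₀ne (hGae.symm.trans ((Lp.eq_zero_iff_ae_eq_zero).1 h))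
  set c := ‖G‖ with hc
  have hcpos : 0 < c := norm_pos_iff.2 hG0
  have hGeig : ∀ᵐ u, ∫ v, f u v * G v = l * G u := by
    filter_upwards [hg₀eig, hGae] with u h1 h2
    rw [h2, ← h1]
    exact integral_congr_ae (hGae.mono fun v hv => by simp only [hv])
  -- Applying the kernel to `G` selects a representative of `G / ‖G‖` that is defined everywhere,
  -- measurable and bounded, as needed to evaluate it at the sampled types.
  set φ : I → ℝ := fun u => (l * c)⁻¹ * ∫ v, f u v * G v with hφ
  have hφm : Measurable φ := (hk.measurable_integral G).const_mul _
  have hφB : ∀ u, |φ u| ≤ (l * c)⁻¹ * (1 * ∫ v, |G v|) := fun u => by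
    rw [hφ]
    simp only
    rw [abs_mul, abs_of_pos (by positivity : 0 < (l * c)⁻¹)]
    exact mul_le_mul_of_nonneg_left (hk.abs_integral_le (L2I.integrable G) u) (by positivity)
  set B := (l * c)⁻¹ * (1 * ∫ v, |G v|) with hB
  have hφL : MemLp φ 2 volume := MemLp.of_bound hφm.aestronglyMeasurable B (ae_of_all _ hφB)
  have hφG : ∀ᵐ u, φ u = c⁻¹ * G u := by
    filter_upwards [hGeig] with u hu
    simp only [hφ]
    rw [hu]; field_simp
  set Φ : L2I := hφL.toLp φ with hΦ
  have hΦae : ∀ᵐ u, Φ u = φ u := hφL.coeFn_toLp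
  have hφeig : ∀ᵐ u, ∫ v, f u v * φ v = l * φ u := by
    filter_upwards [hGeig, hφG] with u h1 h2
    rw [h2, mul_left_comm, ← h1, ← integral_const_mul]
    refine integral_congr_ae ?_
    filter_upwards [hφG] with v hv
    rw [hv]; ring
  have hφ1 : ∫ u, φ u ^ 2 = 1 := by
    have h1 : ∫ u, φ u ^ 2 = ∫ u, (c⁻¹) ^ 2 * G u ^ 2 :=
      integral_congr_ae (hφG.mono fun u hu => by simp only [hu, mul_pow])
    rw [h1, integral_const_mul, ← L2I.norm_sq, ← hc]
    field_simp
  have hB0 : 0 ≤ B := (abs_nonneg _).trans (hφB 0)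
  have hφφ : IsBoundedKernel (fun u v => l * (φ u * φ v)) (l * (B * B)) := by
    refine ⟨((hφm.comp measurable_fst).mul (hφm.comp measurable_snd)).const_mul l, fun u v => ?_⟩
    rw [abs_mul, abs_mul, abs_of_pos hlpos]
    exact mul_le_mul_of_nonneg_left
      (mul_le_mul (hφB u) (hφB v) (abs_nonneg _) hB0) hlpos.le
  have hh := hk.sub hφφ
  have hint1 : Integrable φ volume := hφL.integrable (by norm_num)
  have hlform : ∫ z : I × I, f z.1 z.2 * (φ z.1 * φ z.2) = l := by
    have e : ∫ z : I × I, f z.1 z.2 * (φ z.1 * φ z.2) = ∫ u, ∫ v, f u v * (φ u * φ v) :=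
      integral_prod _ (hk.integrable_form hint1 hint1)
    have e2 : ∫ u, ∫ v, f u v * (φ u * φ v) = ∫ u, l * φ u ^ 2 := by
      refine integral_congr_ae ?_
      filter_upwards [hφeig] with u hu
      calc ∫ v, f u v * (φ u * φ v) = φ u * ∫ v, f u v * φ v := by
            rw [← integral_const_mul]; congr 1; funext v; ring
        _ = _ := by rw [hu]; ring
    rw [e, e2, integral_const_mul, hφ1, mul_one]
  -- If the deflated form is never positive, the gap holds with `μ = 0`. Otherwise its top value `μ`
  -- has an eigenfunction `x`, to be shown orthogonal to `φ` and hence an eigenfunction of `f`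
  -- itself.
  by_cases hcase : ∃ y : L2I, 0 < ∫ z : I × I, (f z.1 z.2 - l * (φ z.1 * φ z.2)) * (y z.1 * y z.2)
  · obtain ⟨y, hy⟩ := hcase
    obtain ⟨μ, x, hμ, hx0, hx, hform⟩ := hh.exists_top_eigenfunction
      (fun u v => by rw [hsym u v, mul_comm (φ u)]) hy
    have hxI := L2I.integrable x
    have hφx : Integrable (fun v => φ v * x v) volume :=
      hxI.bdd_mul (c := B) hφm.aestronglyMeasurable (ae_of_all _ hφB)
    have hsplit : ∀ u, ∫ v, (f u v - l * (φ u * φ v)) * x v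
        = (∫ v, f u v * x v) - l * φ u * ∫ v, φ v * x v := fun u => by
      rw [← integral_const_mul, ← integral_sub (hk.integrable_mul u hxI) (hφx.const_mul _)]
      congr 1; funext v; ring
    have hsplit' : ∀ᵐ u, (∫ v, f u v * x v) = μ * x u + l * φ u * ∫ v, φ v * x v := by
      filter_upwards [hx] with u hu
      rw [hsplit] at hu
      linarith
    -- With `s = ⟨φ, x⟩`, symmetry of the operator equates `l * s` with `μ * s + l * s`, and `μ >
    -- 0`.
    have horth : ∫ v, φ v * x v = 0 := by
      obtain ⟨T, hT, -⟩ := hk.exists_operator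
      have hTΦ : ∀ᵐ u, T Φ u = l * φ u := by
        filter_upwards [hT Φ, hφeig] with u h1 h2
        rw [h1, ← h2]
        exact integral_congr_ae (hΦae.mono fun v hv => by simp only [hv])
      have e1 : inner ℝ (T Φ) x = l * ∫ v, φ v * x v := by
        rw [L2I.inner_eq, ← integral_const_mul]
        refine integral_congr_ae (hTΦ.mono fun u hu => ?_)
        simp only [hu, mul_assoc]
      have e2 : inner ℝ Φ (T x) = μ * (∫ v, φ v * x v) + l * ∫ v, φ v * x v := by
        set s := ∫ v, φ v * x v with hs
        rw [L2I.inner_eq]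
        calc ∫ u, Φ u * T x u = ∫ u, (μ * (φ u * x u) + l * s * φ u ^ 2) := by
              refine integral_congr_ae ?_
              filter_upwards [hΦae, hT x, hsplit'] with u h1 h2 h3
              rw [h1, h2, h3]; ring
          _ = μ * s + l * s * 1 := by
              rw [integral_add (hφx.const_mul μ) (hφL.integrable_sq.const_mul _),
                integral_const_mul, integral_const_mul, hφ1]
          _ = _ := by rw [mul_one]
      have e3 := hk.operator_symm hsym hT Φ x
      rw [e1, e2] at e3
      have : μ * ∫ v, φ v * x v = 0 := by linarith
      exact (mul_eq_zero.1 this).resolve_left hμ.ne'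
    have hxeig : ∀ᵐ u, ∫ v, f u v * x v = μ * x u := by
      filter_upwards [hsplit'] with u hu
      rw [hu, horth, mul_zero, add_zero]
    have hIx := hEig hx0 hxeig
    have hle : μ ≤ l := (le_abs_self μ).trans (hmax μ x hIx)
    -- If `μ = l`, simplicity makes `x` a multiple of `φ`; being orthogonal to `φ`, it would vanish.
    have hne : μ ≠ l := fun hml => by
      rw [hml] at hIx
      obtain ⟨d, hd⟩ := huniq G x (hEig hG0 hGeig) hIx
      have hxφ : ∀ᵐ u, x u = d * c * φ u := by
        filter_upwards [hd, hφG] with u h1 h2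
        rw [h1, h2]; field_simp
      have h1 : ∫ v, φ v * x v = d * c := by
        calc ∫ v, φ v * x v = ∫ v, d * c * φ v ^ 2 :=
              integral_congr_ae (hxφ.mono fun v hv => by simp only [hv]; ring)
          _ = d * c := by rw [integral_const_mul, hφ1, mul_one]
      refine hx0 ((Lp.eq_zero_iff_ae_eq_zero).2 ?_)
      filter_upwards [hxφ] with u hu
      rw [hu, ← h1, horth, zero_mul, Pi.zero_apply]
    exact ⟨l, μ, B, φ, hμ.le, lt_of_le_of_ne hle hne, hφm, hφB, hφ1, hlform, hform⟩
  · push Not at hcase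
    exact ⟨l, 0, B, φ, le_rfl, hlpos, hφm, hφB, hφ1, hlform, fun y => by
      rw [zero_mul]; exact hcase y⟩

end CentralityOLS

end

/-! ### Quadratic forms sampled at finitely many types -/

noncomputable section

namespace CentralityOLS

section Step

variable {m : ℕ} {q : I → Fin m}

lemma integral_comp_eq_sum (hq : Measurable q) (F : Fin m → ℝ) :
    ∫ u, F (q u) = ∑ a, volume.real (q ⁻¹' {a}) * F a := by
  have : IsProbabilityMeasure (volume.map q) := Measure.isProbabilityMeasure_map hq.aemeasurable
  rw [← integral_map (f := F) hq.aemeasurable (measurable_of_finite F).aestronglyMeasurable,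
    integral_fintype Integrable.of_finite]
  refine Finset.sum_congr rfl fun a _ => ?_
  rw [smul_eq_mul, map_measureReal_apply hq (measurableSet_singleton a)]

/-- The quadratic form of a step kernel at a step function. -/
lemma step_form_le (hq : Measurable q) {H : Fin m → Fin m → ℝ} {ν : ℝ}
    (hν : ∀ y : L2I, ∫ z : I × I, H (q z.1) (q z.2) * (y z.1 * y z.2) ≤ ν * ∫ u, y u ^ 2)
    {X : Fin m → ℝ} (hX : ∀ a, volume.real (q ⁻¹' {a}) = 0 → X a = 0) :
    ∑ a, ∑ b, H a b * (X a * X b) ≤ ν * ∑ a, X a ^ 2 / volume.real (q ⁻¹' {a}) := by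
  set w : Fin m → ℝ := fun a => volume.real (q ⁻¹' {a}) with hw
  -- The step function with value `G a` on cell `a` has integral `X a` over that cell. On null cells
  -- the quotient is `0` by convention, consistently with `hX`.
  set G : Fin m → ℝ := fun a => X a / w a with hG
  have hwG : ∀ a, w a * G a = X a := fun a => by
    by_cases h : w a = 0
    · rw [h, zero_mul, hX a h]
    · rw [hG]; field_simp
  have hGm : Measurable fun u => G (q u) := (measurable_of_finite G).comp hq
  have hGb : ∀ u, |G (q u)| ≤ ∑ a, |G a| := fun u =>
    Finset.single_le_sum (f := fun a => |G a|) (fun a _ => abs_nonneg _) (Finset.mem_univ (q u))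
  have hGL : MemLp (fun u => G (q u)) 2 volume :=
    MemLp.of_bound hGm.aestronglyMeasurable _ (ae_of_all _ hGb)
  set y : L2I := hGL.toLp _ with hy
  have hyae : ∀ᵐ u, y u = G (q u) := hGL.coeFn_toLp
  have e1 : ∫ z : I × I, H (q z.1) (q z.2) * (y z.1 * y z.2) = ∑ a, ∑ b, H a b * (X a * X b) := by
    have h1 : ∀ᵐ z : I × I, y z.1 = G (q z.1) := Measure.quasiMeasurePreserving_fst.ae hyae
    have h2 : ∀ᵐ z : I × I, y z.2 = G (q z.2) := Measure.quasiMeasurePreserving_snd.ae hyae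
    have hI := hGL.integrable one_le_two
    calc ∫ z : I × I, H (q z.1) (q z.2) * (y z.1 * y z.2)
        = ∫ z : I × I, H (q z.1) (q z.2) * (G (q z.1) * G (q z.2)) := by
          refine integral_congr_ae ?_
          filter_upwards [h1, h2] with z h1 h2
          rw [h1, h2]
      _ = ∫ u, ∫ v, H (q u) (q v) * (G (q u) * G (q v)) :=
          integral_prod _ ((IsBoundedKernel.of_step hq H).integrable_form hI hI)
      _ = ∫ u, ∑ b, w b * (H (q u) b * (G (q u) * G b)) := by
          congr 1; funext u
          exact integral_comp_eq_sum hq fun b => H (q u) b * (G (q u) * G b)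
      _ = ∑ a, w a * ∑ b, w b * (H a b * (G a * G b)) :=
          integral_comp_eq_sum hq fun a => ∑ b, w b * (H a b * (G a * G b))
      _ = _ := by
          refine Finset.sum_congr rfl fun a _ => ?_
          rw [Finset.mul_sum]
          refine Finset.sum_congr rfl fun b _ => ?_
          rw [← hwG a, ← hwG b]; ring
  have e2 : ∫ u, y u ^ 2 = ∑ a, X a ^ 2 / w a := by
    calc ∫ u, y u ^ 2 = ∫ u, G (q u) ^ 2 :=
          integral_congr_ae (hyae.mono fun u hu => by simp only [hu])
      _ = ∑ a, w a * G a ^ 2 := integral_comp_eq_sum hq fun a => G a ^ 2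
      _ = _ := by
          refine Finset.sum_congr rfl fun a _ => ?_
          by_cases h : w a = 0
          · rw [h, zero_mul, div_zero]
          · simp only [hG]; field_simp
  have := hν y
  rwa [e1, e2] at this

/-- The sampled quadratic form of a step kernel, when no cell is over-represented. -/
lemma sampled_step_form_le (hq : Measurable q) {H : Fin m → Fin m → ℝ} {ν : ℝ} (hν0 : 0 ≤ ν)
    (hν : ∀ y : L2I, ∫ z : I × I, H (q z.1) (q z.2) * (y z.1 * y z.2) ≤ ν * ∫ u, y u ^ 2)
    {n : ℕ} {u : Fin n → I} {t : ℝ} (ht : 0 ≤ t)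
    (hcount : ∀ a, ∑ i, (q ⁻¹' {a}).indicator (fun _ => (1 : ℝ)) (u i)
      ≤ t * volume.real (q ⁻¹' {a}))
    (x : Fin n → ℝ) :
    ∑ i, ∑ j, H (q (u i)) (q (u j)) * (x i * x j) ≤ ν * (t * (x ⬝ᵥ x)) := by
  set w : Fin m → ℝ := fun a => volume.real (q ⁻¹' {a}) with hw
  set e : Fin m → Fin n → ℝ := fun a i => (q ⁻¹' {a}).indicator (fun _ => (1 : ℝ)) (u i) with he
  have he' : ∀ a i, e a i = if q (u i) = a then 1 else 0 := fun a i => by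
    by_cases h : q (u i) = a
    · rw [if_pos h]; exact Set.indicator_of_mem (show u i ∈ q ⁻¹' {a} from h) fun _ => (1 : ℝ)
    · rw [if_neg h]; exact Set.indicator_of_notMem (show u i ∉ q ⁻¹' {a} from h) fun _ => (1 : ℝ)
  set X : Fin m → ℝ := fun a => ∑ i, e a i * x i with hX
  have hee : ∀ a i, e a i * e a i = e a i := fun a i => by rw [he']; split_ifs <;> simp
  have he0 : ∀ a i, 0 ≤ e a i := fun a i => by rw [he']; split_ifs <;> simp
  -- Cauchy-Schwarz within a cell, whose number of sampled points is at most `t * w a`. For a null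
  -- cell this forces `X a = 0`, as the preceding lemma demands.
  have hXsq : ∀ a, X a ^ 2 ≤ (t * w a) * ∑ i, e a i * x i ^ 2 := fun a => by
    have h1 := Finset.sum_mul_sq_le_sq_mul_sq Finset.univ (fun i => e a i) fun i => e a i * x i
    have h2 : ∀ i, e a i * (e a i * x i) = e a i * x i := fun i => by rw [← mul_assoc, hee]
    have h3 : ∀ i, (e a i * x i) ^ 2 = e a i * x i ^ 2 := fun i => by
      rw [mul_pow, sq (e a i), hee]
    simp only [h2, h3, sq (e a _), hee] at h1
    exact h1.trans (mul_le_mul_of_nonneg_right (hcount a)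
      (Finset.sum_nonneg fun i _ => mul_nonneg (he0 a i) (sq_nonneg _)))
  have hX0 : ∀ a, w a = 0 → X a = 0 := fun a h => by
    have := hXsq a
    rw [h, mul_zero, zero_mul] at this
    exact pow_eq_zero_iff two_ne_zero |>.1 (le_antisymm this (sq_nonneg _))
  have hF : ∀ F : Fin m → ℝ, ∀ i, F (q (u i)) = ∑ a, e a i * F a := fun F i => by
    simp only [he', ite_mul, one_mul, zero_mul, Finset.sum_ite_eq, Finset.mem_univ, if_true]
  have hform : ∑ i, ∑ j, H (q (u i)) (q (u j)) * (x i * x j) = ∑ a, ∑ b, H a b * (X a * X b) := by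
    calc ∑ i, ∑ j, H (q (u i)) (q (u j)) * (x i * x j)
        = ∑ i, ∑ j, ∑ a, ∑ b, H a b * ((e a i * x i) * (e b j * x j)) := by
          refine Finset.sum_congr rfl fun i _ => Finset.sum_congr rfl fun j _ => ?_
          rw [hF (fun a => H a (q (u j))) i, Finset.sum_mul]
          refine Finset.sum_congr rfl fun a _ => ?_
          rw [hF (fun b => H a b) j, Finset.mul_sum, Finset.sum_mul]
          exact Finset.sum_congr rfl fun b _ => by ring
      _ = ∑ a, ∑ b, ∑ i, ∑ j, H a b * ((e a i * x i) * (e b j * x j)) := by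
          simp only [Finset.sum_comm (s := (Finset.univ : Finset (Fin n)))
            (t := (Finset.univ : Finset (Fin m)))]
      _ = _ := by
          refine Finset.sum_congr rfl fun a _ => Finset.sum_congr rfl fun b _ => ?_
          simp only [hX]
          rw [Finset.sum_mul_sum]
          simp only [Finset.mul_sum]
  rw [hform]
  refine (step_form_le hq hν hX0).trans (mul_le_mul_of_nonneg_left ?_ hν0)
  calc ∑ a, X a ^ 2 / w a ≤ ∑ a, t * ∑ i, e a i * x i ^ 2 := by
        refine Finset.sum_le_sum fun a _ => ?_
        have hw0 : 0 ≤ w a := measureReal_nonneg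
        have hs : 0 ≤ ∑ i, e a i * x i ^ 2 :=
          Finset.sum_nonneg fun i _ => mul_nonneg (he0 a i) (sq_nonneg _)
        refine div_le_of_le_mul₀ hw0 (mul_nonneg ht hs) ((hXsq a).trans (le_of_eq (by ring)))
    _ = t * (x ⬝ᵥ x) := by
        rw [← Finset.mul_sum, Finset.sum_comm, ← sum_sq_eq_dotProduct_self]
        congr 1
        refine Finset.sum_congr rfl fun i _ => ?_
        rw [← hF (fun _ => x i ^ 2) i]

end Step

lemma sum_offDiag_eq {n : ℕ} (F : Fin n → Fin n → ℝ) :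
    ∑ z ∈ (Finset.univ : Finset (Fin n)).offDiag, F z.1 z.2
      = ∑ i, ∑ j, F i j - ∑ i, F i i := by
  have h1 : ∑ i, ∑ j, F i j = ∑ z ∈ (Finset.univ : Finset (Fin n)).diag, F z.1 z.2 +
      ∑ z ∈ (Finset.univ : Finset (Fin n)).offDiag, F z.1 z.2 := by
    rw [← Finset.sum_union (Finset.disjoint_diag_offDiag _), Finset.diag_union_offDiag,
      Finset.univ_product_univ, Fintype.sum_prod_type]
  have h2 : ∑ z ∈ (Finset.univ : Finset (Fin n)).diag, F z.1 z.2 = ∑ i, F i i := by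
    rw [Finset.sum_diag]
  rw [h1, h2]; ring

/-- Symmetry of `f` makes the ordering by `min` and `max` irrelevant, and the zero diagonal leaves
the off-diagonal pairs. -/
lemma adjacency_form {f : I → I → ℝ} (hs : ∀ u v, f u v = f v u) (p : ℝ) {n : ℕ} (u : Fin n → I)
    (x : Fin n → ℝ) : x ⬝ᵥ adjacency f p u *ᵥ x =
      p * ∑ z ∈ (Finset.univ : Finset (Fin n)).offDiag, f (u z.1) (u z.2) * (x z.1 * x z.2) := by
  have hentry : ∀ i j, adjacency f p u i j = if i = j then 0 else p * f (u i) (u j) := fun i j => by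
    simp only [adjacency, Matrix.of_apply]
    rcases le_total i j with h | h
    · rw [min_eq_left h, max_eq_right h]
    · rw [min_eq_right h, max_eq_left h, hs]
  have h1 : x ⬝ᵥ adjacency f p u *ᵥ x = ∑ i, ∑ j, x i * (adjacency f p u i j * x j) := by
    simp only [dotProduct, Matrix.mulVec, Finset.mul_sum]
  have h2 := sum_offDiag_eq fun i j => x i * (adjacency f p u i j * x j)
  have h3 : ∑ i, x i * (adjacency f p u i i * x i) = 0 :=
    Finset.sum_eq_zero fun i _ => by rw [hentry, if_pos rfl]; ring
  rw [h3, sub_zero] at h2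
  rw [h1, ← h2, Finset.mul_sum]
  refine Finset.sum_congr rfl fun z hz => ?_
  rw [hentry, if_neg (Finset.mem_offDiag.1 hz).2.2]; ring

/-- The sampled quadratic form of a kernel that is close to a step kernel plus a kernel of rank
one. -/
lemma sampled_form_le {f : I → I → ℝ} {l : ℝ} (hl : 0 ≤ l) {φ : I → ℝ} {m : ℕ} {q : I → Fin m}
    (hq : Measurable q) {H : Fin m → Fin m → ℝ} {ν : ℝ} (hν0 : 0 ≤ ν)
    (hν : ∀ y : L2I, ∫ z : I × I, H (q z.1) (q z.2) * (y z.1 * y z.2) ≤ ν * ∫ u, y u ^ 2)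
    {n : ℕ} {u : Fin n → I} {t ρ B : ℝ} (ht : 0 ≤ t) (hρ : 0 ≤ ρ) (hB : ∀ a b, |H a b| ≤ B)
    (hcount : ∀ a, ∑ i, (q ⁻¹' {a}).indicator (fun _ => (1 : ℝ)) (u i)
      ≤ t * volume.real (q ⁻¹' {a}))
    (hr : ∑ z ∈ (Finset.univ : Finset (Fin n)).offDiag,
      (f (u z.1) (u z.2) - l * (φ (u z.1) * φ (u z.2)) - H (q (u z.1)) (q (u z.2))) ^ 2 ≤ ρ ^ 2)
    (x : Fin n → ℝ) :
    ∑ z ∈ (Finset.univ : Finset (Fin n)).offDiag, f (u z.1) (u z.2) * (x z.1 * x z.2) ≤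
      (ν * t + ρ + B) * (x ⬝ᵥ x) + l * ((fun i => φ (u i)) ⬝ᵥ x) ^ 2 := by
  set D := (Finset.univ : Finset (Fin n)).offDiag with hD
  set r : Fin n × Fin n → ℝ := fun z =>
    f (u z.1) (u z.2) - l * (φ (u z.1) * φ (u z.2)) - H (q (u z.1)) (q (u z.2)) with hrdef
  have hxx := dotProduct_self_nonneg x
  have hsplit : ∑ z ∈ D, f (u z.1) (u z.2) * (x z.1 * x z.2) =
      ∑ z ∈ D, H (q (u z.1)) (q (u z.2)) * (x z.1 * x z.2) +
      ∑ z ∈ D, r z * (x z.1 * x z.2) +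
      l * ∑ z ∈ D, (φ (u z.1) * x z.1) * (φ (u z.2) * x z.2) := by
    rw [Finset.mul_sum, ← Finset.sum_add_distrib, ← Finset.sum_add_distrib]
    refine Finset.sum_congr rfl fun z _ => ?_
    simp only [hrdef]; ring
  -- The bound for step kernels includes the diagonal; removing it costs at most `B` times the
  -- squared norm.
  have h1 : ∑ z ∈ D, H (q (u z.1)) (q (u z.2)) * (x z.1 * x z.2) ≤ (ν * t + B) * (x ⬝ᵥ x) := by
    rw [hD, sum_offDiag_eq fun i j => H (q (u i)) (q (u j)) * (x i * x j)]
    have h2 := sampled_step_form_le hq hν0 hν ht hcount x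
    have h3 : -∑ i, H (q (u i)) (q (u i)) * (x i * x i) ≤ B * (x ⬝ᵥ x) := by
      rw [← Finset.sum_neg_distrib, dotProduct, Finset.mul_sum]
      refine Finset.sum_le_sum fun i _ => ?_
      rw [← neg_mul]
      exact mul_le_mul_of_nonneg_right ((neg_le_abs _).trans (hB _ _)) (mul_self_nonneg _)
    linarith
  have h2 : ∑ z ∈ D, r z * (x z.1 * x z.2) ≤ ρ * (x ⬝ᵥ x) := by
    -- Cauchy-Schwarz over pairs: the remainder is controlled by its Frobenius norm.
    refine le_of_sq_le_sq ?_ (by positivity)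
    have hcs := Finset.sum_mul_sq_le_sq_mul_sq D r fun z => x z.1 * x z.2
    have hx : ∑ z ∈ D, (x z.1 * x z.2) ^ 2 ≤ (x ⬝ᵥ x) ^ 2 := by
      calc _ ≤ ∑ z : Fin n × Fin n, (x z.1 * x z.2) ^ 2 :=
            Finset.sum_le_sum_of_subset_of_nonneg (Finset.subset_univ _) fun z _ _ => sq_nonneg _
        _ = _ := by
            rw [← sum_sq_eq_dotProduct_self, sq (∑ i, x i ^ 2), Finset.sum_mul_sum,
              ← Fintype.sum_prod_type']
            exact Finset.sum_congr rfl fun z _ => mul_pow _ _ _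
    calc _ ≤ _ := hcs
      _ ≤ ρ ^ 2 * (x ⬝ᵥ x) ^ 2 := mul_le_mul hr hx
          (Finset.sum_nonneg fun z _ => sq_nonneg _) (sq_nonneg _)
      _ = _ := by ring
  -- Restoring the diagonal of the rank-one term only adds squares.
  have h3 : ∑ z ∈ D, (φ (u z.1) * x z.1) * (φ (u z.2) * x z.2) ≤
      ((fun i => φ (u i)) ⬝ᵥ x) ^ 2 := by
    rw [hD, sum_offDiag_eq fun i j => (φ (u i) * x i) * (φ (u j) * x j), sq, dotProduct,
      Finset.sum_mul_sum]
    have : 0 ≤ ∑ i, (φ (u i) * x i) * (φ (u i) * x i) :=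
      Finset.sum_nonneg fun i _ => mul_self_nonneg _
    linarith
  rw [hsplit]
  have := mul_le_mul_of_nonneg_left h3 hl
  nlinarith

end CentralityOLS

end

/-! ### Simplicity of the leading eigenvalue of the network -/

noncomputable section

namespace CentralityOLS

/-- A step kernel close in `L²` to a given kernel has a quadratic form that is almost as small. -/
lemma IsBoundedKernel.form_le_of_close {h h' : I → I → ℝ} {B B' μ η : ℝ}
    (hh : IsBoundedKernel h B) (hh' : IsBoundedKernel h' B') (hη : 0 ≤ η)
    (hclose : ∫ z : I × I, (h z.1 z.2 - h' z.1 z.2) ^ 2 ≤ η ^ 2)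
    (hμ : ∀ y : L2I, ∫ z : I × I, h z.1 z.2 * (y z.1 * y z.2) ≤ μ * ∫ u, y u ^ 2) (y : L2I) :
    ∫ z : I × I, h' z.1 z.2 * (y z.1 * y z.2) ≤ (μ + η) * ∫ u, y u ^ 2 := by
  obtain ⟨D, hD, hDn⟩ := (hh.sub hh').exists_operator
  have hyI := L2I.integrable y
  have hDle : ‖D‖ ≤ η := hDn.trans (Real.sqrt_le_iff.2 ⟨hη, hclose⟩)
  have h1 : -(η * ∫ u, y u ^ 2) ≤
      ∫ z : I × I, (h z.1 z.2 - h' z.1 z.2) * (y z.1 * y z.2) := by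
    rw [← (hh.sub hh').inner_operator hD y y, ← L2I.norm_sq]
    refine neg_le_of_abs_le ((abs_real_inner_le_norm _ _).trans ?_)
    calc ‖y‖ * ‖D y‖ ≤ ‖y‖ * (η * ‖y‖) := by
          refine mul_le_mul_of_nonneg_left ((D.le_opNorm y).trans ?_) (norm_nonneg _)
          exact mul_le_mul_of_nonneg_right hDle (norm_nonneg _)
      _ = η * ‖y‖ ^ 2 := by ring
  have h2 : ∫ z : I × I, (h z.1 z.2 - h' z.1 z.2) * (y z.1 * y z.2) =
      (∫ z : I × I, h z.1 z.2 * (y z.1 * y z.2)) -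
        ∫ z : I × I, h' z.1 z.2 * (y z.1 * y z.2) := by
    rw [← integral_sub (hh.integrable_form hyI hyI) (hh'.integrable_form hyI hyI)]
    congr 1; funext z; ring
  rw [add_mul]
  linarith [hμ y]

variable {Ω : Type*} [MeasurableSpace Ω] {P : Measure Ω} [IsProbabilityMeasure P]
  {U : ℕ → Ω → I} {ε : ℕ → Ω → ℝ} {f : I → I → ℝ} {p : ℕ → ℝ}

/-- With probability tending to one, no cell of a finite partition is over-represented among the
types. -/
lemma IsSample.tendsto_measure_count (hU : IsSample P U ε) {m : ℕ} {q : I → Fin m}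
    (hq : Measurable q) {η : ℝ} (hη : 0 < η) :
    Tendsto (fun n : ℕ => P {ω | ¬ ∀ a, ∑ i : Fin n, (q ⁻¹' {a}).indicator (fun _ => (1 : ℝ))
      (U i ω) ≤ (1 + η) * n * volume.real (q ⁻¹' {a})}) atTop (𝓝 0) := by
  have hms : ∀ a, MeasurableSet (q ⁻¹' {a}) := fun a => hq (measurableSet_singleton a)
  have hone : ∀ a, Tendsto (fun n : ℕ => P {ω | ¬ ∑ i : Fin n,
      (q ⁻¹' {a}).indicator (fun _ => (1 : ℝ)) (U i ω) ≤
      (1 + η) * n * volume.real (q ⁻¹' {a})}) atTop (𝓝 0) := by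
    intro a
    set w := volume.real (q ⁻¹' {a}) with hw
    have hw0 : 0 ≤ w := measureReal_nonneg
    -- A null cell leaves no margin for the law of large numbers, but almost surely it contains no
    -- type at all. Otherwise the margin is `η * w` per agent.
    rcases hw0.eq_or_lt with h0 | hpos
    · have hnull : ∀ n : ℕ, P {ω | ¬ ∑ i : Fin n,
          (q ⁻¹' {a}).indicator (fun _ => (1 : ℝ)) (U i ω) ≤ (1 + η) * n * w} = 0 := fun n => by
        have h1 : ∀ᵐ ω ∂P, ∀ i : ℕ, U i ω ∉ q ⁻¹' {a} := by
          rw [ae_all_iff]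
          intro i
          have hv : (volume : Measure I) (q ⁻¹' {a}) = 0 :=
            (measureReal_eq_zero_iff (measure_ne_top _ _)).1 h0.symm
          rw [← hU.uniform i, Measure.map_apply (hU.measurable_type i) (hms a)] at hv
          exact measure_eq_zero_iff_ae_notMem.1 hv
        refine measure_mono_null (fun ω hω => ?_) (ae_iff.1 h1)
        refine fun hall => hω ?_
        rw [Finset.sum_eq_zero fun (i : Fin n) _ => Set.indicator_of_notMem (hall i) _, ← h0,
          mul_zero]
      simp only [hnull]
      exact tendsto_const_nhds
    · have hgm : Measurable ((q ⁻¹' {a}).indicator fun _ => (1 : ℝ)) :=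
        measurable_const.indicator (hms a)
      have hgb : ∀ u, |(q ⁻¹' {a}).indicator (fun _ => (1 : ℝ)) u| ≤ 1 := fun u => by
        by_cases hu : u ∈ q ⁻¹' {a}
        · rw [Set.indicator_of_mem hu, abs_one]
        · rw [Set.indicator_of_notMem hu, abs_zero]; exact zero_le_one
      have hint : ∫ u, (q ⁻¹' {a}).indicator (fun _ => (1 : ℝ)) u = w := by
        rw [integral_indicator_const _ (hms a), smul_eq_mul, mul_one]
      have hlim := hU.tendsto_measure_sum hgm hgb (mul_pos hη hpos)
      refine tendsto_of_tendsto_of_tendsto_of_le_of_le tendsto_const_nhds hlim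
        (fun _ => zero_le) fun n => measure_mono fun ω hω => ?_
      simp only [Set.mem_ofPred_eq, not_le] at hω ⊢
      rw [Finset.sum_sub_distrib, hint, Finset.sum_const, Finset.card_univ, Fintype.card_fin,
        nsmul_eq_mul]
      refine le_trans ?_ (le_abs_self _)
      linarith
  have hsum : Tendsto (fun n : ℕ => ∑ a, P {ω | ¬ ∑ i : Fin n,
      (q ⁻¹' {a}).indicator (fun _ => (1 : ℝ)) (U i ω) ≤
      (1 + η) * n * volume.real (q ⁻¹' {a})}) atTop (𝓝 0) := by
    simpa using tendsto_finsetSum Finset.univ fun a _ => hone a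
  refine tendsto_of_tendsto_of_tendsto_of_le_of_le tendsto_const_nhds hsum
    (fun _ => zero_le) fun n => ?_
  refine (measure_mono fun ω hω => ?_).trans (measure_iUnion_fintype_le P _)
  simp only [Set.mem_ofPred_eq, not_forall] at hω
  exact Set.mem_iUnion.2 hω

lemma sum_offDiag_const (n : ℕ) (c : ℝ) :
    ∑ _z ∈ (Finset.univ : Finset (Fin n)).offDiag, c = ((n : ℝ) ^ 2 - n) * c := by
  rw [sum_offDiag_eq (n := n) fun _ _ => c]
  simp only [Finset.sum_const, Finset.card_univ, Fintype.card_fin, nsmul_eq_mul]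
  ring

/-- If the leading eigenvalue of a symmetric graphon is simple, then so is the leading eigenvalue
of the sampled network, with probability tending to one. -/
theorem tendsto_measure_not_simple (hf : IsGraphon f) (hs : GraphonLeadingSimple f)
    (hp : ∀ n, 0 < p n) (hU : IsSample P U ε) :
    Tendsto (fun n => P {ω | ¬ LeadingEigenvalueSimple (network f p U n ω)}) atTop (𝓝 0) := by
  obtain ⟨l, μ, B, φ, hμ0, hμl, hφm, hφB, hφ1, hφl, hgap⟩ := hs.exists_gap hf
  have hl0 : 0 < l := hμ0.trans_lt hμl
  have hB0 : 0 ≤ B := (abs_nonneg _).trans (hφB 0)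
  -- At `η = 0` the inequality reads `μ < l`, so it persists for small `η`. On the left are the step
  -- form with over-represented cells, the remainder `2 * η`, the diagonal `η`, and the factor for
  -- the norm of the sampled `φ`; on the right is the sampled form at `φ`.
  obtain ⟨η, hη, hη1⟩ : ∃ η : ℝ, 0 < η ∧
      ((μ + η) * (1 + η) + 2 * η + η) * (1 + η) < l - 2 * η := by
    have hc : Continuous fun η : ℝ =>
        ((μ + η) * (1 + η) + 2 * η + η) * (1 + η) - (l - 2 * η) := by fun_prop
    have h0 : ∀ᶠ η in 𝓝 (0 : ℝ), ((μ + η) * (1 + η) + 2 * η + η) * (1 + η) - (l - 2 * η) < 0 :=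
      hc.continuousAt.eventually_lt continuousAt_const (by simpa using hμl)
    obtain ⟨η, h1, h2⟩ := ((h0.filter_mono nhdsWithin_le_nhds).and
      (self_mem_nhdsWithin (s := Set.Ioi (0 : ℝ)))).exists
    exact ⟨η, h2, by linarith⟩
  have hk := hf.isBoundedKernel
  have hφφm : Measurable fun z : I × I => φ z.1 * φ z.2 :=
    (hφm.comp measurable_fst).mul (hφm.comp measurable_snd)
  have hφφB : ∀ u v, |φ u * φ v| ≤ B * B := fun u v => by
    rw [abs_mul]; exact mul_le_mul (hφB u) (hφB v) (abs_nonneg _) hB0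
  have hh : IsBoundedKernel (fun u v => f u v - l * (φ u * φ v)) (1 + l * (B * B)) := by
    refine hk.sub (h' := fun u v => l * (φ u * φ v)) ⟨hφφm.const_mul l, fun u v => ?_⟩
    rw [abs_mul, abs_of_pos hl0]
    exact mul_le_mul_of_nonneg_left (hφφB u v) hl0.le
  obtain ⟨m, q, H, hq, hH⟩ := hh.exists_step_approx (show 0 < η ^ 2 by positivity)
  have hst := IsBoundedKernel.of_step hq H
  set b := ∑ a, ∑ b, |H a b| with hb
  have hHb : ∀ a a', |H a a'| ≤ b := fun a a' =>
    (Finset.single_le_sum (f := fun a' => |H a a'|) (fun _ _ => abs_nonneg _)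
      (Finset.mem_univ a')).trans
    (Finset.single_le_sum (f := fun a => ∑ a', |H a a'|)
      (fun _ _ => Finset.sum_nonneg fun _ _ => abs_nonneg _) (Finset.mem_univ a))
  have hform := hh.form_le_of_close hst hη.le hH.le hgap
  have hr := hh.sub hst
  have L1 := hU.tendsto_measure_count hq hη
  have L2 := hU.tendsto_measure_sum_pairs
    (h := fun u v => (f u v - l * (φ u * φ v) - H (q u) (q v)) ^ 2)
    (hr.measurable.pow_const 2) (B := (1 + l * (B * B) + b) ^ 2)
    (fun u v => by
      rw [abs_pow]; exact pow_le_pow_left₀ (abs_nonneg _) (hr.bound u v) 2)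
    (s := fun n => Finset.univ.offDiag) (fun n z hz => (Finset.mem_offDiag.1 hz).2.2)
    (show 0 < η ^ 2 by positivity)
  have L3 := hU.tendsto_measure_sum_pairs (h := fun u v => f u v * (φ u * φ v))
    (hf.measurable.mul hφφm) (B := 1 * (B * B))
    (fun u v => by
      rw [abs_mul]; exact mul_le_mul (hk.bound u v) (hφφB u v) (abs_nonneg _) zero_le_one)
    (s := fun n => Finset.univ.offDiag) (fun n z hz => (Finset.mem_offDiag.1 hz).2.2) hη
  have L4 := hU.tendsto_measure_sum (g := fun u => φ u ^ 2) (hφm.pow_const 2) (B := B ^ 2)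
    (fun u => by rw [abs_pow]; exact pow_le_pow_left₀ (abs_nonneg _) (hφB u) 2) hη
  have L := ((L1.add L2).add L3).add L4
  simp only [add_zero] at L
  refine tendsto_of_tendsto_of_tendsto_of_le_of_le' tendsto_const_nhds L
    (Eventually.of_forall fun _ => zero_le) ?_
  -- These thresholds make the two diagonal corrections, `b` in the step form and `l * n` in the
  -- form at `φ`, at most `η * n` and `η * n ^ 2`.
  filter_upwards [eventually_gt_atTop 0, eventually_ge_atTop ⌈b / η⌉₊,
    eventually_ge_atTop ⌈l / η⌉₊] with n hn hnb hnl
  have hn' : (0 : ℝ) < n := by exact_mod_cast hn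
  have hbn : b ≤ η * n := by
    rw [← div_le_iff₀' hη]; exact Nat.ceil_le.1 hnb
  have hln : l ≤ η * n := by
    rw [← div_le_iff₀' hη]; exact Nat.ceil_le.1 hnl
  refine (measure_mono ?_).trans ((measure_union_le _ _).trans (add_le_add_left
    ((measure_union_le _ _).trans (add_le_add_left (measure_union_le _ _) _)) _))
  intro ω hω
  by_contra hgood
  simp only [Set.mem_union, Set.mem_ofPred_eq, not_or, not_not, not_le] at hgood
  obtain ⟨⟨⟨g1, g2⟩, g3⟩, g4⟩ := hgood
  refine hω ?_
  rw [network_eq]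
  set u := types U n ω with hu
  set y : Fin n → ℝ := fun i => φ (u i) with hy
  set s := p n * (((μ + η) * (1 + η) + 2 * η + η) * n) with hsdef
  -- The mean and the deviation of the squared remainder contribute at most `η ^ 2 * n ^ 2` each,
  -- and `2 * η ^ 2 ≤ (2 * η) ^ 2`.
  have hr2 : ∑ z ∈ (Finset.univ : Finset (Fin n)).offDiag,
      (f (u z.1) (u z.2) - l * (φ (u z.1) * φ (u z.2)) - H (q (u z.1)) (q (u z.2))) ^ 2
      ≤ (2 * η * n) ^ 2 := by
    have h1 := (le_abs_self _).trans g2.le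
    rw [Finset.sum_sub_distrib, sum_offDiag_const] at h1
    have h2 : ((n : ℝ) ^ 2 - n) * ∫ z : I × I,
        (f z.1 z.2 - l * (φ z.1 * φ z.2) - H (q z.1) (q z.2)) ^ 2 ≤ (n : ℝ) ^ 2 * η ^ 2 :=
      mul_le_mul (by linarith) hH.le (integral_nonneg fun z => sq_nonneg _) (sq_nonneg _)
    have h3 : 0 ≤ (n : ℝ) ^ 2 * η ^ 2 := by positivity
    change ∑ z ∈ (Finset.univ : Finset (Fin n)).offDiag, (f (U z.1 ω) (U z.2 ω)
      - l * (φ (U z.1 ω) * φ (U z.2 ω)) - H (q (U z.1 ω)) (q (U z.2 ω))) ^ 2 ≤ _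
    nlinarith
  have hle : ∀ x, x ⬝ᵥ adjacency f (p n) u *ᵥ x ≤ s * (x ⬝ᵥ x) + (p n * l) * (y ⬝ᵥ x) ^ 2 := by
    intro x
    rw [adjacency_form hs.1]
    have h1 := sampled_form_le hl0.le hq (by linarith : 0 ≤ μ + η) hform
      (by positivity : 0 ≤ (1 + η) * (n : ℝ)) (by positivity : 0 ≤ 2 * η * (n : ℝ)) hHb g1 hr2 x
    have h2 : ((μ + η) * ((1 + η) * n) + 2 * η * n + b) * (x ⬝ᵥ x) ≤
        (((μ + η) * (1 + η) + 2 * η + η) * n) * (x ⬝ᵥ x) :=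
      mul_le_mul_of_nonneg_right (by nlinarith) (dotProduct_self_nonneg x)
    calc _ ≤ p n * ((((μ + η) * (1 + η) + 2 * η + η) * n) * (x ⬝ᵥ x) + l * (y ⬝ᵥ x) ^ 2) :=
          mul_le_mul_of_nonneg_left (h1.trans (add_le_add h2 le_rfl)) (hp n).le
      _ = _ := by rw [hsdef]; ring
  have hyy : y ⬝ᵥ y ≤ (1 + η) * n := by
    have h1 := (le_abs_self _).trans g4.le
    rw [Finset.sum_sub_distrib, hφ1, Finset.sum_const, Finset.card_univ, Fintype.card_fin,
      nsmul_eq_mul] at h1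
    rw [← sum_sq_eq_dotProduct_self]
    change ∑ i : Fin n, φ (U i ω) ^ 2 ≤ _
    linarith
  -- One `η` pays for the deviation from the mean `l`, the other for having `n ^ 2 - n` instead of
  -- `n ^ 2` pairs.
  have hyA : (p n) * ((l - 2 * η) * (n : ℝ) ^ 2) ≤ y ⬝ᵥ adjacency f (p n) u *ᵥ y := by
    rw [adjacency_form hs.1]
    refine mul_le_mul_of_nonneg_left ?_ (hp n).le
    have h1 := (neg_le_abs _).trans g3.le
    rw [Finset.sum_sub_distrib, sum_offDiag_const, hφl] at h1
    change _ ≤ ∑ z ∈ (Finset.univ : Finset (Fin n)).offDiag,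
      f (U z.1 ω) (U z.2 ω) * (φ (U z.1 ω) * φ (U z.2 ω))
    nlinarith
  refine leadingEigenvalueSimple_of_form_le hn (isSymm_adjacency f (p n) u)
    (hf.adjacency_nonneg (hp n).le u) hle (lt_of_lt_of_le ?_ hyA)
  have hcoef : 0 ≤ ((μ + η) * (1 + η) + 2 * η + η) * n := by positivity
  calc s * (y ⬝ᵥ y) ≤ s * ((1 + η) * n) :=
        mul_le_mul_of_nonneg_left hyy (mul_nonneg (hp n).le hcoef)
    _ = p n * ((((μ + η) * (1 + η) + 2 * η + η) * (1 + η)) * (n : ℝ) ^ 2) := by rw [hsdef]; ring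
    _ < _ := mul_lt_mul_of_pos_left (mul_lt_mul_of_pos_right hη1 (by positivity)) (hp n)

end CentralityOLS

end

open CentralityOLS in
theorem theorem1 {Ω : Type*} [MeasurableSpace Ω] (P : Measure Ω) [IsProbabilityMeasure P]
    (f : I → I → ℝ) (hf : IsGraphon f)
    (p : ℕ → ℝ) (hp : ∀ n, 0 < p n ∧ p n ≤ 1)
    (U : ℕ → Ω → I) (ε : ℕ → Ω → ℝ) (hU : IsSample P U ε)
    (lo hi κ : ℝ) (hε : ErrorMoments P U ε lo hi κ) (β : ℝ) :
    -- degree centrality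
    (OLSConsistent P β ε (fun n ω => degreeCentrality (network f p U n ω)) ↔
      Tendsto (fun n : ℕ => p n / (n : ℝ) ^ (-(3 / 2) : ℝ)) atTop atTop) ∧
    -- diffusion centrality
    (∀ (δ : ℝ) (T : ℕ), 0 < δ → δ ≤ 1 → 1 ≤ T →
      (OLSConsistent P β ε (fun n ω => diffusionCentrality δ T (network f p U n ω)) ↔
        Tendsto (fun n : ℕ => p n / (n : ℝ) ^ (-(3 / 2) : ℝ)) atTop atTop)) ∧
    -- eigenvector centrality
    (GraphonLeadingSimple f →
      -- the leading eigenvector is well defined, up to its sign, with probability tending to one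
      Tendsto (fun n => P {ω | ¬ LeadingEigenvalueSimple (network f p U n ω)}) atTop (𝓝 0) ∧
      -- whichever unit leading eigenvector `v n ω` is taken
      ∀ (a : ℕ → ℝ) (v : (n : ℕ) → Ω → Fin n → ℝ), (∀ n, 0 < a n) →
        (∀ n, 0 < n → ∀ ω, IsLeadingEigenvector (network f p U n ω) (v n ω)) →
        (OLSConsistent P β ε (fun n ω => a n • v n ω) ↔ Tendsto a atTop atTop)) := by
  have hp0 : ∀ n, 0 < p n := fun n => (hp n).1
  refine ⟨?_, fun δ T hδ hδ1 hT => consistent_diffusion_iff hf hp0 hU hε β hδ hδ1 hT, fun hs => ?_⟩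
  · simp only [degreeCentrality_eq_diffusionCentrality]
    exact consistent_diffusion_iff hf hp0 hU hε β one_pos le_rfl le_rfl
  · have hsimple := tendsto_measure_not_simple hf hs hp0 hU
    exact ⟨hsimple, fun a v ha hv => consistent_eigenvector_iff hf hp0 hU hε β hsimple ha hv⟩
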